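/- There are a single deterministic algorithm and an absolute constant $C$ such that the following holds for all integers $d\ge 0$ and $n\ge k\ge 1$. Let $G=(V,E)$ be a $d$-degenerate graph on $n$ vertices (every nonempty subgraph of $G$ has a vertex of degree at most $d$), with positive real edge weights $w:E\to\mathbb{R}^+$. On input $(G,w,k)$ the algorithm finds a set $S\subseteq V$ with $|S|=k$ for which the total weight $$E_G(S)=\sum_{e\in E,\ e\cap S\neq\emptyset} w(e)$$ of the edges with at least one endpoint in $S$ is maximum among all $k$-element subsets of $V$, and it runs in time at most $$C\cdot 2^{kd+k}\,(kd)^{C\log(kd)}\,n^{C},$$ that is, in time $2^{kd+k}(kd)^{O(\log (kd))}n^{O(1)}$ (for $d=0$ the middle factor is read as $1$). Here running time is measured on a random access machine which is charged logarithmic cost for operations on natural numbers and unit cost for adding, subtracting, comparing and moving exact real numbers. The graph and its weights are given by the adjacency matrix and the matrix of weights, together with $n$ and $k$. -/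

import Mathlib

/-! ### Graphs -/

/-- A graph is `d`-degenerate if every nonempty (finite) induced subgraph, equivalently every
nonempty finite subgraph, has a vertex of degree at most `d`. -/
def SimpleGraph.IsDegenerate {V : Type*} (G : SimpleGraph V) (d : ℕ) : Prop :=
  ∀ U : Finset V, U.Nonempty → ∃ v ∈ U, ((U : Set V) ∩ G.neighborSet v).ncard ≤ d

open Classical in
/-- The total weight of the edges of `G` with at least one endpoint in `S`.
Only the values of `w` on edges of `G` matter. -/
noncomputable def SimpleGraph.coveredWeight {V : Type*} [Fintype V] (G : SimpleGraph V)
    (w : Sym2 V → ℝ) (S : Finset V) : ℝ :=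
  ∑ e : Sym2 V with e ∈ G.edgeSet ∧ ∃ v ∈ S, v ∈ e, w e

/-! ### The machine model

A deterministic random access machine with logarithmic cost for natural numbers, extended by
registers and memory for exact real numbers (which can only be moved, added, subtracted and
compared, at unit cost). Programs are finite and structured (`while` programs). -/

namespace RealRAM

/-- A state of the machine: registers and arrays of natural numbers, registers and arrays of real
numbers. A program names finitely many registers and finitely many arrays; the cells of an array
are addressed by the contents of a register. -/
structure State where
  /-- registers holding natural numbers -/
  reg : ℕ → ℕ
  /-- `mem a i` is the cell number `i` of the array `a` of natural numbers -/
  mem : ℕ → ℕ → ℕ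
  /-- registers holding real numbers -/
  rreg : ℕ → ℝ
  /-- `rmem a i` is the cell number `i` of the array `a` of real numbers -/
  rmem : ℕ → ℕ → ℝ

/-- Arithmetic operations on natural numbers. -/
inductive Op where
  | add
  | sub
  | mul
  | div

/-- The value of an operation (subtraction is truncated, division rounds down). -/
def Op.eval : Op → ℕ → ℕ → ℕ
  | .add, a, b => a + b
  | .sub, a, b => a - b
  | .mul, a, b => a * b
  | .div, a, b => a / b

/-- Elementary instructions. -/
inductive Instr where
  /-- `reg x := c` -/
  | const (x c : ℕ)
  /-- `reg x := o (reg y) (reg z)` -/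
  | op (o : Op) (x y z : ℕ)
  /-- `reg x := mem a (reg i)` -/
  | load (x a i : ℕ)
  /-- `mem a (reg i) := reg x` -/
  | store (a i x : ℕ)
  /-- `rreg x := rreg y + rreg z` -/
  | radd (x y z : ℕ)
  /-- `rreg x := rreg y - rreg z` -/
  | rsub (x y z : ℕ)
  /-- `rreg x := rmem a (reg i)` -/
  | rload (x a i : ℕ)
  /-- `rmem a (reg i) := rreg x` -/
  | rstore (a i x : ℕ)

/-- `setCell m a i v` is the memory `m` with the cell `i` of the array `a` overwritten by `v`. -/
def setCell {α : Type} (m : ℕ → ℕ → α) (a i : ℕ) (v : α) : ℕ → ℕ → α :=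
  Function.update m a (Function.update (m a) i v)

/-- The effect of an instruction. -/
noncomputable def Instr.apply : Instr → State → State
  | .const x c, s => { s with reg := Function.update s.reg x c }
  | .op o x y z, s => { s with reg := Function.update s.reg x (o.eval (s.reg y) (s.reg z)) }
  | .load x a i, s => { s with reg := Function.update s.reg x (s.mem a (s.reg i)) }
  | .store a i x, s => { s with mem := setCell s.mem a (s.reg i) (s.reg x) }
  | .radd x y z, s => { s with rreg := Function.update s.rreg x (s.rreg y + s.rreg z) }
  | .rsub x y z, s => { s with rreg := Function.update s.rreg x (s.rreg y - s.rreg z) }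
  | .rload x a i, s => { s with rreg := Function.update s.rreg x (s.rmem a (s.reg i)) }
  | .rstore a i x, s => { s with rmem := setCell s.rmem a (s.reg i) (s.rreg x) }

/-- The cost of an instruction: one, plus the binary lengths of all the natural numbers
(operands, result, addresses) that it handles. -/
def Instr.cost : Instr → State → ℕ
  | .const _ c, _ => 1 + c.size
  | .op o _ y z, s =>
      1 + (s.reg y).size + (s.reg z).size + (o.eval (s.reg y) (s.reg z)).size
  | .load _ a i, s => 1 + (s.reg i).size + (s.mem a (s.reg i)).size
  | .store _ i x, s => 1 + (s.reg i).size + (s.reg x).size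
  | .radd _ _ _, _ => 1
  | .rsub _ _ _, _ => 1
  | .rload _ _ i, s => 1 + (s.reg i).size
  | .rstore _ i _, s => 1 + (s.reg i).size

/-- Tests: comparison of two natural number registers, or of two real registers. -/
inductive Test where
  /-- `reg x < reg y` -/
  | lt (x y : ℕ)
  /-- `rreg x < rreg y` -/
  | rlt (x y : ℕ)

/-- The test succeeds. -/
def Test.Holds : Test → State → Prop
  | .lt x y, s => s.reg x < s.reg y
  | .rlt x y, s => s.rreg x < s.rreg y

/-- The cost of a test. -/
def Test.cost : Test → State → ℕ
  | .lt x y, s => 1 + (s.reg x).size + (s.reg y).size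
  | .rlt _ _, _ => 1

/-- Programs. -/
inductive Prog where
  | instr (i : Instr)
  | seq (p q : Prog)
  | ite (b : Test) (p q : Prog)
  | while (b : Test) (p : Prog)

/-- `Exec p s s' t`: the program `p`, started in the state `s`, halts in the state `s'` after
running for time `t` (the sum of the costs of all executed instructions and tests). -/
inductive Exec : Prog → State → State → ℕ → Prop where
  | instr (i : Instr) (s : State) : Exec (.instr i) s (i.apply s) (i.cost s)
  | seq {p q : Prog} {s s' s'' : State} {t t' : ℕ} :
      Exec p s s' t → Exec q s' s'' t' → Exec (.seq p q) s s'' (t + t')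
  | ite_true {b : Test} {p q : Prog} {s s' : State} {t : ℕ} :
      b.Holds s → Exec p s s' t → Exec (.ite b p q) s s' (b.cost s + t)
  | ite_false {b : Test} {p q : Prog} {s s' : State} {t : ℕ} :
      ¬ b.Holds s → Exec q s s' t → Exec (.ite b p q) s s' (b.cost s + t)
  | while_false {b : Test} {p : Prog} {s : State} :
      ¬ b.Holds s → Exec (.while b p) s s (b.cost s)
  | while_true {b : Test} {p : Prog} {s s' s'' : State} {t t' : ℕ} :
      b.Holds s → Exec p s s' t → Exec (.while b p) s' s'' t' →
      Exec (.while b p) s s'' (b.cost s + t + t')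

/-- The machine is deterministic: the final state and the running time are determined by the
program and the initial state. -/
theorem Exec.deterministic {p : Prog} {s s₁ s₂ : State} {t₁ t₂ : ℕ}
    (h₁ : Exec p s s₁ t₁) (h₂ : Exec p s s₂ t₂) : s₁ = s₂ ∧ t₁ = t₂ := by
  induction h₁ generalizing s₂ t₂ with
  | instr i s => cases h₂; exact ⟨rfl, rfl⟩
  | seq _ _ ih ih' =>
    cases h₂ with
    | seq a b =>
      obtain ⟨rfl, rfl⟩ := ih a
      obtain ⟨rfl, rfl⟩ := ih' b
      exact ⟨rfl, rfl⟩
  | ite_true hb _ ih =>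
    cases h₂ with
    | ite_true _ a => obtain ⟨rfl, rfl⟩ := ih a; exact ⟨rfl, rfl⟩
    | ite_false h _ => exact absurd hb h
  | ite_false hb _ ih =>
    cases h₂ with
    | ite_true h _ => exact absurd h hb
    | ite_false _ a => obtain ⟨rfl, rfl⟩ := ih a; exact ⟨rfl, rfl⟩
  | while_false hb =>
    cases h₂ with
    | while_false _ => exact ⟨rfl, rfl⟩
    | while_true h _ _ => exact absurd h hb
  | while_true hb _ _ ih ih' =>
    cases h₂ with
    | while_false h => exact absurd hb h
    | while_true _ a b =>
      obtain ⟨rfl, rfl⟩ := ih a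
      obtain ⟨rfl, rfl⟩ := ih' b
      exact ⟨rfl, rfl⟩

/-- An `n × n` matrix stored row by row: the entry `(u, v)` is in the cell `u * n + v`; all the
other cells are zero. -/
def matrixArray {α : Type} [Zero α] {n : ℕ} (A : Fin n → Fin n → α) (i : ℕ) : α :=
  if h : i < n * n then
    A (finProdFinEquiv.symm ⟨i, h⟩).1 (finProdFinEquiv.symm ⟨i, h⟩).2
  else 0

open Classical in
/-- The initial state for an edge-weighted graph on the vertices `0, …, n - 1` and a number `k`:
register `0` holds `n`, register `1` holds `k`, the array `0` of natural numbers holds the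
adjacency matrix, the array `0` of real numbers holds the matrix of the edge weights (with `0` for
non-adjacent pairs), and everything else is zero. -/
noncomputable def input {n : ℕ} (G : SimpleGraph (Fin n)) (w : Sym2 (Fin n) → ℝ) (k : ℕ) :
    State where
  reg x := if x = 0 then n else if x = 1 then k else 0
  mem a i := if a = 0 then matrixArray (fun u v => if G.Adj u v then 1 else 0) i else 0
  rreg _ := 0
  rmem a i := if a = 0 then matrixArray (fun u v => if G.Adj u v then w s(u, v) else 0) i else 0

/-- The set of vertices described by a final state: those `v` whose cell in the array `1` of
natural numbers is not zero. -/
def output (n : ℕ) (s : State) : Finset (Fin n) := {v | s.mem 1 v ≠ 0}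

end RealRAM

/-! Repeated removal of a vertex of minimum remaining degree orients the edges with out-degrees at
most some `D ≤ d` (`eval_orient`). Fix a maximiser `S` whose vertex sum is least among all
maximisers. The search branches over partial colourings and follows those compatible with `S`:
chosen vertices lie in `S`, rejected ones lie outside and receive an arc from `S` (`IsGood`). An
undecided out-neighbour of a chosen vertex (a pending vertex) can be decided either way. If there is
none, let `v` be the first undecided vertex of maximum residual weight. Were `v` neither in `S` nor
an out-neighbour of `S`, with at most one undecided out-neighbour in `S`, then some `u ∈ S` could be
exchanged for `v` without loss, against the choice of `S` and `v`. So `v` is chosen, or `v` is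
rejected, or two undecided out-neighbours of `v` are chosen (`IsFirstMax.exists_pair`,
`IsExpansion.exists_good`).

A rejected vertex with no arc from a chosen one is charged to a member of `S` that is still to be
chosen. So a good colouring with `c` chosen vertices has at most `D * (k - c)` charged ones
(`IsGood.numCharged_le`), and colourings beyond this limit are pruned. The tree is measured by the
potential `A ^ (k - c) * σ⁻¹ ^ e * γ ^ p` with `A = 2 ^ (D + 1)`, `e` charged and `p` pending
vertices. Choosing a vertex gains a factor `1 / A`, but each of its at most `D` out-neighbours may
cost `σ` (no longer charged) or `γ` (newly pending); rejecting a vertex gains `γ⁻¹` or `σ⁻¹`. The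
inequalities in `Rates` say that the potentials of the children add up to at most that of the parent
(`IsExpansion.sum_potential_le`), and they have solutions for every `D` (`exists_rates`). The
potential is at least `1` on active colourings and `A ^ k` at the root, so the tree has `2 ^ ((D +
1) * k)` nodes up to a polynomial factor (`IsExpansion.sum_weight_lt`, `weight_zero_le`). The
quasi-polynomial factor of the time bound enters only through being at least `1`.

On the machine, everything but the main loop consists of `for` loops whose steps raise natural
numbers by at most `n + 3`. The numbers therefore have length polynomial in `n`, and the logarithmic
cost is absorbed by the polynomial factor (`Cmd.exec`, `exec_search`, `exists_time_bound`). -/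

namespace RealRAM

/-! ### Programs with `for` loops

A `Cmd` is a program in which the only loops are `for` loops running over `0, …, n - 1`, where `n`
is the content of register `0`. Register `2` is supposed to hold `1`, register `3` to hold `0`, and
the real register `0` to hold `0`. -/

/-- Programs whose loops run over the natural numbers below the content of register `0`. -/
inductive Cmd where
  | instr (i : Instr)
  | seq (p q : Cmd)
  | ite (b : Test) (p q : Cmd)
  | loop (i : ℕ) (p : Cmd)

namespace Cmd

/-- The machine program of a command. -/
def toProg : Cmd → Prog
  | instr i => .instr i
  | seq p q => .seq p.toProg q.toProg
  | ite b p q => .ite b p.toProg q.toProg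
  | loop i p => .seq (.instr (.const i 0))
      (.while (.lt i 0) (.seq p.toProg (.instr (.op .add i i 2))))

open Classical in
/-- The state transformation of a command. -/
noncomputable def eval : Cmd → State → State
  | instr i, s => i.apply s
  | seq p q, s => q.eval (p.eval s)
  | ite b p q, s => if b.Holds s then p.eval s else q.eval s
  | loop i p, s => (fun s' => (Instr.op .add i i 2).apply (p.eval s'))^[s.reg 0]
      ((Instr.const i 0).apply s)

/-- The registers of natural numbers a command may write to. -/
def regs : Cmd → List ℕ
  | instr (.const x _) => [x]
  | instr (.op _ x _ _) => [x]
  | instr (.load x _ _) => [x]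
  | instr _ => []
  | seq p q => p.regs ++ q.regs
  | ite _ p q => p.regs ++ q.regs
  | loop i p => i :: p.regs

/-- The arrays of natural numbers a command may write to. -/
def arrays : Cmd → List ℕ
  | instr (.store a _ _) => [a]
  | instr _ => []
  | seq p q => p.arrays ++ q.arrays
  | ite _ p q => p.arrays ++ q.arrays
  | loop _ p => p.arrays

/-- The real registers a command may write to. -/
def rregs : Cmd → List ℕ
  | instr (.radd x _ _) => [x]
  | instr (.rsub x _ _) => [x]
  | instr (.rload x _ _) => [x]
  | instr _ => []
  | seq p q => p.rregs ++ q.rregs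
  | ite _ p q => p.rregs ++ q.rregs
  | loop _ p => p.rregs

/-- The instructions that increase natural numbers only by the contents of register `0` or `2`, or
by a small constant, and that do not touch the real memory. -/
def slow : Cmd → Bool
  | instr (.const _ c) => c ≤ 3
  | instr (.op .add _ _ z) => z = 0 || z = 2
  | instr (.op .mul _ _ _) => false
  | instr (.rstore _ _ _) => false
  | instr _ => true
  | seq p q => p.slow && q.slow
  | ite _ p q => p.slow && q.slow
  | loop i p => p.slow && i ∉ p.regs

/-- Admissible commands: they are slow, and they keep the contents of the registers that hold
constants. -/
def ok (c : Cmd) : Bool :=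
  c.slow && 0 ∉ c.regs && 2 ∉ c.regs && 3 ∉ c.regs && 0 ∉ c.rregs

/-- A bound for the number of instructions and tests that are executed. -/
def bound (n : ℕ) : Cmd → ℕ
  | instr _ => 1
  | seq p q => p.bound n + q.bound n
  | ite _ p q => 1 + p.bound n + q.bound n
  | loop _ p => 2 + n * (p.bound n + 2)

end Cmd

/-- The registers `0`, `2`, `3` and the real register `0` hold `n`, `1`, `0` and `0`. -/
structure Std (n : ℕ) (s : State) : Prop where
  reg_zero : s.reg 0 = n
  reg_two : s.reg 2 = 1
  reg_three : s.reg 3 = 0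
  rreg_zero : s.rreg 0 = 0

/-- The two states agree wherever the command does not write. -/
structure Agree (c : Cmd) (s s' : State) : Prop where
  reg : ∀ x, x ∉ c.regs → s'.reg x = s.reg x
  mem : ∀ a, a ∉ c.arrays → s'.mem a = s.mem a
  rreg : ∀ x, x ∉ c.rregs → s'.rreg x = s.rreg x
  rmem : c.slow → s'.rmem = s.rmem

/-- All the natural numbers in the state are at most `V`. -/
def State.BoundedBy (s : State) (V : ℕ) : Prop :=
  (∀ x, s.reg x ≤ V) ∧ ∀ a i, s.mem a i ≤ V

theorem Agree.refl (c : Cmd) (s : State) : Agree c s s :=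
  ⟨fun _ _ => rfl, fun _ _ => rfl, fun _ _ => rfl, fun _ => rfl⟩

theorem Agree.iterate {c : Cmd} {f : State → State} (hf : ∀ s, Agree c s (f s)) (m : ℕ)
    (s : State) : Agree c s (f^[m] s) := by
  induction m with
  | zero => exact Agree.refl c s
  | succ m ih =>
    rw [Function.iterate_succ_apply']
    have h := hf (f^[m] s)
    exact ⟨fun x hx => (h.reg x hx).trans (ih.reg x hx),
      fun x hx => (h.mem x hx).trans (ih.mem x hx),
      fun x hx => (h.rreg x hx).trans (ih.rreg x hx), fun hc => (h.rmem hc).trans (ih.rmem hc)⟩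

/-- Frame rule. What a command may write to is computed from its syntax, so for concrete programs
conditions such as `x ∉ c.regs` are settled by `decide`, without unfolding the command. -/
theorem Cmd.agree_eval (c : Cmd) (s : State) : Agree c s (c.eval s) := by
  induction c generalizing s with
  | instr i =>
    cases i <;> constructor <;> intros <;>
      simp_all [Cmd.regs, Cmd.arrays, Cmd.rregs, Cmd.slow, Cmd.eval, Instr.apply, setCell]
  | seq p q ihp ihq =>
    have h₁ := ihp s
    have h₂ := ihq (p.eval s)
    constructor
    · intro x hx
      simp only [Cmd.regs, List.mem_append, not_or] at hx
      exact (h₂.reg x hx.2).trans (h₁.reg x hx.1)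
    · intro x hx
      simp only [Cmd.arrays, List.mem_append, not_or] at hx
      exact (h₂.mem x hx.2).trans (h₁.mem x hx.1)
    · intro x hx
      simp only [Cmd.rregs, List.mem_append, not_or] at hx
      exact (h₂.rreg x hx.2).trans (h₁.rreg x hx.1)
    · intro hc
      simp only [Cmd.slow, Bool.and_eq_true] at hc
      exact (h₂.rmem hc.2).trans (h₁.rmem hc.1)
  | ite b p q ihp ihq =>
    have h₁ := ihp s
    have h₂ := ihq s
    by_cases hb : b.Holds s <;> simp only [Cmd.eval, hb, if_true, if_false] <;> constructor <;>
      intros <;> simp_all [Cmd.regs, Cmd.arrays, Cmd.rregs, Cmd.slow, h₁.reg, h₁.mem, h₁.rreg,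
        h₁.rmem, h₂.reg, h₂.mem, h₂.rreg, h₂.rmem]
  | loop i p ih =>
    have h : Agree (.loop i p) s ((Instr.const i 0).apply s) := by
      constructor <;> intros <;> simp_all [Cmd.regs, Instr.apply]
    have h' := Agree.iterate (c := .loop i p)
      (f := fun s' => (Instr.op .add i i 2).apply (p.eval s')) (fun s' => by
        have := ih s'
        constructor
        · intro x hx
          simp only [Cmd.regs, List.mem_cons, not_or] at hx
          simp [Instr.apply, hx.1, this.reg x hx.2]
        · exact fun x hx => this.mem x hx
        · exact fun x hx => this.rreg x hx
        · intro hc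
          simp only [Cmd.slow, Bool.and_eq_true] at hc
          exact this.rmem hc.1) (s.reg 0) ((Instr.const i 0).apply s)
    exact ⟨fun x hx => (h'.reg x hx).trans (h.reg x hx),
      fun x hx => (h'.mem x hx).trans (h.mem x hx),
      fun x hx => (h'.rreg x hx).trans (h.rreg x hx), fun hc => (h'.rmem hc).trans (h.rmem hc)⟩

theorem Agree.std {n : ℕ} {c : Cmd} {s s' : State} (h : Agree c s s') (hc : c.ok) (hs : Std n s) :
    Std n s' := by
  simp only [Cmd.ok, Bool.and_eq_true, decide_eq_true_eq] at hc
  obtain ⟨⟨⟨⟨-, h0⟩, h2⟩, h3⟩, hr⟩ := hc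
  exact ⟨(h.reg 0 h0).trans hs.1, (h.reg 2 h2).trans hs.2, (h.reg 3 h3).trans hs.3,
    (h.rreg 0 hr).trans hs.4⟩

theorem Std.eval {n : ℕ} {s : State} (hs : Std n s) {c : Cmd} (hc : c.ok) : Std n (c.eval s) :=
  (c.agree_eval s).std hc hs

theorem Cmd.ok_of_seq {p q : Cmd} (h : (Cmd.seq p q).ok) : p.ok ∧ q.ok := by
  simp_all [Cmd.ok, Cmd.slow, Cmd.regs, Cmd.rregs]

theorem Cmd.ok_of_ite {b : Test} {p q : Cmd} (h : (Cmd.ite b p q).ok) : p.ok ∧ q.ok := by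
  simp_all [Cmd.ok, Cmd.slow, Cmd.regs, Cmd.rregs]

theorem Cmd.ok_of_loop {i : ℕ} {p : Cmd} (h : (Cmd.loop i p).ok) :
    p.ok ∧ i ∉ p.regs ∧ i ≠ 0 ∧ i ≠ 2 ∧ i ≠ 3 := by
  simp only [Cmd.ok, Cmd.slow, Cmd.regs, Cmd.rregs, Bool.and_eq_true, decide_eq_true_eq,
    List.mem_cons, not_or] at h ⊢
  grind

/-- The state before the `j`-th passage through the body of a loop, and after the last one for
`j = n`. -/
theorem Cmd.eval_loop_induct {n i : ℕ} {p : Cmd} {s : State} (hok : (Cmd.loop i p).ok)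
    (hs : Std n s) (Inv : ℕ → State → Prop) (base : Inv 0 ((Instr.const i 0).apply s))
    (step : ∀ j s', j < n → Std n s' → s'.reg i = j → Agree (.loop i p) s s' → Inv j s' →
      Inv (j + 1) ((Instr.op .add i i 2).apply (p.eval s'))) :
    Inv n ((Cmd.loop i p).eval s) := by
  obtain ⟨hp, hi, h0, h2, h3⟩ := Cmd.ok_of_loop hok
  set f : State → State := fun s' => (Instr.op .add i i 2).apply (p.eval s') with hf
  set s₀ := (Instr.const i 0).apply s with hs₀
  -- The extra conjuncts are what the invariant rule offers to its user: `Std` keeps the increment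
  -- at `1`, and the frame relation to the state before the loop lets `Inv` mention only what
  -- changes.
  have key : ∀ j ≤ n, Std n (f^[j] s₀) ∧ (f^[j] s₀).reg i = j ∧
      Agree (.loop i p) s (f^[j] s₀) ∧ Inv j (f^[j] s₀) := by
    intro j
    induction j with
    | zero =>
      intro _
      have ha : Agree (.loop i p) s s₀ := by
        constructor <;> intros <;> simp_all [Cmd.regs, Instr.apply]
      exact ⟨ha.std hok hs, by simp [hs₀, Instr.apply], ha, base⟩
    | succ j ih =>
      intro hj
      obtain ⟨i1, i2, i3, i4⟩ := ih (by omega)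
      rw [Function.iterate_succ_apply']
      generalize f^[j] s₀ = s₁ at i1 i2 i3 i4 ⊢
      have hb := p.agree_eval s₁
      have ha : Agree (.loop i p) s (f s₁) := by
        constructor
        · intro x hx
          have hx' := hx
          simp only [Cmd.regs, List.mem_cons, not_or] at hx
          simp [hf, Instr.apply, hx.1, hb.reg x hx.2, i3.reg x hx']
        · exact fun x hx => (hb.mem x hx).trans (i3.mem x hx)
        · exact fun x hx => (hb.rreg x hx).trans (i3.rreg x hx)
        · intro hc
          have hc' := hc
          simp only [Cmd.slow, Bool.and_eq_true] at hc
          exact (hb.rmem hc.1).trans (i3.rmem hc')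
      refine ⟨ha.std hok hs, ?_, ha, step j _ (by omega) i1 i2 i3 i4⟩
      have hb2 := (i1.eval hp).reg_two
      simp [hf, Instr.apply, hb2, hb.reg i hi, i2, Op.eval]
  have := (key n le_rfl).2.2.2
  rwa [Cmd.eval, hs.reg_zero]

/-! ### Running times -/

/-- An instruction handles at most three natural numbers (two operands and a result), so `1 + 3 *
M.size` is a uniform price for tests and instructions. -/
theorem Test.cost_le {b : Test} {s : State} {V M : ℕ} (hV : s.BoundedBy V) (hM : V ≤ M) :
    b.cost s ≤ 1 + 3 * M.size := by
  have h : ∀ x, (s.reg x).size ≤ M.size := fun x => Nat.size_le_size ((hV.1 x).trans hM)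
  cases b with
  | lt x y => have := h x; have := h y; simp only [Test.cost]; omega
  | rlt x y => simp only [Test.cost]; omega

/-- A slow addition adds the content of register `0` or `2`, that is `n` or `1`, and a slow constant
is at most `3`; all other slow instructions copy or shrink natural numbers. Hence numbers grow
additively with time. -/
theorem Instr.boundedBy_apply {n : ℕ} {i : Instr} {s : State} {V : ℕ} (hi : (Cmd.instr i).slow)
    (hs : Std n s) (hV : s.BoundedBy V) : (i.apply s).BoundedBy (V + (n + 3)) := by
  have h0 := hs.reg_zero
  have h2 := hs.reg_two
  obtain ⟨hr, hm⟩ := hV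
  have hr' : ∀ x, s.reg x ≤ V + (n + 3) := fun x => (hr x).trans (by omega)
  have hm' : ∀ a i, s.mem a i ≤ V + (n + 3) := fun a i => (hm a i).trans (by omega)
  have hu : ∀ x v, v ≤ V + (n + 3) → ∀ y, Function.update s.reg x v y ≤ V + (n + 3) := by
    intro x v hv y
    rw [Function.update_apply]
    split_ifs <;> simp_all
  cases i with
  | const x c => exact ⟨hu x c (by simp [Cmd.slow] at hi; omega), hm'⟩
  | op o x y z =>
    refine ⟨hu x _ ?_, hm'⟩
    have hy := hr y
    cases o with
    | add =>
      simp only [Cmd.slow, Bool.or_eq_true, decide_eq_true_eq] at hi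
      rcases hi with rfl | rfl <;> simp only [Op.eval] <;> omega
    | sub => simp only [Op.eval]; omega
    | mul => simp [Cmd.slow] at hi
    | div => exact (Nat.div_le_self _ _).trans (by omega)
  | load x a i => exact ⟨hu x _ (hm' _ _), hm'⟩
  | store a i x =>
    refine ⟨hr', fun b j => ?_⟩
    simp only [Instr.apply, setCell, Function.update_apply]
    split_ifs
    · simp only [Function.update_apply]
      split_ifs
      · exact hr' x
      · exact hm' _ _
    · exact hm' _ _
  | radd x y z => exact ⟨hr', hm'⟩
  | rsub x y z => exact ⟨hr', hm'⟩
  | rload x a i => exact ⟨hr', hm'⟩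
  | rstore a i x => exact ⟨hr', hm'⟩

theorem Instr.cost_le {n : ℕ} {i : Instr} {s : State} {V M : ℕ} (hi : (Cmd.instr i).slow)
    (hs : Std n s) (hV : s.BoundedBy V) (hM : V + (n + 3) ≤ M) : i.cost s ≤ 1 + 3 * M.size := by
  have hr : ∀ x, (s.reg x).size ≤ M.size :=
    fun x => Nat.size_le_size ((hV.1 x).trans (by omega))
  have hm : ∀ a i, (s.mem a i).size ≤ M.size :=
    fun a i => Nat.size_le_size ((hV.2 a i).trans (by omega))
  have hb := Instr.boundedBy_apply hi hs hV
  cases i with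
  | const x c =>
    have : c.size ≤ M.size := Nat.size_le_size (by simp [Cmd.slow] at hi; omega)
    simp only [Instr.cost]; omega
  | op o x y z =>
    have h1 := hr y
    have h2 := hr z
    have h3 : (o.eval (s.reg y) (s.reg z)).size ≤ M.size := by
      refine Nat.size_le_size (le_trans ?_ hM)
      simpa [Instr.apply] using hb.1 x
    simp only [Instr.cost]; omega
  | load x a i => have := hr i; have := hm a (s.reg i); simp only [Instr.cost]; omega
  | store a i x => have := hr i; have := hr x; simp only [Instr.cost]; omega
  | radd x y z => simp only [Instr.cost]; omega
  | rsub x y z => simp only [Instr.cost]; omega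
  | rload x a i => have := hr i; simp only [Instr.cost]; omega
  | rstore a i x => simp [Cmd.slow] at hi

theorem State.BoundedBy.mono {s : State} {V V' : ℕ} (h : s.BoundedBy V) (hV : V ≤ V') :
    s.BoundedBy V' :=
  ⟨fun x => (h.1 x).trans hV, fun a i => (h.2 a i).trans hV⟩

theorem Cmd.slow_of_ok {c : Cmd} (h : c.ok) : c.slow := by
  simp only [Cmd.ok, Bool.and_eq_true] at h
  exact h.1.1.1.1

/-- An admissible command is executed by its program within the bound. -/
theorem Cmd.exec {n M : ℕ} (c : Cmd) : ∀ (s : State) (V : ℕ), c.ok → Std n s → s.BoundedBy V →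
    V + c.bound n * (n + 3) ≤ M →
    ∃ t ≤ c.bound n * (1 + 3 * M.size), Exec c.toProg s (c.eval s) t ∧
      (c.eval s).BoundedBy (V + c.bound n * (n + 3)) := by
  induction c with
  | instr i =>
    intro s V hok hs hV hM
    have hi := Cmd.slow_of_ok hok
    simp only [Cmd.bound, one_mul] at hM ⊢
    exact ⟨_, Instr.cost_le hi hs hV hM, .instr i s, Instr.boundedBy_apply hi hs hV⟩
  | seq p q ihp ihq =>
    intro s V hok hs hV hM
    obtain ⟨hp, hq⟩ := Cmd.ok_of_seq hok
    simp only [Cmd.bound] at hM ⊢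
    obtain ⟨t, ht, he, hb⟩ := ihp s V hp hs hV (by nlinarith)
    obtain ⟨t', ht', he', hb'⟩ := ihq _ _ hq (hs.eval hp) hb (by nlinarith)
    exact ⟨t + t', by nlinarith, .seq he he', hb'.mono (by nlinarith)⟩
  | ite b p q ihp ihq =>
    intro s V hok hs hV hM
    obtain ⟨hp, hq⟩ := Cmd.ok_of_ite hok
    simp only [Cmd.bound] at hM ⊢
    have hc := Test.cost_le (b := b) hV (show V ≤ M by nlinarith)
    by_cases h : b.Holds s
    · obtain ⟨t, ht, he, hb⟩ := ihp s V hp hs hV (by nlinarith)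
      simp only [Cmd.eval, h, if_true]
      exact ⟨_, by nlinarith, .ite_true h he, hb.mono (by nlinarith)⟩
    · obtain ⟨t, ht, he, hb⟩ := ihq s V hq hs hV (by nlinarith)
      simp only [Cmd.eval, h, if_false]
      exact ⟨_, by nlinarith, .ite_false h he, hb.mono (by nlinarith)⟩
  | loop i p ih =>
    intro s V hok hs hV hM
    obtain ⟨hp, hi, h0, h2, h3⟩ := Cmd.ok_of_loop hok
    simp only [Cmd.bound] at hM ⊢
    set f : State → State := fun s' => (Instr.op .add i i 2).apply (p.eval s') with hf
    -- Here `m` counts the remaining passages. Each one pays for the test, the body and the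
    -- increment, whence `p.bound n + 2`; the `1` is the last, failing test.
    have key : ∀ m s' V', m ≤ n → s'.reg i + m = n → Std n s' → s'.BoundedBy V' →
        V' + m * (p.bound n + 2) * (n + 3) ≤ M →
        ∃ t ≤ (1 + m * (p.bound n + 2)) * (1 + 3 * M.size),
          Exec (.while (.lt i 0) (.seq p.toProg (.instr (.op .add i i 2)))) s' (f^[m] s') t ∧
          (f^[m] s').BoundedBy (V' + m * (p.bound n + 2) * (n + 3)) := by
      intro m
      induction m with
      | zero =>
        intro s' V' _ hm hs' hV' hM'
        refine ⟨_, ?_, .while_false ?_, hV'.mono (by simp)⟩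
        · simpa using Test.cost_le hV' (by simpa using hM')
        · simp only [Test.Holds, hs'.reg_zero]; omega
      | succ m ihm =>
        intro s' V' hmn hm hs' hV' hM'
        have hV'M : V' ≤ M := le_trans (Nat.le_add_right _ _) hM'
        obtain ⟨t₁, ht₁, he₁, hb₁⟩ := ih s' V' hp hs' hV' (by nlinarith)
        have hs₁ := hs'.eval hp
        have hslow : (Cmd.instr (.op .add i i 2)).slow := rfl
        have hb₂ := Instr.boundedBy_apply hslow hs₁ hb₁
        have hc₂ := Instr.cost_le hslow hs₁ hb₁ (M := M) (by nlinarith)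
        have hs₂ : Std n (f s') := by
          refine ⟨?_, ?_, ?_, hs₁.rreg_zero⟩
          · simpa [hf, Instr.apply, h0.symm] using hs₁.reg_zero
          · simpa [hf, Instr.apply, h2.symm] using hs₁.reg_two
          · simpa [hf, Instr.apply, h3.symm] using hs₁.reg_three
        have hi₂ : (f s').reg i + m = n := by
          have := (p.agree_eval s').reg i hi
          simp only [hf, Instr.apply, Function.update_self, Op.eval, hs₁.reg_two, this]
          omega
        obtain ⟨t₃, ht₃, he₃, hb₃⟩ := ihm (f s') (V' + p.bound n * (n + 3) + (n + 3)) (by omega)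
          hi₂ hs₂ hb₂ (by nlinarith)
        refine ⟨_, ?_, .while_true ?_ (.seq he₁ (.instr _ _)) he₃, hb₃.mono (by nlinarith)⟩
        · have hc := Test.cost_le (b := .lt i 0) hV' hV'M
          nlinarith
        · simp only [Test.Holds, hs'.reg_zero]; omega
    have hs₀ : Std n ((Instr.const i 0).apply s) := by
      refine ⟨?_, ?_, ?_, hs.rreg_zero⟩
      · simpa [Instr.apply, h0.symm] using hs.reg_zero
      · simpa [Instr.apply, h2.symm] using hs.reg_two
      · simpa [Instr.apply, h3.symm] using hs.reg_three
    have hslow : (Cmd.instr (.const i 0)).slow := rfl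
    obtain ⟨t, ht, he, hb⟩ := key n _ _ le_rfl (by simp [Instr.apply]) hs₀
      (Instr.boundedBy_apply hslow hs hV) (by nlinarith)
    have hc := Instr.cost_le hslow hs hV (M := M) (by nlinarith)
    refine ⟨_, ?_, .seq (.instr _ _) (by simpa [Cmd.eval, hs.reg_zero] using he), ?_⟩
    · nlinarith
    · have : (Cmd.loop i p).eval s = f^[n] ((Instr.const i 0).apply s) := by
        simp [Cmd.eval, hs.reg_zero, hf]
      rw [this]
      exact hb.mono (by nlinarith)

/-- Sequencing adds bounds and looping multiplies by `n`. One number can serve as coefficient and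
exponent because powers of a positive `n` increase. -/
theorem Cmd.exists_bound_le (c : Cmd) : ∃ a : ℕ, ∀ n : ℕ, 0 < n → c.bound n ≤ a * n ^ a := by
  induction c with
  | instr i => exact ⟨1, fun n hn => by simp [Cmd.bound]; omega⟩
  | seq p q ihp ihq =>
    obtain ⟨a, ha⟩ := ihp
    obtain ⟨b, hb⟩ := ihq
    refine ⟨a + b, fun n hn => ?_⟩
    have h1 : n ^ a ≤ n ^ (a + b) := Nat.pow_le_pow_right hn (by omega)
    have h2 : n ^ b ≤ n ^ (a + b) := Nat.pow_le_pow_right hn (by omega)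
    simp only [Cmd.bound]
    calc _ ≤ a * n ^ a + b * n ^ b := add_le_add (ha n hn) (hb n hn)
      _ ≤ a * n ^ (a + b) + b * n ^ (a + b) := by gcongr
      _ = _ := by ring
  | ite t p q ihp ihq =>
    obtain ⟨a, ha⟩ := ihp
    obtain ⟨b, hb⟩ := ihq
    refine ⟨1 + a + b, fun n hn => ?_⟩
    have h0 : 1 ≤ n ^ (1 + a + b) := Nat.one_le_pow _ _ hn
    have h1 : n ^ a ≤ n ^ (1 + a + b) := Nat.pow_le_pow_right hn (by omega)
    have h2 : n ^ b ≤ n ^ (1 + a + b) := Nat.pow_le_pow_right hn (by omega)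
    simp only [Cmd.bound]
    calc _ ≤ 1 + a * n ^ a + b * n ^ b := by have := ha n hn; have := hb n hn; omega
      _ ≤ n ^ (1 + a + b) + a * n ^ (1 + a + b) + b * n ^ (1 + a + b) := by gcongr
      _ = _ := by ring
  | loop i p ih =>
    obtain ⟨a, ha⟩ := ih
    -- The bound `2 + n * (a * n ^ a + 2)` has coefficients `2`, `a` and `2`, with sum `a + 4`.
    refine ⟨a + 4, fun n hn => ?_⟩
    have h0 : 1 ≤ n ^ (a + 4) := Nat.one_le_pow _ _ hn
    have h1 : n * n ^ a ≤ n ^ (a + 4) := by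
      rw [← pow_succ']; exact Nat.pow_le_pow_right hn (by omega)
    have h2 : n ≤ n ^ (a + 4) := Nat.le_self_pow (by omega) n
    simp only [Cmd.bound]
    calc _ ≤ 2 + n * (a * n ^ a + 2) := by gcongr; exact ha n hn
      _ = 2 + a * (n * n ^ a) + 2 * n := by ring
      _ ≤ 2 * n ^ (a + 4) + a * n ^ (a + 4) + 2 * n ^ (a + 4) := by gcongr; omega
      _ = _ := by ring

end RealRAM

namespace RealRAM

/-! ### Covered weight of sets of numbers

The algorithm orients the edges with out-degrees at most `d` and branches over partial colourings of
the vertices. Fix an optimal set `S`. A vertex that is an out-neighbour of a chosen vertex is either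
chosen or one of the at most `k * d` out-neighbours of `S`. If all such vertices are decided, then
let `v` be an undecided vertex of maximum residual weight: by an exchange argument, `v` belongs to
`S`, or it is an out-neighbour of `S`, or two of its undecided out-neighbours belong to `S`. -/

/-- The sum of the entries of the symmetric matrix `W` that lie in a row or a column of `S`: twice
the total weight of the edges that meet `S`. -/
noncomputable def matrixCover (n : ℕ) (W : ℕ → ℕ → ℝ) (S : Finset ℕ) : ℝ :=
  ∑ u ∈ Finset.range n, ∑ v ∈ Finset.range n, if u ∈ S ∨ v ∈ S then W u v else 0

/-- The weight that `v` adds to a set that it does not belong to. -/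
noncomputable def residualWeight (n : ℕ) (W : ℕ → ℕ → ℝ) (S : Finset ℕ) (v : ℕ) : ℝ :=
  ∑ u ∈ Finset.range n, if u ∈ S then 0 else W v u

/-- The newly covered entries lie in the row or the column of `v` and have their other index outside
`S`. Symmetry makes both sums equal, and the zero at `(v, v)` makes their overlap harmless. -/
theorem matrixCover_insert {n : ℕ} {W : ℕ → ℕ → ℝ} {S : Finset ℕ} {v : ℕ}
    (hW : ∀ u v, W u v = W v u) (hd : W v v = 0) (hv : v < n) (hS : v ∉ S) :
    matrixCover n W (insert v S) = matrixCover n W S + 2 * residualWeight n W S v := by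
  have hv' : v ∈ Finset.range n := Finset.mem_range.2 hv
  have h1 : ∀ f : ℕ → ℝ, ∑ u ∈ Finset.range n, (if u = v then f u else 0) = f v := fun f => by
    simp [hv]
  have h2 : residualWeight n W S v = ∑ u ∈ Finset.range n, ∑ x ∈ Finset.range n,
      if u = v then (if x ∈ S then 0 else W u x) else 0 := by
    have : ∀ u, (∑ x ∈ Finset.range n, if u = v then (if x ∈ S then 0 else W u x) else 0) =
        if u = v then residualWeight n W S u else 0 := by
      intro u; split_ifs <;> simp [residualWeight]
    simp_rw [this]
    rw [h1]
  have h3 : residualWeight n W S v = ∑ u ∈ Finset.range n, ∑ x ∈ Finset.range n,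
      if x = v then (if u ∈ S then 0 else W u x) else 0 := by
    rw [h2, Finset.sum_comm]
    simp_rw [fun u x => hW u x]
  rw [two_mul]
  -- One copy of the residual weight is spread over the row of `v`, the other over the column, so
  -- that the identity can be checked entry by entry.
  nth_rewrite 1 [h2]
  rw [h3, matrixCover, matrixCover, ← Finset.sum_add_distrib, ← Finset.sum_add_distrib]
  refine Finset.sum_congr rfl fun u _ => ?_
  rw [← Finset.sum_add_distrib, ← Finset.sum_add_distrib]
  refine Finset.sum_congr rfl fun x _ => ?_
  simp only [Finset.mem_insert]
  by_cases hu : u = v <;> by_cases hx : x = v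
  · subst hu; subst hx; simp [hd]
  · subst hu; by_cases hxS : x ∈ S <;> simp [hx, hxS, hS]
  · subst hx; by_cases huS : u ∈ S <;> simp [hu, huS, hS]
  · simp [hu, hx]

/-- `S` is an optimal set of `k` numbers below `n`, and among all such sets it has the least sum of
elements. -/
structure IsFirstOptimal (n k : ℕ) (W : ℕ → ℕ → ℝ) (S : Finset ℕ) : Prop where
  subset : S ⊆ Finset.range n
  card_eq : S.card = k
  le : ∀ T ⊆ Finset.range n, T.card = k → matrixCover n W T ≤ matrixCover n W S
  sum_le : ∀ T ⊆ Finset.range n, T.card = k → matrixCover n W T = matrixCover n W S →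
    ∑ x ∈ S, x ≤ ∑ x ∈ T, x

theorem exists_isFirstOptimal {n k : ℕ} (W : ℕ → ℕ → ℝ) (hk : k ≤ n) :
    ∃ S, IsFirstOptimal n k W S := by
  classical
  have hne : ((Finset.range n).powersetCard k).Nonempty :=
    Finset.powersetCard_nonempty.2 (by simpa using hk)
  obtain ⟨S₀, hS₀, hmax⟩ := Finset.exists_max_image _ (matrixCover n W) hne
  have hne' : (((Finset.range n).powersetCard k).filter
      (fun T => matrixCover n W T = matrixCover n W S₀)).Nonempty :=
    ⟨S₀, Finset.mem_filter.2 ⟨hS₀, rfl⟩⟩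
  obtain ⟨S, hS, hmin⟩ := Finset.exists_min_image _ (fun T => ∑ x ∈ T, x) hne'
  simp only [Finset.mem_filter, Finset.mem_powersetCard] at hS hmin hmax
  refine ⟨S, hS.1.1, hS.1.2, fun T h1 h2 => ?_, fun T h1 h2 h3 => ?_⟩
  · rw [hS.2]; exact hmax T ⟨h1, h2⟩
  · exact hmin T ⟨⟨h1, h2⟩, h3.trans hS.2⟩

/-! ### Partial colourings

A colouring assigns to each `v < n` the colour `0` (undecided), `1` (chosen) or `2` (rejected). The
relation `O` is an orientation of the edges of the graph. -/

open Classical in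
/-- The numbers below `n` with the property `p`. -/
noncomputable def below (n : ℕ) (p : ℕ → Prop) : Finset ℕ := (Finset.range n).filter p

@[simp] theorem mem_below {n : ℕ} {p : ℕ → Prop} {v : ℕ} : v ∈ below n p ↔ v < n ∧ p v := by
  simp [below]

theorem below_subset_range (n : ℕ) (p : ℕ → Prop) : below n p ⊆ Finset.range n := by
  intro v; simp +contextual

/-- Some chosen vertex has an arc to `v`. -/
def IsMarked (n : ℕ) (O : ℕ → ℕ → Prop) (col : ℕ → ℕ) (v : ℕ) : Prop :=
  ∃ u < n, col u = 1 ∧ O u v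

/-- The number of chosen vertices. -/
noncomputable def numChosen (n : ℕ) (col : ℕ → ℕ) : ℕ := (below n fun v => col v = 1).card

/-- The number of undecided vertices. -/
noncomputable def numBlank (n : ℕ) (col : ℕ → ℕ) : ℕ := (below n fun v => col v = 0).card

/-- The number of rejected vertices that are not marked. -/
noncomputable def numCharged (n : ℕ) (O : ℕ → ℕ → Prop) (col : ℕ → ℕ) : ℕ :=
  (below n fun v => 1 < col v ∧ ¬ IsMarked n O col v).card

/-- The number of undecided vertices that are marked. -/
noncomputable def numPending (n : ℕ) (O : ℕ → ℕ → Prop) (col : ℕ → ℕ) : ℕ :=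
  (below n fun v => col v = 0 ∧ IsMarked n O col v).card

/-- The colouring with the colour of `v` changed to `c`. -/
abbrev recolour (col : ℕ → ℕ) (v c : ℕ) : ℕ → ℕ := Function.update col v c

/-- The colouring can be completed to the set `S`, in such a way that all the rejected vertices have
an arc from `S`. -/
structure IsGood (n : ℕ) (O : ℕ → ℕ → Prop) (S : Finset ℕ) (col : ℕ → ℕ) : Prop where
  mem : ∀ v < n, col v = 1 → v ∈ S
  notMem : ∀ v < n, 1 < col v → v ∉ S
  arc : ∀ v < n, 1 < col v → ∃ u ∈ S, O u v

/-- The children of a colouring that arise from deciding about `v`. -/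
def splitOn (col : ℕ → ℕ) (v : ℕ) : List (ℕ → ℕ) := [recolour col v 1, recolour col v 2]

open Classical in
/-- The children of a colouring that arise from choosing two undecided out-neighbours of `v`. -/
noncomputable def choosePairs (n : ℕ) (O : ℕ → ℕ → Prop) (col : ℕ → ℕ) (v : ℕ) :
    List (ℕ → ℕ) :=
  (List.range n).flatMap fun i => (List.range n).flatMap fun j =>
    if i < j ∧ (O v i ∧ col i = 0) ∧ (O v j ∧ col j = 0) then
      [recolour (recolour col i 1) j 1] else []

/-- `v` is the first undecided vertex of maximum residual weight. -/
structure IsFirstMax (n : ℕ) (W : ℕ → ℕ → ℝ) (col : ℕ → ℕ) (v : ℕ) : Prop where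
  lt : v < n
  blank : col v = 0
  le : ∀ u < n, col u = 0 → residualWeight n W (below n fun x => col x = 1) u ≤
    residualWeight n W (below n fun x => col x = 1) v
  first : ∀ u < n, col u = 0 → residualWeight n W (below n fun x => col x = 1) u =
    residualWeight n W (below n fun x => col x = 1) v → v ≤ u

/-- `L` is the list of children of the colouring. -/
inductive IsExpansion (n : ℕ) (W : ℕ → ℕ → ℝ) (O : ℕ → ℕ → Prop) (col : ℕ → ℕ) :
    List (ℕ → ℕ) → Prop where
  | pending (v : ℕ) (hv : v < n) (h0 : col v = 0) (hm : IsMarked n O col v) :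
      IsExpansion n W O col (splitOn col v)
  | top (v : ℕ) (hv : IsFirstMax n W col v) (hm : ∀ u < n, col u = 0 → ¬ IsMarked n O col u) :
      IsExpansion n W O col (splitOn col v ++ choosePairs n O col v)
  | none (h : ∀ u < n, col u ≠ 0) : IsExpansion n W O col []

/-! ### Colourings that can be completed to the optimal set, and the exchange argument -/

section Good

variable {n k : ℕ} {W : ℕ → ℕ → ℝ} {O : ℕ → ℕ → Prop} {S : Finset ℕ} {col : ℕ → ℕ}

theorem IsGood.choose (h : IsGood n O S col) {v : ℕ} (hv : v ∈ S) :
    IsGood n O S (recolour col v 1) := by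
  constructor
  · intro u hu h1
    by_cases huv : u = v
    · exact huv ▸ hv
    · exact h.mem u hu (by simpa [huv] using h1)
  · intro u hu h1
    by_cases huv : u = v
    · simp [huv] at h1
    · exact h.notMem u hu (by simpa [huv] using h1)
  · intro u hu h1
    by_cases huv : u = v
    · simp [huv] at h1
    · exact h.arc u hu (by simpa [huv] using h1)

theorem IsGood.reject (h : IsGood n O S col) {v u : ℕ} (hv : v ∉ S) (hu : u ∈ S) (ho : O u v) :
    IsGood n O S (recolour col v 2) := by
  constructor
  · intro x hx h1
    by_cases hxv : x = v
    · simp [hxv] at h1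
    · exact h.mem x hx (by simpa [hxv] using h1)
  · intro x hx h1
    by_cases hxv : x = v
    · exact hxv ▸ hv
    · exact h.notMem x hx (by simpa [hxv] using h1)
  · intro x hx h1
    by_cases hxv : x = v
    · exact ⟨u, hu, hxv ▸ ho⟩
    · exact h.arc x hx (by simpa [hxv] using h1)

theorem IsGood.chosen_subset (h : IsGood n O S col) : (below n fun v => col v = 1) ⊆ S := by
  intro v hv
  rw [mem_below] at hv
  exact h.mem v hv.1 hv.2

theorem IsGood.numChosen_le (h : IsGood n O S col) : numChosen n col ≤ S.card :=
  Finset.card_le_card h.chosen_subset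

theorem IsGood.eq_of_numChosen (h : IsGood n O S col) (hc : numChosen n col = S.card) :
    (below n fun v => col v = 1) = S :=
  Finset.eq_of_subset_of_card_le h.chosen_subset hc.ge

/-- The arc from `S` into an unmarked rejected vertex starts at a member of `S` not chosen yet, and
each such member has at most `D` out-neighbours. This makes the pruning safe. -/
theorem IsGood.numCharged_le (h : IsGood n O S col) {D : ℕ} (hS : S ⊆ Finset.range n)
    (hD : ∀ u < n, (below n (O u)).card ≤ D) :
    numCharged n O col ≤ D * (S.card - numChosen n col) := by
  classical
  have hsub : (below n fun v => 1 < col v ∧ ¬ IsMarked n O col v) ⊆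
      (S \ below n fun v => col v = 1).biUnion fun u => below n (O u) := by
    intro v hv
    obtain ⟨hv, h1, h2⟩ := mem_below.1 hv
    obtain ⟨u, hu, ho⟩ := h.arc v hv h1
    have hun := Finset.mem_range.1 (hS hu)
    simp only [Finset.mem_biUnion, Finset.mem_sdiff, mem_below, not_and]
    exact ⟨u, ⟨hu, fun _ hc => h2 ⟨u, hun, hc, ho⟩⟩, hv, ho⟩
  calc numCharged n O col ≤ _ := Finset.card_le_card hsub
    _ ≤ (S \ below n fun v => col v = 1).card * D :=
      Finset.card_biUnion_le_card_mul _ _ _ fun u hu =>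
        hD u (Finset.mem_range.1 (hS (Finset.mem_sdiff.1 hu).1))
    _ = D * (S.card - numChosen n col) := by
      rw [Finset.card_sdiff_of_subset h.chosen_subset, mul_comm, numChosen]

theorem mem_choosePairs {v i j : ℕ} (hi : i < n) (hj : j < n) (hij : i < j) (hvi : O v i)
    (hvj : O v j) (hci : col i = 0) (hcj : col j = 0) :
    recolour (recolour col i 1) j 1 ∈ choosePairs n O col v := by
  simp only [choosePairs, List.mem_flatMap, List.mem_range]
  refine ⟨i, hi, j, hj, ?_⟩
  rw [if_pos ⟨hij, ⟨hvi, hci⟩, hvj, hcj⟩]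
  exact List.mem_singleton_self _

/-- If the top vertex is neither in the optimal set nor an out-neighbour of it, then the optimal set
contains two of its undecided out-neighbours. -/
theorem IsFirstMax.exists_pair (hW : ∀ u v, W u v = W v u) (hd : ∀ v, W v v = 0) (h0 : ∀ u v, 0 ≤ W u v)
    (hO : ∀ u v, W u v ≠ 0 → O u v ∨ O v u) (hS : IsFirstOptimal n k W S) (hg : IsGood n O S col)
    (hk : numChosen n col < k) {v : ℕ} (hv : IsFirstMax n W col v) (hvS : v ∉ S)
    (hin : ∀ u ∈ S, ¬ O u v) :
    ∃ i j, i < n ∧ j < n ∧ i < j ∧ O v i ∧ O v j ∧ col i = 0 ∧ col j = 0 ∧ i ∈ S ∧ j ∈ S := by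
  classical
  set F := below n fun x => col x = 1 with hF
  have hFS : F ⊆ S := hg.chosen_subset
  have hlt : F.card < S.card := by rw [hS.card_eq]; exact hk
  have hblank : ∀ u ∈ S, u ∉ F → u < n ∧ col u = 0 := by
    intro u hu huF
    have hun := Finset.mem_range.1 (hS.subset hu)
    refine ⟨hun, ?_⟩
    rcases Nat.lt_trichotomy (col u) 1 with h | h | h
    · omega
    · exact absurd (mem_below.2 ⟨hun, h⟩) huF
    · exact absurd hu (hg.notMem u hun h)
  by_contra hcon
  push Not at hcon
  -- `u` is to be exchanged for `v`: it is the only out-neighbour of `v` in `S \ F` if there is one,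
  -- and any element of `S \ F` otherwise.
  obtain ⟨u, huS, huF, huT⟩ : ∃ u ∈ S, u ∉ F ∧ ∀ x ∈ S, x ∉ F → O v x → x = u := by
    by_cases hT : ∃ u ∈ S, u ∉ F ∧ O v u
    · obtain ⟨u, hu, huF, ho⟩ := hT
      refine ⟨u, hu, huF, fun x hx hxF hox => ?_⟩
      obtain ⟨hun, huc⟩ := hblank u hu huF
      obtain ⟨hxn, hxc⟩ := hblank x hx hxF
      rcases Nat.lt_trichotomy x u with h | h | h
      · exact absurd hu (hcon x u hxn hun h hox ho hxc huc hx)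
      · exact h
      · exact absurd hx (hcon u x hun hxn h ho hox huc hxc hu)
    · push Not at hT
      obtain ⟨u, hu, huF⟩ := Finset.exists_mem_notMem_of_card_lt_card hlt
      exact ⟨u, hu, huF, fun x hx hxF hox => absurd hox (hT x hx hxF)⟩
  obtain ⟨hun, huc⟩ := hblank u huS huF
  set T := S.erase u with hT
  have hvT : v ∉ T := fun h => hvS (Finset.mem_of_mem_erase h)
  have hFT : F ⊆ T := fun x hx => Finset.mem_erase.2 ⟨fun h => huF (h ▸ hx), hFS hx⟩
  have hS' : insert u T = S := Finset.insert_erase huS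
  have hcov : matrixCover n W S = matrixCover n W T + 2 * residualWeight n W T u := by
    rw [← matrixCover_insert hW (hd u) hun (Finset.notMem_erase u S), hS']
  have hcov' : matrixCover n W (insert v T) = matrixCover n W T + 2 * residualWeight n W T v :=
    matrixCover_insert hW (hd v) hv.lt hvT
  -- Passing from `F` to the larger set `T` can only lower residual weights.
  have hu_le : residualWeight n W T u ≤ residualWeight n W F u := by
    refine Finset.sum_le_sum fun x _ => ?_
    by_cases hxF : x ∈ F
    · simp [hxF, hFT hxF]
    · simp only [hxF, if_false]
      split_ifs
      · exact h0 u x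
      · exact le_rfl
  -- For `v` nothing is lost: an edge of positive weight between `v` and `T \ F` would be an arc to
  -- a vertex of `S \ F` other than `u`, or an arc from `S` into `v`.
  have hv_le : residualWeight n W F v ≤ residualWeight n W T v := by
    refine Finset.sum_le_sum fun x _ => ?_
    by_cases hxF : x ∈ F
    · simp [hxF, hFT hxF]
    · simp only [hxF, if_false]
      split_ifs with hxT
      · obtain ⟨hxu, hxS⟩ := Finset.mem_erase.1 hxT
        by_contra hne
        rcases hO v x (fun h => hne h.le) with h | h
        · exact hxu (huT x hxS hxF h)
        · exact hin x hxS h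
      · exact le_rfl
  have hle := hv.le u hun huc
  have hsub : insert v T ⊆ Finset.range n := by
    intro x hx
    rcases Finset.mem_insert.1 hx with rfl | hx
    · exact Finset.mem_range.2 hv.lt
    · exact hS.subset (Finset.mem_of_mem_erase hx)
  have hcard : (insert v T).card = k := by
    rw [Finset.card_insert_of_notMem hvT, ← hS.card_eq, ← hS',
      Finset.card_insert_of_notMem (Finset.notMem_erase u S)]
  -- The exchange does not lower the cover, so equality holds throughout. Then the least vertex sum
  -- gives `u ≤ v`, and the first position among the maxima gives `v ≤ u`.
  have hopt := hS.le _ hsub hcard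
  have hsum := hS.sum_le _ hsub hcard (by linarith)
  have hfirst := hv.first u hun huc (by linarith)
  rw [Finset.sum_insert hvT] at hsum
  have : ∑ x ∈ S, x = u + ∑ x ∈ T, x := by
    rw [← hS', Finset.sum_insert (Finset.notMem_erase u S)]
  have : v = u := by omega
  exact hvS (this ▸ huS)

/-- A good colouring that is not complete has a good child. -/
theorem IsExpansion.exists_good (hW : ∀ u v, W u v = W v u) (hd : ∀ v, W v v = 0)
    (h0 : ∀ u v, 0 ≤ W u v) (hO : ∀ u v, W u v ≠ 0 → O u v ∨ O v u)
    (hS : IsFirstOptimal n k W S) (hg : IsGood n O S col) (hk : numChosen n col < k)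
    {L : List (ℕ → ℕ)} (hL : IsExpansion n W O col L) : ∃ c ∈ L, IsGood n O S c := by
  cases hL with
  | pending v hv hb hm =>
    by_cases hvS : v ∈ S
    · exact ⟨_, by simp [splitOn], hg.choose hvS⟩
    · obtain ⟨u, hu, huc, ho⟩ := hm
      exact ⟨_, by simp [splitOn], hg.reject hvS (hg.mem u hu huc) ho⟩
  | top v hv hm =>
    by_cases hvS : v ∈ S
    · exact ⟨_, by simp [splitOn], hg.choose hvS⟩
    by_cases hin : ∃ u ∈ S, O u v
    · obtain ⟨u, hu, ho⟩ := hin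
      exact ⟨_, by simp [splitOn], hg.reject hvS hu ho⟩
    · push Not at hin
      obtain ⟨i, j, hi, hj, hij, hvi, hvj, hci, hcj, hiS, hjS⟩ :=
        hv.exists_pair hW hd h0 hO hS hg hk hvS hin
      exact ⟨_, List.mem_append_right _ (mem_choosePairs hi hj hij hvi hvj hci hcj),
        (hg.choose hiS).choose hjS⟩
  -- If no vertex is undecided, all members of `S` are chosen, against the count below `k`.
  | none h =>
    exfalso
    have hlt : (below n fun v => col v = 1).card < S.card := by rw [hS.card_eq]; exact hk
    obtain ⟨u, hu, huF⟩ := Finset.exists_mem_notMem_of_card_lt_card hlt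
    have hun := Finset.mem_range.1 (hS.subset hu)
    have := h u hun
    rcases Nat.lt_trichotomy (col u) 1 with h | h | h
    · omega
    · exact huF (mem_below.2 ⟨hun, h⟩)
    · exact hg.notMem u hun h hu

end Good

end RealRAM

namespace RealRAM

/-! ### A potential for partial colourings -/

/-- Rates for which the potential of a colouring bounds the sum of the potentials of its
children. -/
structure Rates (D : ℕ) (A σ γ : ℝ) : Prop where
  one_le : 1 ≤ γ
  le : γ ≤ σ
  pos : 0 < A
  pending : σ ^ D / A + γ⁻¹ ≤ 1
  top : ∀ j ≤ D, γ ^ j * σ ^ (D - j) / A + σ⁻¹ + (j * (j - 1) / 2 : ℝ) * (σ ^ D / A) ^ 2 ≤ 1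

/-- The rates `σ = γ = 2` give choosing and rejecting the share `1 / 2` each. That leaves nothing
for pairs, so it works only for `D < 2`, where there are none. For larger `D` smaller rates make
room. -/
theorem exists_rates (D : ℕ) : ∃ σ γ : ℝ, Rates D (2 ^ (D + 1)) σ γ := by
  rcases Nat.lt_or_ge D 2 with h | h
  · refine ⟨2, 2, by norm_num, le_rfl, by positivity, ?_, fun j hj => ?_⟩
    · rw [pow_succ]; field_simp; norm_num
    · have hj' : j = 0 ∨ j = 1 := by omega
      rw [← pow_add, Nat.add_sub_cancel' hj, pow_succ]
      have : (2 : ℝ) ^ D / (2 ^ D * 2) = 1 / 2 := by field_simp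
      rcases hj' with rfl | rfl <;> rw [this] <;> norm_num
  rcases Nat.eq_or_lt_of_le h with rfl | h
  · refine ⟨3 / 2, 7 / 5, by norm_num, by norm_num, by norm_num, by norm_num, fun j hj => ?_⟩
    interval_cases j <;> norm_num
  -- With `q = (2 / 3) ^ D`, the estimate `D * q ≤ 1` tames the term of the pairs: `D * (D - 1) / 2
  -- * (q / 2) ^ 2 ≤ (D - 1) * q / 8`.
  · have hD : ∀ m : ℕ, ((m + 3 : ℕ) : ℝ) * (2 / 3) ^ (m + 3) ≤ 1 := by
      intro m
      induction m with
      | zero => norm_num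
      | succ m ih =>
        have : (0 : ℝ) ≤ (2 / 3) ^ (m + 3) := by positivity
        have hm : (0 : ℝ) ≤ m := m.cast_nonneg
        rw [show m + 1 + 3 = (m + 3) + 1 from rfl, pow_succ]
        push_cast at ih ⊢
        nlinarith
    obtain ⟨m, rfl⟩ : ∃ m, D = m + 3 := ⟨D - 3, by omega⟩
    have hq : (4 / 3 : ℝ) ^ (m + 3) / 2 ^ (m + 3 + 1) = (2 / 3) ^ (m + 3) / 2 := by
      rw [pow_succ (2 : ℝ) (m + 3), ← div_div, ← div_pow]; norm_num
    have hm := hD m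
    set q : ℝ := (2 / 3) ^ (m + 3) with hqdef
    have hq0 : 0 ≤ q := by positivity
    have hm0 : (0 : ℝ) ≤ m := m.cast_nonneg
    push_cast at hm
    have hm3 : m * q + 3 * q ≤ 1 := by linarith
    refine ⟨4 / 3, 4 / 3, by norm_num, le_rfl, by positivity, ?_, fun j hj => ?_⟩
    · rw [hq]; nlinarith
    · rw [← pow_add, Nat.add_sub_cancel' hj, hq]
      have hj1 : (j : ℝ) ≤ m + 3 := by exact_mod_cast hj
      have hj2 : (j * (j - 1) : ℝ) ≤ (m + 3) * (m + 2) := by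
        rcases Nat.eq_zero_or_pos j with rfl | hj0
        · simp; positivity
        · have : (1 : ℝ) ≤ j := by exact_mod_cast hj0
          nlinarith
      have h1 : (j * (j - 1) / 2 : ℝ) * (q / 2) ^ 2 ≤ ((m + 3) * (m + 2)) / 2 * (q / 2) ^ 2 := by
        gcongr
      have h2 : ((m + 3) * q) * ((m + 2) * q) ≤ (m + 2) * q := by
        have : 0 ≤ (m + 2) * q := by positivity
        nlinarith
      have : ((4 : ℝ) / 3)⁻¹ = 3 / 4 := by norm_num
      rw [this]
      nlinarith

/-- The potential of a colouring bounds the number of its complete descendants. -/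
noncomputable def potential (n k : ℕ) (O : ℕ → ℕ → Prop) (A σ γ : ℝ) (col : ℕ → ℕ) : ℝ :=
  A ^ k * A⁻¹ ^ numChosen n col * σ⁻¹ ^ numCharged n O col * γ ^ numPending n O col

/-! ### How the counts change when a vertex is decided -/

section Counts

variable {n k D : ℕ} {O : ℕ → ℕ → Prop} {col : ℕ → ℕ} {v : ℕ}

theorem IsMarked.recolour_of_blank {u c : ℕ} (h : IsMarked n O col u) (hv : col v = 0) :
    IsMarked n O (recolour col v c) u := by
  obtain ⟨x, hx, h1, ho⟩ := h
  refine ⟨x, hx, ?_, ho⟩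
  have : x ≠ v := by rintro rfl; omega
  simpa [this] using h1

theorem isMarked_recolour_two {u : ℕ} (hv : col v = 0) :
    IsMarked n O (recolour col v 2) u ↔ IsMarked n O col u := by
  refine ⟨?_, fun h => h.recolour_of_blank hv⟩
  rintro ⟨x, hx, h1, ho⟩
  have : x ≠ v := by rintro rfl; simp at h1
  exact ⟨x, hx, by simpa [this] using h1, ho⟩

theorem IsMarked.of_recolour_one {u : ℕ} (h : IsMarked n O (recolour col v 1) u) :
    IsMarked n O col u ∨ O v u := by
  obtain ⟨x, hx, h1, ho⟩ := h
  by_cases hxv : x = v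
  · exact .inr (hxv ▸ ho)
  · exact .inl ⟨x, hx, by simpa [hxv] using h1, ho⟩

theorem numChosen_recolour_one (hv : v < n) (h0 : col v = 0) :
    numChosen n (recolour col v 1) = numChosen n col + 1 := by
  rw [numChosen, numChosen, ← Finset.card_insert_of_notMem (a := v) (by simp [h0])]
  congr 1
  ext u
  by_cases h : u = v <;> simp [h, hv]

theorem numChosen_recolour_two (h0 : col v = 0) :
    numChosen n (recolour col v 2) = numChosen n col := by
  rw [numChosen, numChosen]
  congr 1
  ext u
  by_cases h : u = v <;> simp [h, h0]

theorem numBlank_recolour {c : ℕ} (hv : v < n) (h0 : col v = 0) (hc : c ≠ 0) :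
    numBlank n (recolour col v c) + 1 = numBlank n col := by
  rw [numBlank, numBlank, ← Finset.card_insert_of_notMem (a := v) (by simp [hc])]
  congr 1
  ext u
  by_cases h : u = v <;> simp [h, hv, h0]

/-- Choosing `v` can newly mark only out-neighbours of `v`, so only these can stop being charged. -/
theorem numCharged_le_recolour_one (h0 : col v = 0) :
    numCharged n O col ≤ numCharged n O (recolour col v 1) +
      (below n fun u => O v u ∧ 1 < col u ∧ ¬ IsMarked n O col u).card := by
  classical
  refine (Finset.card_le_card ?_).trans (Finset.card_union_le _ _)
  intro u hu
  simp only [mem_below, Finset.mem_union] at hu ⊢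
  obtain ⟨hu, h1, h2⟩ := hu
  have huv : u ≠ v := by rintro rfl; omega
  by_cases ho : O v u
  · exact .inr ⟨hu, ho, h1, h2⟩
  · refine .inl ⟨hu, by simpa [huv] using h1, fun h => ?_⟩
    exact h.of_recolour_one.elim h2 ho

/-- Only unmarked undecided out-neighbours of `v` are gained. This is an inequality because `v`
itself may have been pending. -/
theorem numPending_recolour_one_le :
    numPending n O (recolour col v 1) ≤ numPending n O col +
      (below n fun u => O v u ∧ col u = 0 ∧ ¬ IsMarked n O col u).card := by
  classical
  refine (Finset.card_le_card ?_).trans (Finset.card_union_le _ _)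
  intro u hu
  simp only [mem_below, Finset.mem_union] at hu ⊢
  obtain ⟨hu, h1, h2⟩ := hu
  have huv : u ≠ v := by rintro rfl; simp at h1
  have h1' : col u = 0 := by simpa [huv] using h1
  have := h2.of_recolour_one
  tauto

/-- An out-neighbour is rejected or undecided, not both. So it costs one factor `σ` or `γ`, and a
choice costs at most `D` factors in all. -/
theorem card_charged_add_card_pending_le (hD : (below n (O v)).card ≤ D) :
    (below n fun u => O v u ∧ 1 < col u ∧ ¬ IsMarked n O col u).card +
      (below n fun u => O v u ∧ col u = 0 ∧ ¬ IsMarked n O col u).card ≤ D := by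
  classical
  rw [← Finset.card_union_of_disjoint]
  · refine (Finset.card_le_card ?_).trans hD
    intro u
    simp only [mem_below, Finset.mem_union]
    tauto
  · rw [Finset.disjoint_left]
    intro u
    simp only [mem_below]
    omega

/-- Rejecting a marked vertex charges nobody and only removes a pending vertex (gain `γ⁻¹`), while
an unmarked one becomes charged (gain `σ⁻¹`). -/
theorem numCharged_recolour_two_of_marked (h0 : col v = 0) (hm : IsMarked n O col v) :
    numCharged n O (recolour col v 2) = numCharged n O col := by
  rw [numCharged, numCharged]
  congr 1
  ext u
  simp only [mem_below, isMarked_recolour_two h0]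
  by_cases h : u = v
  · subst h; simp [h0, hm]
  · simp [h]

theorem numCharged_recolour_two_of_not_marked (hv : v < n) (h0 : col v = 0)
    (hm : ¬ IsMarked n O col v) :
    numCharged n O (recolour col v 2) = numCharged n O col + 1 := by
  rw [numCharged, numCharged, ← Finset.card_insert_of_notMem (a := v) (by simp [h0])]
  congr 1
  ext u
  simp only [mem_below, isMarked_recolour_two h0, Finset.mem_insert]
  by_cases h : u = v
  · subst h; simp [hv, hm]
  · simp [h]

theorem numPending_recolour_two_of_marked (hv : v < n) (h0 : col v = 0) (hm : IsMarked n O col v) :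
    numPending n O (recolour col v 2) + 1 = numPending n O col := by
  rw [numPending, numPending, ← Finset.card_insert_of_notMem (a := v) (by simp)]
  congr 1
  ext u
  simp only [mem_below, isMarked_recolour_two h0, Finset.mem_insert]
  by_cases h : u = v
  · subst h; simp [hv, hm, h0]
  · simp [h]

theorem numPending_recolour_two_of_not_marked (h0 : col v = 0) (hm : ¬ IsMarked n O col v) :
    numPending n O (recolour col v 2) = numPending n O col := by
  rw [numPending, numPending]
  congr 1
  ext u
  simp only [mem_below, isMarked_recolour_two h0]
  by_cases h : u = v
  · subst h; simp [hm]
  · simp [h]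

end Counts

/-! ### The potentials of the children -/

section Potential

variable {n k D : ℕ} {O : ℕ → ℕ → Prop} {col : ℕ → ℕ} {v : ℕ} {A σ γ : ℝ}

theorem Rates.gamma_pos (h : Rates D A σ γ) : 0 < γ := one_pos.trans_le h.one_le

theorem Rates.sigma_pos (h : Rates D A σ γ) : 0 < σ := h.gamma_pos.trans_le h.le

theorem Rates.pow_le (h : Rates D A σ γ) : σ ^ D ≤ A := by
  have h1 := h.pending
  have h2 : 0 < γ⁻¹ := inv_pos.2 h.gamma_pos
  rw [← div_le_one h.pos]
  linarith

theorem Rates.potential_nonneg (h : Rates D A σ γ) : 0 ≤ potential n k O A σ γ col := by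
  have := h.pos; have := h.gamma_pos; have := h.sigma_pos
  unfold potential; positivity

/-- `e` bounds how many vertices stop being charged and `j` how many become pending. They stay
parameters because the two kinds of branching bound them differently. -/
theorem Rates.potential_recolour_one_le' (h : Rates D A σ γ) (hv : v < n) (h0 : col v = 0)
    {e j : ℕ} (he : numCharged n O col ≤ numCharged n O (recolour col v 1) + e)
    (hj : numPending n O (recolour col v 1) ≤ numPending n O col + j) :
    potential n k O A σ γ (recolour col v 1) ≤
      γ ^ j * σ ^ e / A * potential n k O A σ γ col := by
  have hA := h.pos; have hγ := h.gamma_pos; have hσ := h.sigma_pos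
  have h1 : (1 : ℝ) ≤ σ := h.one_le.trans h.le
  have hc : σ⁻¹ ^ numCharged n O (recolour col v 1) ≤ σ ^ e * σ⁻¹ ^ numCharged n O col := by
    have : σ ^ numCharged n O col ≤ σ ^ (numCharged n O (recolour col v 1) + e) :=
      pow_le_pow_right₀ h1 he
    rw [inv_pow, inv_pow, ← div_eq_mul_inv, inv_eq_one_div, div_le_div_iff₀ (by positivity)
      (by positivity), one_mul, ← pow_add, add_comm e]
    exact this
  have hp : γ ^ numPending n O (recolour col v 1) ≤ γ ^ j * γ ^ numPending n O col := by
    rw [← pow_add, add_comm j]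
    exact pow_le_pow_right₀ h.one_le hj
  unfold potential
  rw [numChosen_recolour_one hv h0]
  calc _ ≤ A ^ k * A⁻¹ ^ (numChosen n col + 1) * (σ ^ e * σ⁻¹ ^ numCharged n O col) *
        (γ ^ j * γ ^ numPending n O col) := by gcongr
    _ = _ := by rw [pow_succ]; ring

/-- As `γ ≤ σ`, the worst case is that `D` out-neighbours stop being charged. -/
theorem Rates.potential_recolour_one_le (h : Rates D A σ γ) (hv : v < n) (h0 : col v = 0)
    (hD : (below n (O v)).card ≤ D) :
    potential n k O A σ γ (recolour col v 1) ≤ σ ^ D / A * potential n k O A σ γ col := by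
  refine (h.potential_recolour_one_le' hv h0 (numCharged_le_recolour_one h0)
    numPending_recolour_one_le).trans ?_
  have hsum := card_charged_add_card_pending_le (O := O) (col := col) hD
  set e := (below n fun u => O v u ∧ 1 < col u ∧ ¬ IsMarked n O col u).card
  set j := (below n fun u => O v u ∧ col u = 0 ∧ ¬ IsMarked n O col u).card
  have hA := h.pos; have hγ := h.gamma_pos; have hσ := h.sigma_pos
  have h1 : (1 : ℝ) ≤ σ := h.one_le.trans h.le
  refine mul_le_mul_of_nonneg_right ?_ h.potential_nonneg
  refine div_le_div_of_nonneg_right ?_ hA.le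
  calc γ ^ j * σ ^ e ≤ σ ^ j * σ ^ e := by gcongr; exact h.le
    _ = σ ^ (j + e) := (pow_add _ _ _).symm
    _ ≤ σ ^ D := pow_le_pow_right₀ h1 (by omega)

/-- Without pending vertices, every undecided out-neighbour of `v` is unmarked and takes the cheaper
factor `γ`, so fewer are left for `σ`. The number of pairs grows with the same count, so the two
effects are weighed against each other in `Rates.top`. -/
theorem Rates.potential_recolour_one_le_of_no_pending (h : Rates D A σ γ) (hv : v < n)
    (h0 : col v = 0) (hD : (below n (O v)).card ≤ D)
    (hm : ∀ u < n, col u = 0 → ¬ IsMarked n O col u) :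
    (below n fun u => O v u ∧ col u = 0).card ≤ D ∧
    potential n k O A σ γ (recolour col v 1) ≤
      γ ^ (below n fun u => O v u ∧ col u = 0).card *
        σ ^ (D - (below n fun u => O v u ∧ col u = 0).card) / A *
        potential n k O A σ γ col := by
  have hsum := card_charged_add_card_pending_le (O := O) (col := col) hD
  have hj := numPending_recolour_one_le (n := n) (O := O) (col := col) (v := v)
  have heq : (below n fun u => O v u ∧ col u = 0 ∧ ¬ IsMarked n O col u) =
      below n fun u => O v u ∧ col u = 0 := by
    ext u
    simp only [mem_below]
    have := hm u
    tauto
  rw [heq] at hsum hj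
  refine ⟨by omega, h.potential_recolour_one_le' hv h0 ?_ hj⟩
  exact (numCharged_le_recolour_one h0).trans (by omega)

theorem Rates.potential_recolour_two_of_marked (h : Rates D A σ γ) (hv : v < n) (h0 : col v = 0)
    (hm : IsMarked n O col v) :
    potential n k O A σ γ (recolour col v 2) = γ⁻¹ * potential n k O A σ γ col := by
  have hγ := h.gamma_pos
  unfold potential
  rw [numChosen_recolour_two h0, numCharged_recolour_two_of_marked h0 hm,
    ← numPending_recolour_two_of_marked hv h0 hm, pow_succ]
  field_simp

theorem potential_recolour_two_of_not_marked (hv : v < n) (h0 : col v = 0)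
    (hm : ¬ IsMarked n O col v) :
    potential n k O A σ γ (recolour col v 2) = σ⁻¹ * potential n k O A σ γ col := by
  unfold potential
  rw [numChosen_recolour_two h0, numCharged_recolour_two_of_not_marked hv h0 hm,
    numPending_recolour_two_of_not_marked h0 hm, pow_succ]
  ring

/-- Swapping matches increasing pairs with decreasing ones, and together they fit into the
off-diagonal. Over the reals the factor `card - 1` is not truncated. -/
theorem card_filter_lt_le (s : Finset ℕ) :
    (((s ×ˢ s).filter fun p => p.1 < p.2).card : ℝ) ≤ s.card * (s.card - 1) / 2 := by
  have h1 : ((s ×ˢ s).filter fun p => p.1 < p.2).card =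
      ((s ×ˢ s).filter fun p => p.2 < p.1).card := by
    refine Finset.card_bij (fun p _ => p.swap) ?_ ?_ ?_
    · simp +contextual
    · simp +contextual
    · intro p hp
      exact ⟨p.swap, by simpa [and_comm] using hp, by simp⟩
  have h2 : ((s ×ˢ s).filter fun p => p.1 < p.2).card +
      ((s ×ˢ s).filter fun p => p.2 < p.1).card ≤ s.offDiag.card := by
    rw [← Finset.card_union_of_disjoint]
    · refine Finset.card_le_card fun p => ?_
      simp only [Finset.mem_union, Finset.mem_filter, Finset.mem_product, Finset.mem_offDiag]
      rintro (⟨h, h'⟩ | ⟨h, h'⟩)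
      · exact ⟨h.1, h.2, h'.ne⟩
      · exact ⟨h.1, h.2, h'.ne'⟩
    · rw [Finset.disjoint_left]
      intro p
      simp only [Finset.mem_filter]
      omega
  rw [Finset.offDiag_card] at h2
  have h3 : s.card ≤ s.card * s.card := Nat.le_mul_self _
  have h4 : (2 * ((s ×ˢ s).filter fun p => p.1 < p.2).card + s.card : ℝ) ≤ s.card * s.card := by
    have : 2 * ((s ×ˢ s).filter fun p => p.1 < p.2).card + s.card ≤ s.card * s.card := by omega
    exact_mod_cast this
  linarith

theorem sum_map_flatMap_range {α : Type*} (n : ℕ) (f : ℕ → List α) (g : α → ℝ) :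
    (((List.range n).flatMap f).map g).sum = ∑ i ∈ Finset.range n, ((f i).map g).sum := by
  induction n with
  | zero => simp
  | succ n ih => simp [List.range_succ, Finset.sum_range_succ, ih]

theorem length_flatMap_range_le {α : Type*} (n m : ℕ) (f : ℕ → List α)
    (hf : ∀ i, (f i).length ≤ m) : ((List.range n).flatMap f).length ≤ n * m := by
  induction n with
  | zero => simp
  | succ n ih =>
    rw [List.range_succ, List.flatMap_append, List.length_append, add_mul, one_mul]
    exact add_le_add ih (by simpa using hf n)

/-- Choosing a pair means two successive choices, each with the crude factor `σ ^ D / A`. -/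
theorem Rates.sum_choosePairs_le (h : Rates D A σ γ) (hD : ∀ u < n, (below n (O u)).card ≤ D) :
    ((choosePairs n O col v).map (potential n k O A σ γ)).sum ≤
      ((below n fun u => O v u ∧ col u = 0).card *
        ((below n fun u => O v u ∧ col u = 0).card - 1) / 2 : ℝ) * (σ ^ D / A) ^ 2 *
        potential n k O A σ γ col := by
  classical
  have hA := h.pos; have hγ := h.gamma_pos; have hσ := h.sigma_pos
  set B := below n fun u => O v u ∧ col u = 0 with hB
  have hP := h.potential_nonneg (n := n) (k := k) (O := O) (col := col)
  set q := (σ ^ D / A) ^ 2 * potential n k O A σ γ col with hq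
  have hq0 : 0 ≤ q := by positivity
  rw [choosePairs, sum_map_flatMap_range]
  simp_rw [sum_map_flatMap_range]
  have hterm : ∀ i ∈ Finset.range n, ∀ j ∈ Finset.range n,
      (((if i < j ∧ (O v i ∧ col i = 0) ∧ (O v j ∧ col j = 0) then
        [recolour (recolour col i 1) j 1] else []).map (potential n k O A σ γ)).sum : ℝ) ≤
      if (i, j) ∈ (B ×ˢ B).filter (fun p => p.1 < p.2) then q else 0 := by
    intro i hi j hj
    rw [Finset.mem_range] at hi hj
    by_cases hij : i < j ∧ (O v i ∧ col i = 0) ∧ (O v j ∧ col j = 0)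
    · have hmem : (i, j) ∈ (B ×ˢ B).filter (fun p => p.1 < p.2) := by
        simp [hB, hi, hj, hij]
      rw [if_pos hij, if_pos hmem]
      simp only [List.map_cons, List.map_nil, List.sum_cons, List.sum_nil, add_zero]
      have hj0 : recolour col i 1 j = 0 := by
        have : j ≠ i := hij.1.ne'
        simpa [this] using hij.2.2.2
      have h1 := h.potential_recolour_one_le (k := k) hi hij.2.1.2 (hD i hi)
      have h2 := h.potential_recolour_one_le (k := k) hj hj0 (hD j hj)
      refine h2.trans ?_
      rw [hq, sq, mul_assoc]
      gcongr
    · rw [if_neg hij]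
      simp only [List.map_nil, List.sum_nil]
      split_ifs
      · exact hq0
      · exact le_rfl
  refine (Finset.sum_le_sum fun i hi => Finset.sum_le_sum fun j hj => hterm i hi j hj).trans ?_
  rw [← Finset.sum_product', Finset.sum_ite_mem, Finset.sum_const, nsmul_eq_mul, mul_assoc]
  refine mul_le_mul_of_nonneg_right ?_ hq0
  refine le_trans ?_ (card_filter_lt_le B)
  exact_mod_cast Finset.card_le_card Finset.inter_subset_right

/-- The contributions of the children are, term by term, bounded by the left sides of
`Rates.pending` and `Rates.top` times the potential of the parent. -/
theorem IsExpansion.sum_potential_le {W : ℕ → ℕ → ℝ} (h : Rates D A σ γ)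
    (hD : ∀ u < n, (below n (O u)).card ≤ D) {L : List (ℕ → ℕ)} (hL : IsExpansion n W O col L) :
    (L.map (potential n k O A σ γ)).sum ≤ potential n k O A σ γ col := by
  have hP := h.potential_nonneg (n := n) (k := k) (O := O) (col := col)
  cases hL with
  | pending v hv h0 hm =>
    have h1 := h.potential_recolour_one_le (k := k) hv h0 (hD v hv)
    have h2 := h.potential_recolour_two_of_marked (k := k) hv h0 hm
    have h3 := h.pending
    simp only [splitOn, List.map_cons, List.map_nil, List.sum_cons, List.sum_nil, h2]
    nlinarith
  | top v hv hm =>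
    obtain ⟨hj, h1⟩ := h.potential_recolour_one_le_of_no_pending (k := k) hv.lt hv.blank
      (hD v hv.lt) hm
    have h2 := potential_recolour_two_of_not_marked (k := k) (A := A) (σ := σ) (γ := γ) hv.lt
      hv.blank (hm v hv.lt hv.blank)
    have h3 := h.sum_choosePairs_le (k := k) (col := col) (v := v) hD
    have h4 := h.top _ hj
    simp only [splitOn, List.map_append, List.sum_append, List.map_cons, List.map_nil,
      List.sum_cons, List.sum_nil, h2]
    nlinarith
  | none h => simpa using hP

theorem IsExpansion.length_le {W : ℕ → ℕ → ℝ} {L : List (ℕ → ℕ)} (hL : IsExpansion n W O col L) :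
    L.length ≤ n * n + 2 := by
  cases hL with
  | pending v hv h0 hm => simp [splitOn]
  | top v hv hm =>
    have : (choosePairs n O col v).length ≤ n * n := by
      refine length_flatMap_range_le _ _ _ fun i => ?_
      refine (length_flatMap_range_le _ 1 _ fun j => ?_).trans (by simp)
      split_ifs <;> simp
    simp [splitOn]
    omega
  | none h => simp

theorem IsExpansion.numBlank_lt {W : ℕ → ℕ → ℝ} {L : List (ℕ → ℕ)} (hL : IsExpansion n W O col L)
    {c : ℕ → ℕ} (hc : c ∈ L) : numBlank n c + 1 ≤ numBlank n col := by
  have hsplit : ∀ v < n, col v = 0 → c ∈ splitOn col v → numBlank n c + 1 ≤ numBlank n col := by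
    intro v hv h0 hc
    simp only [splitOn, List.mem_cons, List.not_mem_nil, or_false] at hc
    rcases hc with rfl | rfl
    · exact (numBlank_recolour hv h0 (by norm_num)).le
    · exact (numBlank_recolour hv h0 (by norm_num)).le
  cases hL with
  | pending v hv h0 hm => exact hsplit v hv h0 hc
  | top v hv hm =>
    rcases List.mem_append.1 hc with hc | hc
    · exact hsplit v hv.lt hv.blank hc
    · simp only [choosePairs, List.mem_flatMap, List.mem_range] at hc
      obtain ⟨i, hi, j, hj, hc⟩ := hc
      split_ifs at hc with hij
      · rw [List.mem_singleton] at hc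
        subst hc
        have hj0 : recolour col i 1 j = 0 := by
          have : j ≠ i := hij.1.ne'
          simpa [this] using hij.2.2.2
        have h1 := numBlank_recolour (c := 1) hi hij.2.1.2 (by norm_num)
        have h2 := numBlank_recolour (c := 1) hj hj0 (by norm_num)
        omega
      · simp at hc
  | none h => simp at hc

/-- The colouring is neither complete nor pruned. -/
def IsActive (n k D : ℕ) (O : ℕ → ℕ → Prop) (col : ℕ → ℕ) : Prop :=
  numChosen n col < k ∧ numCharged n O col ≤ D * (k - numChosen n col)

/-- With `m` vertices still to be chosen, at most `D * m` are charged. Because `σ ^ D ≤ A`, the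
factor `A ^ m` outweighs all their factors `σ⁻¹`, and pending vertices only help. -/
theorem IsActive.one_le_potential (h : Rates D A σ γ) (ha : IsActive n k D O col) :
    1 ≤ potential n k O A σ γ col := by
  obtain ⟨hk, hc⟩ := ha
  have hA := h.pos; have hγ := h.gamma_pos; have hσ := h.sigma_pos
  have h1 : (1 : ℝ) ≤ σ := h.one_le.trans h.le
  have h2 : A ^ k * A⁻¹ ^ numChosen n col = A ^ (k - numChosen n col) := by
    rw [inv_pow, pow_sub₀ _ hA.ne' hk.le]
  have h3 : σ ^ numCharged n O col ≤ A ^ (k - numChosen n col) := by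
    calc σ ^ numCharged n O col ≤ σ ^ (D * (k - numChosen n col)) := pow_le_pow_right₀ h1 hc
      _ = (σ ^ D) ^ (k - numChosen n col) := pow_mul _ _ _
      _ ≤ _ := by gcongr; exact h.pow_le
  have h4 : 1 ≤ A ^ (k - numChosen n col) * σ⁻¹ ^ numCharged n O col := by
    rw [inv_pow, ← div_eq_mul_inv, one_le_div (by positivity)]
    exact h3
  have h5 : 1 ≤ γ ^ numPending n O col := one_le_pow₀ h.one_le
  rw [potential, h2]
  nlinarith

open Classical in
/-- A bound for the number of descendants of a colouring. -/
noncomputable def weight (n k D : ℕ) (O : ℕ → ℕ → Prop) (A σ γ : ℝ) (col : ℕ → ℕ) : ℝ :=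
  if IsActive n k D O col then
    (n * n + 3 : ℝ) * (numBlank n col + 1) * potential n k O A σ γ col else 1

theorem Rates.one_le_weight (h : Rates D A σ γ) : 1 ≤ weight n k D O A σ γ col := by
  unfold weight
  split_ifs with ha
  · have h1 := ha.one_le_potential h
    have h2 : (1 : ℝ) ≤ (n * n + 3 : ℝ) * (numBlank n col + 1) := by
      have : (0 : ℝ) ≤ n * n := by positivity
      have : (0 : ℝ) ≤ numBlank n col := by positivity
      nlinarith
    nlinarith
  · exact le_rfl

/-- The weight of a colouring exceeds the sum of the weights of its children. -/
theorem IsExpansion.sum_weight_lt {W : ℕ → ℕ → ℝ} (h : Rates D A σ γ)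
    (hD : ∀ u < n, (below n (O u)).card ≤ D) (ha : IsActive n k D O col) {L : List (ℕ → ℕ)}
    (hL : IsExpansion n W O col L) :
    (L.map (weight n k D O A σ γ)).sum + 1 ≤ weight n k D O A σ γ col := by
  have hK : (0 : ℝ) ≤ n * n + 3 := by positivity
  -- Every child has fewer undecided vertices, so its factor `numBlank + 1` is at most the
  -- `numBlank` of the parent. The added `1` covers inactive children.
  have h1 : ∀ c ∈ L, weight n k D O A σ γ c ≤
      (n * n + 3 : ℝ) * numBlank n col * potential n k O A σ γ c + 1 := by
    intro c hc
    have h2 : (numBlank n c + 1 : ℝ) ≤ numBlank n col := by exact_mod_cast hL.numBlank_lt hc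
    have hP := h.potential_nonneg (n := n) (k := k) (O := O) (col := c)
    unfold weight
    split_ifs
    · have : (n * n + 3 : ℝ) * (numBlank n c + 1) * potential n k O A σ γ c ≤
          (n * n + 3 : ℝ) * numBlank n col * potential n k O A σ γ c := by gcongr
      linarith
    · have : 0 ≤ (n * n + 3 : ℝ) * numBlank n col * potential n k O A σ γ c := by positivity
      linarith
  have h2 : (L.map (weight n k D O A σ γ)).sum ≤ (n * n + 3 : ℝ) * numBlank n col *
      (L.map (potential n k O A σ γ)).sum + L.length := by
    refine (List.sum_le_sum h1).trans ?_
    rw [List.sum_map_add, List.sum_map_mul_left]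
    simp
  have h3 := hL.sum_potential_le (k := k) h hD
  have h4 : (L.length : ℝ) ≤ n * n + 2 := by exact_mod_cast hL.length_le
  have h5 := ha.one_le_potential h
  have h6 : (n * n + 3 : ℝ) * numBlank n col * (L.map (potential n k O A σ γ)).sum ≤
      (n * n + 3 : ℝ) * numBlank n col * potential n k O A σ γ col := by gcongr
  -- The unit of `numBlank + 1` still unspent is worth `n * n + 3` times a potential of at least
  -- `1`: this pays `1` for each of at most `n * n + 2` children and `1` for the colouring itself.
  rw [weight, if_pos ha]
  nlinarith

end Potential

end RealRAM

namespace RealRAM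

@[simp] theorem card_below_zero (p : ℕ → Prop) : (below 0 p).card = 0 := by simp [below]

open Classical in
theorem card_below_succ (n : ℕ) (p : ℕ → Prop) :
    (below (n + 1) p).card = (below n p).card + if p n then 1 else 0 := by
  unfold below
  rw [Finset.range_add_one, Finset.filter_insert]
  split_ifs <;> simp

/-! ### The branching program

Registers: `0` holds `n`, `1` holds `k`, `2` holds `1`, `3` holds `0`, `4` is a waste register,
`5` is the stack pointer, `6` holds the bound `D` for the out-degrees, `7` is a pointer, `8` is a
buffer, `9`, `10`, `11` and `23` are loop counters, `12` is a pointer into a matrix, `13` and `14`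
are buffers, `15`, `16`, `17` and `18` hold numbers of vertices, `19` is a flag, `20` holds a
vertex, `21` and `22` hold degrees. Real registers: `0` holds `0`, `1` the best value found, `2` a
sum, `3` is a buffer, `4` holds a maximum. Arrays: `0` adjacency matrix, `1` best set found, `2`
stack of colourings, `3` current colouring, `4` marks, `5` matrix of the orientation, `6` candidates,
`7` removed vertices. -/

section Semantics

variable {α : Type} (s : State)

@[simp] theorem Cmd.eval_instr (i : Instr) : (Cmd.instr i).eval s = i.apply s := rfl

@[simp] theorem Cmd.eval_seq (p q : Cmd) : (Cmd.seq p q).eval s = q.eval (p.eval s) := rfl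

@[simp] theorem Cmd.eval_ite_lt (x y : ℕ) (p q : Cmd) :
    (Cmd.ite (.lt x y) p q).eval s = if s.reg x < s.reg y then p.eval s else q.eval s := by
  by_cases h : s.reg x < s.reg y <;> simp [Cmd.eval, Test.Holds, h]

open Classical in
@[simp] theorem Cmd.eval_ite_rlt (x y : ℕ) (p q : Cmd) :
    (Cmd.ite (.rlt x y) p q).eval s = if s.rreg x < s.rreg y then p.eval s else q.eval s := by
  by_cases h : s.rreg x < s.rreg y <;> simp [Cmd.eval, Test.Holds, h]

@[simp] theorem setCell_same (m : ℕ → ℕ → α) (a i : ℕ) (v : α) :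
    setCell m a i v a = Function.update (m a) i v := by simp [setCell]

@[simp] theorem setCell_of_ne (m : ℕ → ℕ → α) {a b : ℕ} (h : b ≠ a) (i : ℕ) (v : α) :
    setCell m a i v b = m b := by simp [setCell, h]

end Semantics

attribute [simp] Instr.apply Op.eval

local infixr:60 " ;; " => Cmd.seq

namespace Cmd

abbrev const (x c : ℕ) : Cmd := instr (.const x c)
-- Copying is subtraction of the `0` in register `3`, since adding register `3` would not be `slow`.
abbrev copy (x y : ℕ) : Cmd := instr (.op .sub x y 3)
abbrev minus (x y z : ℕ) : Cmd := instr (.op .sub x y z)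
abbrev incr (x : ℕ) : Cmd := instr (.op .add x x 2)
abbrev addWidth (x : ℕ) : Cmd := instr (.op .add x x 0)
abbrev load (x a i : ℕ) : Cmd := instr (.load x a i)
abbrev store (a i x : ℕ) : Cmd := instr (.store a i x)
abbrev radd (x y z : ℕ) : Cmd := instr (.radd x y z)
abbrev rload (x i : ℕ) : Cmd := instr (.rload x 0 i)
abbrev skip : Cmd := const 4 0

/-- Branch according to whether the register `x` is positive. -/
def ifPos (x : ℕ) (p q : Cmd) : Cmd := ite (.lt 3 x) p q

/-- Branch according to whether the register `x` holds `1`. -/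
def ifOne (x : ℕ) (p q : Cmd) : Cmd := ite (.lt 3 x) (ite (.lt 2 x) q p) q

@[simp] theorem eval_ifPos {s : State} (h3 : s.reg 3 = 0) (x : ℕ) (p q : Cmd) :
    (ifPos x p q).eval s = if s.reg x = 0 then q.eval s else p.eval s := by
  by_cases h : s.reg x = 0
  · simp [ifPos, h3, h]
  · simp [ifPos, h3, h, Nat.pos_of_ne_zero h]

@[simp] theorem eval_ifOne {s : State} (h2 : s.reg 2 = 1) (h3 : s.reg 3 = 0) (x : ℕ) (p q : Cmd) :
    (ifOne x p q).eval s = if s.reg x = 1 then p.eval s else q.eval s := by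
  rcases Nat.lt_trichotomy (s.reg x) 1 with h | h | h
  · have h0 : s.reg x = 0 := by omega
    simp [ifOne, h3, h0]
  · simp [ifOne, h2, h3, h]
  · have h0 : 0 < s.reg x := by omega
    have h1 : s.reg x ≠ 1 := by omega
    simp [ifOne, h2, h3, h0, h, h1]

/-- Push the current colouring on the stack. -/
def push : Cmd :=
  copy 7 5 ;; loop 9 (load 8 3 9 ;; store 2 7 8 ;; incr 7) ;; addWidth 5

/-- Pop the current colouring from the stack. -/
def pop : Cmd :=
  minus 5 5 0 ;; copy 7 5 ;; loop 9 (load 8 2 7 ;; store 3 9 8 ;; incr 7)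

/-- Mark the out-neighbours of the vertex in the register `10` if it is chosen. -/
def markRow : Cmd :=
  load 13 3 10 ;; loop 11 (load 14 5 12 ;; incr 12 ;;
    ifOne 13 (ifPos 14 (store 4 11 2) skip) skip)

/-- Mark the out-neighbours of the chosen vertices. -/
def mark : Cmd := loop 10 (store 4 10 3) ;; const 12 0 ;; loop 10 markRow

/-- Count the chosen vertices and the rejected vertices that are not marked. -/
def count : Cmd :=
  const 15 0 ;; const 16 0 ;; loop 10 (load 13 3 10 ;; load 14 4 10 ;;
    ifOne 13 (incr 15) skip ;; ite (.lt 2 13) (ifPos 14 skip (incr 16)) skip)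

/-- Add the content of the register `6` to the register `17`. -/
def addDegree : Cmd := loop 11 (ite (.lt 11 6) (incr 17) skip)

/-- Compute the product of `D` and the number of vertices that are still to be chosen. -/
def limit : Cmd :=
  minus 18 1 15 ;; const 17 0 ;; loop 10 (ite (.lt 10 18) addDegree skip)

/-- Look for an undecided vertex that is marked. -/
def findPending : Cmd :=
  const 19 0 ;; loop 10 (load 13 3 10 ;; load 14 4 10 ;;
    ifPos 13 skip (ifPos 14 (const 19 1 ;; copy 20 10) skip))

/-- Add up the weights of the edges from the vertex in the register `10` to vertices that are not
chosen. -/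
def rowResidual : Cmd :=
  radd 2 0 0 ;; loop 11 (load 13 3 11 ;; rload 3 12 ;; incr 12 ;; ifOne 13 skip (radd 2 2 3))

/-- Record the vertex in the register `10` as the one of maximum residual weight. -/
def recordTop : Cmd := const 19 1 ;; copy 20 10 ;; radd 4 2 0

/-- Look for the first undecided vertex of maximum residual weight. -/
def findTop : Cmd :=
  const 12 0 ;; loop 10 (rowResidual ;; load 13 3 10 ;;
    ifPos 13 skip (ifPos 19 (ite (.rlt 4 2) recordTop skip) recordTop))

/-- Push the two colourings that arise from deciding about the vertex in the register `20`. -/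
def split : Cmd :=
  store 3 20 2 ;; push ;; const 13 2 ;; store 3 20 13 ;; push ;; store 3 20 3

/-- Let the register `7` point to the row of the vertex in the register `20`. -/
def rowPointer : Cmd := const 7 0 ;; loop 10 (ite (.lt 10 20) (addWidth 7) skip)

/-- Determine the undecided out-neighbours of the vertex in the register `20`. -/
def findCandidates : Cmd :=
  rowPointer ;; loop 10 (load 13 5 7 ;; load 14 3 10 ;; incr 7 ;; store 6 10 3 ;;
    ifPos 13 (ifPos 14 skip (store 6 10 2)) skip)

/-- Push the colouring in which the vertices in the registers `10` and `11` are chosen. -/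
def pushPair : Cmd :=
  store 3 10 2 ;; store 3 11 2 ;; push ;; store 3 10 3 ;; store 3 11 3

/-- Push the colourings in which the vertex in the register `10` and a later candidate are
chosen. -/
def pairsRow : Cmd :=
  load 13 6 10 ;; loop 11 (load 14 6 11 ;;
    ite (.lt 10 11) (ifPos 13 (ifPos 14 pushPair skip) skip) skip)

/-- Push the children of the current colouring. -/
def expand : Cmd :=
  findPending ;; ifPos 19 split
    (findTop ;; ifPos 19 (split ;; findCandidates ;; loop 10 pairsRow) skip)

/-- Add the weights in the row of the vertex in the register `10` that the chosen vertices cover. -/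
def rowCover : Cmd :=
  load 13 3 10 ;; loop 11 (load 14 3 11 ;; rload 3 12 ;; incr 12 ;;
    ifOne 13 (radd 2 2 3) (ifOne 14 (radd 2 2 3) skip))

/-- Save the set of chosen vertices as the best one. -/
def saveBest : Cmd :=
  radd 1 2 0 ;; loop 10 (load 13 3 10 ;; store 1 10 3 ;; ifOne 13 (store 1 10 2) skip)

/-- Compute the covered weight of the set of chosen vertices and compare it with the best one. -/
def evaluate : Cmd :=
  radd 2 0 0 ;; const 12 0 ;; loop 10 rowCover ;; ite (.rlt 2 1) skip saveBest

/-- Handle the topmost colouring on the stack. -/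
def body : Cmd :=
  pop ;; mark ;; count ;;
    ite (.lt 15 1) (limit ;; ite (.lt 17 16) skip expand) (ite (.lt 1 15) skip evaluate)

end Cmd

/-! ### Correctness of the stack operations and of the marks -/

theorem eval_push {n : ℕ} {s : State} (hs : Std n s) :
    (Cmd.push.eval s).reg 5 = s.reg 5 + n ∧ ∀ x, (Cmd.push.eval s).mem 2 x =
      if s.reg 5 ≤ x ∧ x < s.reg 5 + n then s.mem 3 (x - s.reg 5) else s.mem 2 x := by
  set p : Cmd := Cmd.load 8 3 9 ;; Cmd.store 2 7 8 ;; Cmd.incr 7 with hp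
  set s₁ := (Cmd.copy 7 5).eval s with hs₁
  have hstd : Std n s₁ := hs.eval rfl
  have h := Cmd.eval_loop_induct (n := n) (i := 9) (p := p) (s := s₁) rfl hstd
    (fun j s' => s'.reg 7 = s.reg 5 + j ∧ ∀ x, s'.mem 2 x =
      if s.reg 5 ≤ x ∧ x < s.reg 5 + j then s.mem 3 (x - s.reg 5) else s.mem 2 x)
    (by
      have := hs.reg_three
      refine ⟨by simp [hs₁, this], fun x => ?_⟩
      rw [if_neg (by omega)]; simp [hs₁])
    (by
      intro j s' hj hs' hi ha ⟨h1, h2⟩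
      have h3 : s'.mem 3 = s.mem 3 := by simpa [hs₁] using ha.mem 3 (by decide)
      refine ⟨by simp [hp, h1, hs'.reg_two]; omega, fun x => ?_⟩
      simp only [hp, Cmd.eval_seq, Cmd.eval_instr, Instr.apply, setCell_same,
        Function.update_self, Function.update_apply, h1, h2, h3, hi]
      by_cases hx : x = s.reg 5 + j
      · subst hx; simp
      · simp [hx]
        congr 1
        simp; omega)
  set s₂ := (Cmd.loop 9 p).eval s₁ with hs₂
  have ha : Agree _ s₁ s₂ := Cmd.agree_eval _ s₁
  have h5 : s₂.reg 5 = s.reg 5 := by simpa [hs₁] using ha.reg 5 (by decide)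
  have h0 : s₂.reg 0 = n := (hstd.eval (c := .loop 9 p) rfl).reg_zero
  have heq : Cmd.push.eval s = (Cmd.addWidth 5).eval s₂ := rfl
  rw [heq]
  exact ⟨by simp [h5, h0], fun x => by simpa using h.2 x⟩

theorem eval_pop {n : ℕ} {s : State} (hs : Std n s) :
    (Cmd.pop.eval s).reg 5 = s.reg 5 - n ∧
    ∀ v < n, (Cmd.pop.eval s).mem 3 v = s.mem 2 (s.reg 5 - n + v) := by
  set p : Cmd := Cmd.load 8 2 7 ;; Cmd.store 3 9 8 ;; Cmd.incr 7 with hp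
  set s₁ := (Cmd.minus 5 5 0 ;; Cmd.copy 7 5).eval s with hs₁
  have hstd : Std n s₁ := hs.eval rfl
  have h := Cmd.eval_loop_induct (n := n) (i := 9) (p := p) (s := s₁) rfl hstd
    (fun j s' => s'.reg 7 = s.reg 5 - n + j ∧ ∀ v < j, s'.mem 3 v = s.mem 2 (s.reg 5 - n + v))
    (by simp [hs₁, hs.reg_three, hs.reg_zero])
    (by
      intro j s' hj hs' hi ha ⟨h1, h2⟩
      have h3 : s'.mem 2 = s.mem 2 := by simpa [hs₁] using ha.mem 2 (by decide)
      refine ⟨by simp [hp, h1, hs'.reg_two]; omega, fun v hv => ?_⟩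
      by_cases hvj : v = j
      · subst hvj; simp [hp, hi, h1, h3]
      · have := h2 v (by omega)
        simp [hp, hi, hvj, this])
  have heq : Cmd.pop.eval s = (Cmd.loop 9 p).eval s₁ := rfl
  rw [heq]
  refine ⟨?_, h.2⟩
  have := (Cmd.agree_eval (.loop 9 p) s₁).reg 5 (by decide)
  rw [this]
  simp [hs₁, hs.reg_zero]

theorem eval_markRow {n : ℕ} {s : State} (hs : Std n s) :
    (Cmd.markRow.eval s).reg 12 = s.reg 12 + n ∧
    ∀ v, (Cmd.markRow.eval s).mem 4 v ≠ 0 ↔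
      s.mem 4 v ≠ 0 ∨ v < n ∧ s.mem 3 (s.reg 10) = 1 ∧ s.mem 5 (s.reg 12 + v) ≠ 0 := by
  set p : Cmd := Cmd.load 14 5 12 ;; Cmd.incr 12 ;;
    Cmd.ifOne 13 (Cmd.ifPos 14 (Cmd.store 4 11 2) Cmd.skip) Cmd.skip with hp
  set s₁ := (Cmd.load 13 3 10).eval s with hs₁
  have hstd : Std n s₁ := hs.eval rfl
  exact Cmd.eval_loop_induct (n := n) (i := 11) (p := p) (s := s₁) rfl hstd
    (fun j s' => s'.reg 12 = s.reg 12 + j ∧ ∀ v, s'.mem 4 v ≠ 0 ↔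
      s.mem 4 v ≠ 0 ∨ v < j ∧ s.mem 3 (s.reg 10) = 1 ∧ s.mem 5 (s.reg 12 + v) ≠ 0)
    (by simp [hs₁])
    (by
      intro j s' hj hs' hi ha ⟨h1, h2⟩
      have h5 : s'.mem 5 = s.mem 5 := by simpa [hs₁] using ha.mem 5 (by decide)
      have h13 : s'.reg 13 = s.mem 3 (s.reg 10) := by simpa [hs₁] using ha.reg 13 (by decide)
      simp only [hp, Cmd.eval_seq]
      by_cases hc : s.mem 3 (s.reg 10) = 1
      · by_cases ho : s.mem 5 (s.reg 12 + j) = 0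
        · simp [hs'.reg_two, hs'.reg_three, h13, h1, h5, hc, ho]
          refine ⟨by omega, fun v => ?_⟩
          simp only [ne_eq, hc] at h2
          rw [h2 v]
          by_cases hvj : v = j
          · subst hvj; simp [ho]
          · have : v ≤ j ↔ v < j := by omega
            simp [this]
        · simp [hs'.reg_two, hs'.reg_three, h13, h1, h5, hc, ho, hi]
          refine ⟨by omega, fun v => ?_⟩
          by_cases hvj : v = j
          · subst hvj; simp [ho]
          · simp only [ne_eq, hc] at h2
            have : v ≤ j ↔ v < j := by omega
            simp [hvj, h2 v, this]
      · simp [hs'.reg_two, hs'.reg_three, h13, h1, h5, hc]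
        refine ⟨by omega, fun v => ?_⟩
        simpa [hc] using h2 v)

/-- Register `12` sweeps the matrix row by row and holds `j * n` at the start of row `j`. The
address `u * n + v` thus arises without multiplication, which is not `slow`. -/
theorem eval_mark {n : ℕ} {s : State} (hs : Std n s) :
    ∀ v < n, (Cmd.mark.eval s).mem 4 v ≠ 0 ↔
      IsMarked n (fun u v => s.mem 5 (u * n + v) ≠ 0) (s.mem 3) v := by
  have hclear := Cmd.eval_loop_induct (n := n) (i := 10) (p := Cmd.store 4 10 3) (s := s) rfl hs
    (fun j s' => ∀ v < j, s'.mem 4 v = 0) (by simp)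
    (by
      intro j s' hj hs' hi ha h v hv
      by_cases hvj : v = j
      · subst hvj; simp [hi, hs'.reg_three]
      · have := h v (by omega)
        simp [hi, hvj, this])
  set s₁ := (Cmd.loop 10 (Cmd.store 4 10 3)).eval s with hs₁
  have hstd₁ : Std n s₁ := hs.eval rfl
  have ha₁ : Agree _ s s₁ := Cmd.agree_eval _ s
  have hstd₂ : Std n ((Cmd.const 12 0).eval s₁) := hstd₁.eval rfl
  have h := Cmd.eval_loop_induct (n := n) (i := 10) (p := Cmd.markRow)
    (s := (Cmd.const 12 0).eval s₁) rfl hstd₂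
    (fun j s' => s'.reg 12 = j * n ∧ ∀ v < n, s'.mem 4 v ≠ 0 ↔
      ∃ u < j, s.mem 3 u = 1 ∧ s.mem 5 (u * n + v) ≠ 0)
    (by simpa using hclear)
    (by
      intro j s' hj hs' hi ha ⟨h1, h2⟩
      have h5 : s'.mem 5 = s.mem 5 := by
        simpa [ha₁.mem 5 (by decide)] using ha.mem 5 (by decide)
      have h3 : s'.mem 3 = s.mem 3 := by
        simpa [ha₁.mem 3 (by decide)] using ha.mem 3 (by decide)
      obtain ⟨h6, h7⟩ := eval_markRow hs'
      refine ⟨by simp [h6, h1]; ring, fun v hv => ?_⟩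
      have h8 : ((Instr.op .add 10 10 2).apply (Cmd.markRow.eval s')).mem 4 v =
        (Cmd.markRow.eval s').mem 4 v := rfl
      rw [h8, h7 v, h2 v hv, h5, h3, hi, h1, Nat.exists_lt_succ_right]
      simp [hv])
  exact h.2

end RealRAM

/-! ### Counting, the pruning limit, and the selection of the branching vertex -/

namespace RealRAM

theorem eval_count {n : ℕ} {s : State} (hs : Std n s) :
    (Cmd.count.eval s).reg 15 = numChosen n (s.mem 3) ∧
    (Cmd.count.eval s).reg 16 = (below n fun v => 1 < s.mem 3 v ∧ s.mem 4 v = 0).card := by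
  set s₁ := (Cmd.seq (.const 15 0) (.const 16 0)).eval s with hs₁
  have hstd : Std n s₁ := hs.eval rfl
  refine Cmd.eval_loop_induct (n := n) (i := 10) (s := s₁) rfl hstd
    (fun j s' => s'.reg 15 = (below j fun v => s.mem 3 v = 1).card ∧
      s'.reg 16 = (below j fun v => 1 < s.mem 3 v ∧ s.mem 4 v = 0).card)
    (by simp [hs₁]) ?_
  intro j s' hj hs' hi ha ⟨h1, h2⟩
  have h3 : s'.mem 3 = s.mem 3 := by simpa [hs₁] using ha.mem 3 (by decide)
  have h4 : s'.mem 4 = s.mem 4 := by simpa [hs₁] using ha.mem 4 (by decide)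
  rw [card_below_succ, card_below_succ]
  have e2 := hs'.reg_two
  have e3 := hs'.reg_three
  by_cases hc : s.mem 3 j = 1
  · simp [e2, e3, h1, h2, h3, h4, hi, hc]
  · by_cases hc' : 1 < s.mem 3 j
    · by_cases hm : s.mem 4 j = 0
      · simp [e2, e3, h1, h2, h3, h4, hi, hc, hc', hm]
      · simp [e2, e3, h1, h2, h3, h4, hi, hc, hc', hm]
    · simp [e2, e3, h1, h2, h3, h4, hi, hc, hc']

/-- Since multiplication is not `slow`, the limit is formed by counting. A loop counts no further
than `n`, hence `D ≤ n` here and `k ≤ n` in `eval_limit`. -/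
theorem eval_addDegree {n : ℕ} {s : State} (hs : Std n s) (hD : s.reg 6 ≤ n) :
    (Cmd.addDegree.eval s).reg 17 = s.reg 17 + s.reg 6 := by
  have h := Cmd.eval_loop_induct (n := n) (i := 11) (s := s)
    (p := .ite (.lt 11 6) (.incr 17) .skip) rfl hs
    (fun j s' => s'.reg 17 = s.reg 17 + min j (s.reg 6)) (by simp)
    (by
      intro j s' hj hs' hi ha h1
      have h6 : s'.reg 6 = s.reg 6 := ha.reg 6 (by decide)
      by_cases hc : j < s.reg 6
      · simp [hi, h6, hc, h1, hs'.reg_two]; omega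
      · simp [hi, h6, hc, h1]; omega)
  rwa [min_eq_right hD] at h

theorem eval_limit {n : ℕ} {s : State} (hs : Std n s) (hD : s.reg 6 ≤ n) (hk : s.reg 1 ≤ n) :
    (Cmd.limit.eval s).reg 17 = s.reg 6 * (s.reg 1 - s.reg 15) := by
  set s₁ := (Cmd.seq (.minus 18 1 15) (.const 17 0)).eval s with hs₁
  have hstd : Std n s₁ := hs.eval rfl
  have h := Cmd.eval_loop_induct (n := n) (i := 10) (s := s₁)
    (p := .ite (.lt 10 18) .addDegree .skip) rfl hstd
    (fun j s' => s'.reg 17 = s.reg 6 * min j (s.reg 1 - s.reg 15)) (by simp [hs₁])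
    (by
      intro j s' hj hs' hi ha h1
      have h6 : s'.reg 6 = s.reg 6 := by simpa [hs₁] using ha.reg 6 (by decide)
      have h18 : s'.reg 18 = s.reg 1 - s.reg 15 := by simpa [hs₁] using ha.reg 18 (by decide)
      have h2 := eval_addDegree hs' (h6 ▸ hD)
      by_cases hc : j < s.reg 1 - s.reg 15
      · simp [hi, h18, hc, h2, h1, h6]
        rw [min_eq_left hc.le, mul_add, mul_one]
      · simp [hi, h18, hc, h1]
        left; omega)
  rwa [min_eq_right (by omega)] at h

/-- A later hit overwrites an earlier one; any pending vertex will do. -/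
theorem eval_findPending {n : ℕ} {s : State} (hs : Std n s) :
    ((Cmd.findPending.eval s).reg 19 = 0 ∧ ∀ v < n, s.mem 3 v = 0 → s.mem 4 v = 0) ∨
    ((Cmd.findPending.eval s).reg 19 ≠ 0 ∧ (Cmd.findPending.eval s).reg 20 < n ∧
      s.mem 3 ((Cmd.findPending.eval s).reg 20) = 0 ∧
      s.mem 4 ((Cmd.findPending.eval s).reg 20) ≠ 0) := by
  have hstd : Std n ((Cmd.const 19 0).eval s) := hs.eval rfl
  refine Cmd.eval_loop_induct (n := n) (i := 10) (s := (Cmd.const 19 0).eval s) rfl hstd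
    (fun j s' => (s'.reg 19 = 0 ∧ ∀ v < j, s.mem 3 v = 0 → s.mem 4 v = 0) ∨
      (s'.reg 19 ≠ 0 ∧ s'.reg 20 < j ∧ s.mem 3 (s'.reg 20) = 0 ∧ s.mem 4 (s'.reg 20) ≠ 0))
    (by simp) ?_
  intro j s' hj hs' hi ha h
  have h3 : s'.mem 3 = s.mem 3 := by simpa using ha.mem 3 (by decide)
  have h4 : s'.mem 4 = s.mem 4 := by simpa using ha.mem 4 (by decide)
  have e3 := hs'.reg_three
  by_cases hc : s.mem 3 j = 0 ∧ s.mem 4 j ≠ 0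
  · right
    simp [e3, h3, h4, hi, hc.1, hc.2]
  · have hcc : s.mem 3 j = 0 → s.mem 4 j = 0 := by tauto
    rcases h with ⟨h1, h2⟩ | ⟨h1, h2, h5⟩
    · left
      have h2' : ∀ v < j + 1, s.mem 3 v = 0 → s.mem 4 v = 0 := by
        intro v hv
        rcases Nat.lt_succ_iff_lt_or_eq.1 hv with hv | rfl
        · exact h2 v hv
        · exact hcc
      refine ⟨?_, h2'⟩
      by_cases h0 : s.mem 3 j = 0
      · simp [e3, h3, h4, hi, h0, hcc h0, h1]
      · simp [e3, h3, h4, hi, h0, h1]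
    · right
      have h2' : s'.reg 20 < j + 1 := by omega
      by_cases h0 : s.mem 3 j = 0
      · simpa [e3, h3, h4, hi, h0, hcc h0, h1, h2'] using h5
      · simpa [e3, h3, h4, hi, h0, h1, h2'] using h5

/-- The sum that is computed for the vertex `v` when looking for the maximum residual weight. -/
noncomputable def rowSum (n : ℕ) (s : State) (v : ℕ) : ℝ :=
  ∑ u ∈ Finset.range n, if s.mem 3 u = 1 then 0 else s.rmem 0 (v * n + u)

theorem eval_rowResidual {n : ℕ} {s : State} (hs : Std n s) :
    (Cmd.rowResidual.eval s).reg 12 = s.reg 12 + n ∧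
    (Cmd.rowResidual.eval s).rreg 2 =
      ∑ u ∈ Finset.range n, if s.mem 3 u = 1 then 0 else s.rmem 0 (s.reg 12 + u) := by
  set s₁ := (Cmd.radd 2 0 0).eval s with hs₁
  have hstd : Std n s₁ := hs.eval rfl
  refine Cmd.eval_loop_induct (n := n) (i := 11) (s := s₁) rfl hstd
    (fun j s' => s'.reg 12 = s.reg 12 + j ∧ s'.rreg 2 =
      ∑ u ∈ Finset.range j, if s.mem 3 u = 1 then 0 else s.rmem 0 (s.reg 12 + u))
    (by simp [hs₁, hs.rreg_zero]) ?_
  intro j s' hj hs' hi ha ⟨h1, h2⟩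
  have h3 : s'.mem 3 = s.mem 3 := by simpa [hs₁] using ha.mem 3 (by decide)
  have h4 : s'.rmem = s.rmem := by simpa [hs₁] using ha.rmem (by decide)
  have e2 := hs'.reg_two
  have e3 := hs'.reg_three
  rw [Finset.sum_range_succ]
  by_cases hc : s.mem 3 j = 1
  · simp [e2, e3, h1, h2, h3, hi, hc]; omega
  · simp [e2, e3, h1, h2, h3, h4, hi, hc]; omega

/-- Replacing the record only on strict improvement yields the first maximum, which the exchange
argument needs. The flag in register `19` is not reset: it is `0` after an unsuccessful
`findPending`. -/
theorem eval_findTop {n : ℕ} {s : State} (hs : Std n s) (h19 : s.reg 19 = 0) :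
    ((Cmd.findTop.eval s).reg 19 = 0 ∧ ∀ v < n, s.mem 3 v ≠ 0) ∨
    ((Cmd.findTop.eval s).reg 19 ≠ 0 ∧ (Cmd.findTop.eval s).reg 20 < n ∧
      s.mem 3 ((Cmd.findTop.eval s).reg 20) = 0 ∧
      ∀ u < n, s.mem 3 u = 0 → rowSum n s u ≤ rowSum n s ((Cmd.findTop.eval s).reg 20) ∧
        (rowSum n s u = rowSum n s ((Cmd.findTop.eval s).reg 20) →
          (Cmd.findTop.eval s).reg 20 ≤ u)) := by
  set s₁ := (Cmd.const 12 0).eval s with hs₁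
  have hstd : Std n s₁ := hs.eval rfl
  have key := Cmd.eval_loop_induct (n := n) (i := 10) (s := s₁)
    (p := .seq .rowResidual (.seq (.load 13 3 10)
      (.ifPos 13 .skip (.ifPos 19 (.ite (.rlt 4 2) .recordTop .skip) .recordTop)))) rfl hstd
    (fun j s' => s'.reg 12 = j * n ∧ ((s'.reg 19 = 0 ∧ ∀ v < j, s.mem 3 v ≠ 0) ∨
      (s'.reg 19 ≠ 0 ∧ s'.reg 20 < j ∧ s.mem 3 (s'.reg 20) = 0 ∧
        s'.rreg 4 = rowSum n s (s'.reg 20) ∧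
        ∀ u < j, s.mem 3 u = 0 → rowSum n s u ≤ rowSum n s (s'.reg 20) ∧
        (rowSum n s u = rowSum n s (s'.reg 20) → s'.reg 20 ≤ u))))
    (by simp [hs₁, h19]) (by
      intro j s' hj hs' hi ha ⟨h1, h2⟩
      have h3 : s'.mem 3 = s.mem 3 := by simpa [hs₁] using ha.mem 3 (by decide)
      have h4 : s'.rmem = s.rmem := by simpa [hs₁] using ha.rmem (by decide)
      obtain ⟨h5, h6⟩ := eval_rowResidual hs'
      have hs'' : Std n (Cmd.rowResidual.eval s') := hs'.eval rfl
      have hag := Cmd.agree_eval .rowResidual s'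
      have e19 := hag.reg 19 (by decide)
      have e20 := hag.reg 20 (by decide)
      have e10 := hag.reg 10 (by decide)
      have er4 := hag.rreg 4 (by decide)
      have em3 := hag.mem 3 (by decide)
      rw [h3, h4, h1] at h6
      change _ = rowSum n s j at h6
      rw [h1] at h5
      rw [hi] at e10
      rw [h3] at em3
      rw [Cmd.eval_seq]
      generalize Cmd.rowResidual.eval s' = s₂ at *
      have e2 := hs''.reg_two
      have e3 := hs''.reg_three
      have er0 := hs''.rreg_zero
      have hjn : (j + 1) * n = j * n + n := by ring
      by_cases hc : s.mem 3 j = 0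
      · rcases h2 with ⟨h2, h7⟩ | ⟨h2, h7, h8, h9, h10⟩
        · rw [h2] at e19
          refine ⟨by simp [e3, e10, em3, hc, e19, Cmd.recordTop, h5, hjn], .inr ?_⟩
          simp [e3, e10, em3, hc, e19, Cmd.recordTop, er0, h6]
          intro u hu hu0
          rcases Nat.lt_succ_iff_lt_or_eq.1 (Nat.lt_succ_iff.2 hu) with hu | rfl
          · exact absurd hu0 (h7 u hu)
          · simp
        · have e19' : s₂.reg 19 ≠ 0 := by rwa [e19]
          by_cases hlt : rowSum n s (s'.reg 20) < rowSum n s j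
          · refine ⟨by simp [e3, e10, em3, hc, e19', Cmd.recordTop, h5, hjn, er4, h9, h6, hlt],
              .inr ?_⟩
            simp [e3, e10, em3, hc, e19', Cmd.recordTop, er0, h6, er4, h9, hlt]
            intro u hu hu0
            rcases Nat.lt_succ_iff_lt_or_eq.1 (Nat.lt_succ_iff.2 hu) with hu | rfl
            · have := (h10 u hu hu0).1
              exact ⟨by linarith, fun h => by linarith⟩
            · simp
          · refine ⟨by simp [e3, e10, em3, hc, e19', h5, hjn, er4, h9, h6, hlt], .inr ?_⟩
            simp [e3, e10, em3, hc, h6, er4, h9, hlt, e19, e20, h2, h8]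
            refine ⟨by omega, ?_⟩
            intro u hu hu0
            rcases Nat.lt_succ_iff_lt_or_eq.1 (Nat.lt_succ_iff.2 hu) with hu | rfl
            · exact h10 u hu hu0
            · exact ⟨not_lt.1 hlt, fun _ => by omega⟩
      · refine ⟨by simp [e3, e10, em3, hc, h5, hjn], ?_⟩
        simp [e3, e10, em3, hc, e19, e20, er4]
        rcases h2 with ⟨h2, h7⟩ | ⟨h2, h7, h8, h9, h10⟩
        · left
          refine ⟨h2, fun v hv => ?_⟩
          rcases Nat.lt_succ_iff_lt_or_eq.1 (Nat.lt_succ_iff.2 hv) with hv | rfl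
          · exact h7 v hv
          · exact hc
        · right
          refine ⟨h2, by omega, h8, h9, fun u hu hu0 => ?_⟩
          rcases Nat.lt_succ_iff_lt_or_eq.1 (Nat.lt_succ_iff.2 hu) with hu | rfl
          · exact h10 u hu hu0
          · exact absurd hu0 hc)
  rcases key.2 with h | ⟨h1, h2, h3, -, h4⟩
  · exact .inl h
  · exact .inr ⟨h1, h2, h3, h4⟩

end RealRAM

/-! ### The stack of colourings -/

namespace RealRAM

/-- The stack of the state `s` holds the colourings in `L`. -/
structure HasStack (n : ℕ) (s : State) (L : List (ℕ → ℕ)) : Prop where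
  ptr : s.reg 5 = L.length * n
  cell : ∀ (i : ℕ) (hi : i < L.length), ∀ v < n, s.mem 2 (i * n + v) = L[i] v

theorem HasStack.congr {n : ℕ} {s s' : State} {L : List (ℕ → ℕ)} (h : HasStack n s L)
    (h5 : s'.reg 5 = s.reg 5) (h2 : s'.mem 2 = s.mem 2) : HasStack n s' L :=
  ⟨h5.trans h.ptr, fun i hi v hv => h2 ▸ h.cell i hi v hv⟩

theorem HasStack.push {n : ℕ} {s : State} {L : List (ℕ → ℕ)} {col : ℕ → ℕ} (h : HasStack n s L)
    (hs : Std n s) (hc : ∀ v < n, s.mem 3 v = col v) :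
    HasStack n (Cmd.push.eval s) (L ++ [col]) := by
  obtain ⟨h1, h2⟩ := eval_push hs
  refine ⟨by rw [h1, h.ptr]; simp; ring, fun i hi v hv => ?_⟩
  rw [h2, h.ptr]
  rw [List.length_append, List.length_singleton] at hi
  rcases Nat.lt_succ_iff_lt_or_eq.1 hi with hi' | rfl
  · rw [if_neg, h.cell i hi' v hv, List.getElem_append_left hi']
    have : (i + 1) * n ≤ L.length * n := Nat.mul_le_mul_right n hi'
    have : (i + 1) * n = i * n + n := by ring
    omega
  · rw [if_pos (by omega), Nat.add_sub_cancel_left, hc v hv]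
    simp

theorem HasStack.pop {n : ℕ} {s : State} {L : List (ℕ → ℕ)} {col : ℕ → ℕ}
    (h : HasStack n s (L ++ [col])) (hs : Std n s) :
    HasStack n (Cmd.pop.eval s) L ∧ ∀ v < n, (Cmd.pop.eval s).mem 3 v = col v := by
  obtain ⟨h1, h2⟩ := eval_pop hs
  have hptr : s.reg 5 - n = L.length * n := by
    rw [h.ptr, List.length_append, List.length_singleton, add_mul, one_mul, Nat.add_sub_cancel]
  have hmem := (Cmd.agree_eval .pop s).mem 2 (by decide)
  refine ⟨⟨by rw [h1, hptr], fun i hi v hv => ?_⟩, fun v hv => ?_⟩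
  · rw [hmem, h.cell i (by simp; omega) v hv, List.getElem_append_left hi]
  · rw [h2 v hv, hptr, h.cell L.length (by simp) v hv]
    simp

/-- The current colouring is modified in place, pushed twice, and restored by writing `0` into one
cell. This is correct because the vertex was undecided. -/
theorem HasStack.split {n : ℕ} {s : State} {L : List (ℕ → ℕ)} {col : ℕ → ℕ} (h : HasStack n s L)
    (hs : Std n s) (hc : ∀ v < n, s.mem 3 v = col v) (h0 : col (s.reg 20) = 0) :
    HasStack n (Cmd.split.eval s) (L ++ splitOn col (s.reg 20)) ∧
      ∀ v < n, (Cmd.split.eval s).mem 3 v = col v := by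
  set v := s.reg 20 with hv
  set s₁ := (Cmd.store 3 20 2).eval s with hs₁
  have hstd₁ : Std n s₁ := hs.eval rfl
  have hc₁ : ∀ u < n, s₁.mem 3 u = recolour col v 1 u := by
    intro u hu
    by_cases huv : u = v
    · subst huv; simp [hs₁, ← hv, hs.reg_two]
    · simp [hs₁, ← hv, huv, hc u hu]
  have hst₁ : HasStack n s₁ L := h.congr rfl (by simp [hs₁])
  have hst₂ := hst₁.push hstd₁ hc₁
  have ha₂ := Cmd.agree_eval .push s₁
  have hstd₂ : Std n (Cmd.push.eval s₁) := hstd₁.eval rfl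
  have hm₂ := ha₂.mem 3 (by decide)
  have hr₂ := ha₂.reg 20 (by decide)
  set s₂ := Cmd.push.eval s₁ with hs₂
  set s₃ := (Cmd.seq (.const 13 2) (.store 3 20 13)).eval s₂ with hs₃
  have hstd₃ : Std n s₃ := hstd₂.eval rfl
  have hr₂' : s₂.reg 20 = v := hr₂
  have hc₃ : ∀ u < n, s₃.mem 3 u = recolour col v 2 u := by
    intro u hu
    by_cases huv : u = v
    · subst huv; simp [hs₃, hr₂']
    · have := hc₁ u hu
      simp [huv] at this
      simp [hs₃, hr₂', huv, hm₂, this]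
  have hst₃ : HasStack n s₃ (L ++ [recolour col v 1]) := hst₂.congr (by simp [hs₃]) (by simp [hs₃])
  have hst₄ := hst₃.push hstd₃ hc₃
  have ha₄ := Cmd.agree_eval .push s₃
  have hstd₄ : Std n (Cmd.push.eval s₃) := hstd₃.eval rfl
  have hm₄ := ha₄.mem 3 (by decide)
  have hr₄ := ha₄.reg 20 (by decide)
  have heq : Cmd.split.eval s = (Cmd.store 3 20 3).eval (Cmd.push.eval s₃) := rfl
  have hr₄' : (Cmd.push.eval s₃).reg 20 = v := by rw [hr₄]; simp [hs₃, hr₂']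
  generalize Cmd.push.eval s₃ = s₄ at *
  rw [heq]
  refine ⟨?_, fun u hu => ?_⟩
  · rw [List.append_assoc] at hst₄
    exact hst₄.congr (by simp) (by simp)
  · by_cases huv : u = v
    · subst huv; simp [hr₄', hstd₄.reg_three, h0]
    · have := hc₃ u hu
      simp [huv] at this
      simp [hr₄', huv, hm₄, this]

theorem HasStack.pushPair {n : ℕ} {s : State} {L : List (ℕ → ℕ)} {col : ℕ → ℕ}
    (h : HasStack n s L) (hs : Std n s) (hc : ∀ v < n, s.mem 3 v = col v)
    (h0 : col (s.reg 10) = 0) (h0' : col (s.reg 11) = 0) :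
    HasStack n (Cmd.pushPair.eval s)
      (L ++ [recolour (recolour col (s.reg 10) 1) (s.reg 11) 1]) ∧
      ∀ v < n, (Cmd.pushPair.eval s).mem 3 v = col v := by
  set i := s.reg 10 with hi
  set j := s.reg 11 with hj
  set s₁ := (Cmd.seq (.store 3 10 2) (.store 3 11 2)).eval s with hs₁
  have hstd₁ : Std n s₁ := hs.eval rfl
  have hc₁ : ∀ u < n, s₁.mem 3 u = recolour (recolour col i 1) j 1 u := by
    intro u hu
    by_cases huj : u = j
    · simp [hs₁, ← hi, ← hj, huj, hs.reg_two]
    · by_cases hui : u = i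
      · have hij : i ≠ j := hui ▸ huj
        simp [hs₁, ← hi, ← hj, hui, hij, hs.reg_two]
      · simp [hs₁, ← hi, ← hj, hui, huj, hc u hu]
  have hst₁ : HasStack n s₁ L := h.congr (by simp [hs₁]) (by simp [hs₁])
  have hst₂ := hst₁.push hstd₁ hc₁
  have ha₂ := Cmd.agree_eval .push s₁
  have hstd₂ : Std n (Cmd.push.eval s₁) := hstd₁.eval rfl
  have hm₂ := ha₂.mem 3 (by decide)
  have hi₂ : (Cmd.push.eval s₁).reg 10 = i := ha₂.reg 10 (by decide)
  have hj₂ : (Cmd.push.eval s₁).reg 11 = j := ha₂.reg 11 (by decide)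
  have heq : Cmd.pushPair.eval s =
      (Cmd.seq (.store 3 10 3) (.store 3 11 3)).eval (Cmd.push.eval s₁) := rfl
  generalize Cmd.push.eval s₁ = s₂ at *
  rw [heq]
  refine ⟨hst₂.congr (by simp) (by simp), fun u hu => ?_⟩
  by_cases huj : u = j
  · simp [hi₂, hj₂, huj, hstd₂.reg_three, h0']
  · by_cases hui : u = i
    · have hij : i ≠ j := hui ▸ huj
      simp [hi₂, hj₂, hui, hij, hstd₂.reg_three, h0]
    · have := hc₁ u hu
      simp [huj, hui] at this
      simp [hi₂, hj₂, hui, huj, hm₂, this]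

theorem eval_rowPointer {n : ℕ} {s : State} (hs : Std n s) (hv : s.reg 20 ≤ n) :
    (Cmd.rowPointer.eval s).reg 7 = s.reg 20 * n := by
  have hstd : Std n ((Cmd.const 7 0).eval s) := hs.eval rfl
  have h := Cmd.eval_loop_induct (n := n) (i := 10) (s := (Cmd.const 7 0).eval s)
    (p := .ite (.lt 10 20) (.addWidth 7) .skip) rfl hstd
    (fun j s' => s'.reg 7 = min j (s.reg 20) * n) (by simp)
    (by
      intro j s' hj hs' hi ha h1
      have h20 : s'.reg 20 = s.reg 20 := by simpa using ha.reg 20 (by decide)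
      by_cases hc : j < s.reg 20
      · have h1' : min j (s.reg 20) = j := by omega
        have h2 : min (j + 1) (s.reg 20) = j + 1 := by omega
        rw [h1'] at h1
        rw [h2]
        simp [hi, h20, hc, h1, hs'.reg_zero]; ring
      · have h1' : min j (s.reg 20) = s.reg 20 := by omega
        have h2 : min (j + 1) (s.reg 20) = s.reg 20 := by omega
        rw [h1'] at h1
        rw [h2]
        simp [hi, h20, hc, h1])
  rwa [min_eq_right hv] at h

theorem eval_findCandidates {n : ℕ} {s : State} (hs : Std n s) (hv : s.reg 20 < n) :
    ∀ u < n, (Cmd.findCandidates.eval s).mem 6 u ≠ 0 ↔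
      s.mem 5 (s.reg 20 * n + u) ≠ 0 ∧ s.mem 3 u = 0 := by
  have hp := eval_rowPointer hs hv.le
  have hstd : Std n (Cmd.rowPointer.eval s) := hs.eval rfl
  have ha₁ := Cmd.agree_eval .rowPointer s
  have hm5 := ha₁.mem 5 (by decide)
  have hm3 := ha₁.mem 3 (by decide)
  refine (Cmd.eval_loop_induct (n := n) (i := 10) (s := Cmd.rowPointer.eval s) rfl hstd
    (fun j s' => s'.reg 7 = s.reg 20 * n + j ∧ ∀ u < j, s'.mem 6 u ≠ 0 ↔
      s.mem 5 (s.reg 20 * n + u) ≠ 0 ∧ s.mem 3 u = 0) (by simp [hp]) ?_).2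
  intro j s' hj hs' hi ha ⟨h1, h2⟩
  have h5 : s'.mem 5 = s.mem 5 := by simpa [hm5] using ha.mem 5 (by decide)
  have h3 : s'.mem 3 = s.mem 3 := by simpa [hm3] using ha.mem 3 (by decide)
  have e2 := hs'.reg_two
  have e3 := hs'.reg_three
  by_cases ho : s.mem 5 (s.reg 20 * n + j) = 0
  · refine ⟨by simp [e2, e3, h1, h5, h3, hi, ho]; omega, fun u hu => ?_⟩
    by_cases huj : u = j
    · subst huj; simp [e2, e3, h1, h5, h3, hi, ho]
    · simpa [e2, e3, h1, h5, h3, hi, ho, huj] using h2 u (by omega)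
  · by_cases hc : s.mem 3 j = 0
    · refine ⟨by simp [e2, e3, h1, h5, h3, hi, ho, hc]; omega, fun u hu => ?_⟩
      by_cases huj : u = j
      · subst huj; simp [e2, e3, h1, h5, h3, hi, ho, hc]
      · simpa [e2, e3, h1, h5, h3, hi, ho, hc, huj] using h2 u (by omega)
    · refine ⟨by simp [e2, e3, h1, h5, h3, hi, ho, hc]; omega, fun u hu => ?_⟩
      by_cases huj : u = j
      · subst huj; simp [e2, e3, h1, h5, h3, hi, ho, hc]
      · simpa [e2, e3, h1, h5, h3, hi, ho, hc, huj] using h2 u (by omega)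

-- `p` stands for the row `O v`. The pushes follow the order of enumeration in `choosePairs`, so no
-- permutation of lists has to be handled.
open Classical in
theorem HasStack.pairsRow {n : ℕ} {s : State} {L : List (ℕ → ℕ)} {col : ℕ → ℕ} {p : ℕ → Prop}
    (h : HasStack n s L) (hs : Std n s) (hc : ∀ v < n, s.mem 3 v = col v)
    (hp : ∀ v < n, s.mem 6 v ≠ 0 ↔ p v ∧ col v = 0) (hi : s.reg 10 < n) :
    HasStack n (Cmd.pairsRow.eval s) (L ++ (List.range n).flatMap fun j =>
      if s.reg 10 < j ∧ (p (s.reg 10) ∧ col (s.reg 10) = 0) ∧ (p j ∧ col j = 0) then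
        [recolour (recolour col (s.reg 10) 1) j 1] else []) ∧
      ∀ v < n, (Cmd.pairsRow.eval s).mem 3 v = col v := by
  set i := s.reg 10 with hi'
  set s₁ := (Cmd.load 13 6 10).eval s with hs₁
  have hstd : Std n s₁ := hs.eval rfl
  refine Cmd.eval_loop_induct (n := n) (i := 11) (s := s₁) rfl hstd
    (fun m s' => HasStack n s' (L ++ (List.range m).flatMap fun j =>
      if i < j ∧ (p i ∧ col i = 0) ∧ (p j ∧ col j = 0) then
        [recolour (recolour col i 1) j 1] else []) ∧ ∀ v < n, s'.mem 3 v = col v)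
    ⟨by simpa using h.congr (by simp [hs₁]) (by simp [hs₁]), by simpa [hs₁] using hc⟩ ?_
  intro j s' hj hs' hij ha ⟨h1, h2⟩
  have h6 : s'.mem 6 = s.mem 6 := by simpa [hs₁] using ha.mem 6 (by decide)
  have h10 : s'.reg 10 = i := by simpa [hs₁] using ha.reg 10 (by decide)
  have h13 : s'.reg 13 = s.mem 6 i := by simpa [hs₁] using ha.reg 13 (by decide)
  have e3 := hs'.reg_three
  rw [List.range_succ, List.flatMap_append, ← List.append_assoc]
  rw [List.flatMap_singleton]
  set L' := L ++ (List.range j).flatMap fun j =>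
      if i < j ∧ (p i ∧ col i = 0) ∧ (p j ∧ col j = 0) then
        [recolour (recolour col i 1) j 1] else [] with hL'
  have e5 : ((Cmd.load 14 6 11).eval s').reg 5 = s'.reg 5 := by simp
  have hpi := hp i hi
  have hpj := hp j hj
  by_cases hcond : i < j ∧ (p i ∧ col i = 0) ∧ (p j ∧ col j = 0)
  · rw [if_pos hcond]
    have hi6 := hpi.2 hcond.2.1
    have hj6 := hpj.2 hcond.2.2
    set s₂ := (Cmd.load 14 6 11).eval s' with hs₂
    have hstd₂ : Std n s₂ := hs'.eval rfl
    have h10' : s₂.reg 10 = i := by simp [hs₂, h10]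
    have h11' : s₂.reg 11 = j := by simp [hs₂, hij]
    have hpush := HasStack.pushPair (s := s₂) (L := L') (col := col) (h1.congr e5 (by simp [hs₂]))
      hstd₂ (by simpa [hs₂] using h2) (by rw [h10']; exact hcond.2.1.2)
      (by rw [h11']; exact hcond.2.2.2)
    rw [h10', h11'] at hpush
    have heq : (Cmd.seq (.load 14 6 11) (.ite (.lt 10 11)
        (.ifPos 13 (.ifPos 14 .pushPair .skip) .skip) .skip)).eval s' = Cmd.pushPair.eval s₂ := by
      have h13' : s₂.reg 13 ≠ 0 := by simpa [hs₂, h13] using hi6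
      have h14' : s₂.reg 14 ≠ 0 := by simpa [hs₂, hij, h6] using hj6
      rw [Cmd.eval_seq, ← hs₂, Cmd.eval_ite_lt, h10', h11', if_pos hcond.1,
        Cmd.eval_ifPos hstd₂.reg_three, if_neg h13', Cmd.eval_ifPos hstd₂.reg_three, if_neg h14']
    rw [heq]
    exact ⟨hpush.1.congr (by simp) (by simp), by simpa using hpush.2⟩
  · rw [if_neg hcond, List.append_nil]
    have heq : (Cmd.seq (.load 14 6 11) (.ite (.lt 10 11)
        (.ifPos 13 (.ifPos 14 .pushPair .skip) .skip) .skip)).eval s' =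
        Cmd.skip.eval ((Cmd.load 14 6 11).eval s') := by
      by_cases hlt : i < j
      · by_cases hi6 : s.mem 6 i = 0
        · simp [e3, h10, hij, hlt, h13, hi6]
        · have hj6 : s.mem 6 j = 0 := by
            by_contra hne
            exact hcond ⟨hlt, hpi.1 hi6, hpj.1 hne⟩
          simp [e3, h10, hij, hlt, h13, hi6, h6, hj6]
      · simp [h10, hij, hlt]
    rw [heq]
    exact ⟨h1.congr (by simp) (by simp), by simpa using h2⟩

theorem HasStack.pairs {n : ℕ} {s : State} {L : List (ℕ → ℕ)} {col : ℕ → ℕ} {O : ℕ → ℕ → Prop}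
    {v : ℕ} (h : HasStack n s L) (hs : Std n s) (hc : ∀ v < n, s.mem 3 v = col v)
    (hp : ∀ u < n, s.mem 6 u ≠ 0 ↔ O v u ∧ col u = 0) :
    HasStack n ((Cmd.loop 10 .pairsRow).eval s) (L ++ choosePairs n O col v) := by
  classical
  refine (Cmd.eval_loop_induct (n := n) (i := 10) (s := s) rfl hs
    (fun m s' => HasStack n s' (L ++ (List.range m).flatMap fun i => (List.range n).flatMap fun j =>
      if i < j ∧ (O v i ∧ col i = 0) ∧ (O v j ∧ col j = 0) then
        [recolour (recolour col i 1) j 1] else []) ∧ ∀ v < n, s'.mem 3 v = col v)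
    ⟨by simpa using h.congr (by simp) (by simp), by simpa using hc⟩ ?_).1
  intro i s' hi hs' hij ha ⟨h1, h2⟩
  have h6 : s'.mem 6 = s.mem 6 := ha.mem 6 (by decide)
  have := h1.pairsRow hs' h2 (p := O v) (by simpa [h6] using hp) (by omega)
  rw [hij] at this
  rw [List.range_succ, List.flatMap_append, ← List.append_assoc, List.flatMap_singleton]
  exact ⟨this.1.congr (by simp) (by simp), by simpa using this.2⟩

end RealRAM

/-! ### One passage through the main loop -/

namespace RealRAM

theorem below_congr {n : ℕ} {p q : ℕ → Prop} (h : ∀ v < n, p v ↔ q v) : below n p = below n q := by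
  ext v
  simp only [mem_below]
  exact and_congr_right fun hv => h v hv

/-- The state holds the numbers `n` and `k`, a bound `D` for the out-degrees, the weights `W` and
the orientation `O`. -/
structure HoldsData (n k D : ℕ) (W : ℕ → ℕ → ℝ) (O : ℕ → ℕ → Prop) (s : State) : Prop where
  std : Std n s
  reg_one : s.reg 1 = k
  reg_six : s.reg 6 = D
  weight : ∀ u < n, ∀ v < n, s.rmem 0 (u * n + v) = W u v
  arc : ∀ u < n, ∀ v < n, s.mem 5 (u * n + v) ≠ 0 ↔ O u v

variable {n k D : ℕ} {W : ℕ → ℕ → ℝ} {O : ℕ → ℕ → Prop} {s : State} {L : List (ℕ → ℕ)}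
  {col : ℕ → ℕ}

/-- Admissible commands contain no `rstore`, so the weights survive; only registers `1` and `6` and
array `5` need checking. -/
theorem HoldsData.eval (h : HoldsData n k D W O s) {c : Cmd} (hc : c.ok) (h1 : 1 ∉ c.regs)
    (h6 : 6 ∉ c.regs) (h5 : 5 ∉ c.arrays) : HoldsData n k D W O (c.eval s) := by
  have ha := c.agree_eval s
  refine ⟨h.std.eval hc, (ha.reg 1 h1).trans h.reg_one, (ha.reg 6 h6).trans h.reg_six, ?_, ?_⟩
  · rw [ha.rmem (Cmd.slow_of_ok hc)]
    exact h.weight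
  · rw [ha.mem 5 h5]
    exact h.arc

theorem HoldsData.rowSum_eq (h : HoldsData n k D W O s) (hc : ∀ v < n, s.mem 3 v = col v) {v : ℕ}
    (hv : v < n) : rowSum n s v = residualWeight n W (below n fun x => col x = 1) v := by
  refine Finset.sum_congr rfl fun u hu => ?_
  rw [Finset.mem_range] at hu
  rw [hc u hu, h.weight v hv u hu]
  simp [hu]

/-- The children of the current colouring are pushed on the stack. -/
theorem HoldsData.expand (h : HoldsData n k D W O s) (hL : HasStack n s L)
    (hc : ∀ v < n, s.mem 3 v = col v) (hm : ∀ v < n, s.mem 4 v ≠ 0 ↔ IsMarked n O col v) :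
    ∃ L', IsExpansion n W O col L' ∧ HasStack n (Cmd.expand.eval s) (L ++ L') := by
  have ha₁ := Cmd.agree_eval .findPending s
  have h₁ : HoldsData n k D W O (Cmd.findPending.eval s) :=
    h.eval rfl (by decide) (by decide) (by decide)
  have hL₁ : HasStack n (Cmd.findPending.eval s) L :=
    hL.congr (ha₁.reg 5 (by decide)) (ha₁.mem 2 (by decide))
  have hm3 := ha₁.mem 3 (by decide)
  have hspec := eval_findPending h.std
  rw [Cmd.expand, Cmd.eval_seq]
  -- From here on the state is opaque, known only by its specification and the frame conditions. The
  -- same device recurs after every subroutine.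
  generalize Cmd.findPending.eval s = s₁ at *
  have hc₁ : ∀ v < n, s₁.mem 3 v = col v := by rwa [hm3]
  rw [Cmd.eval_ifPos h₁.std.reg_three]
  rcases hspec with ⟨h19, hnone⟩ | ⟨h19, hv, h0, hmark⟩
  · rw [if_pos h19]
    have hno : ∀ u < n, col u = 0 → ¬ IsMarked n O col u := by
      intro u hu hu0 hmu
      rw [← hc u hu] at hu0
      exact (hm u hu).2 hmu (hnone u hu hu0)
    have ha₂ := Cmd.agree_eval .findTop s₁
    have h₂ : HoldsData n k D W O (Cmd.findTop.eval s₁) :=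
      h₁.eval rfl (by decide) (by decide) (by decide)
    have hL₂ : HasStack n (Cmd.findTop.eval s₁) L :=
      hL₁.congr (ha₂.reg 5 (by decide)) (ha₂.mem 2 (by decide))
    have hm3₂ := ha₂.mem 3 (by decide)
    have hspec₂ := eval_findTop h₁.std h19
    rw [Cmd.eval_seq]
    generalize Cmd.findTop.eval s₁ = s₂ at *
    have hc₂ : ∀ v < n, s₂.mem 3 v = col v := by rwa [hm3₂]
    rw [Cmd.eval_ifPos h₂.std.reg_three]
    rcases hspec₂ with ⟨h19', hall⟩ | ⟨h19', hv, h0, hmax⟩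
    · rw [if_pos h19']
      refine ⟨[], .none fun u hu => hc₁ u hu ▸ hall u hu, ?_⟩
      simpa using hL₂.congr (s' := Cmd.skip.eval s₂) (by simp) (by simp)
    · rw [if_neg h19']
      set v := s₂.reg 20 with hvdef
      rw [hc₁ v hv] at h0
      have htop : IsFirstMax n W col v := by
        refine ⟨hv, h0, fun u hu hu0 => ?_, fun u hu hu0 hEq => ?_⟩
        · rw [← hc₁ u hu] at hu0
          have := (hmax u hu hu0).1
          rwa [h₁.rowSum_eq hc₁ hu, h₁.rowSum_eq hc₁ hv] at this
        · rw [← hc₁ u hu] at hu0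
          have := (hmax u hu hu0).2
          rw [h₁.rowSum_eq hc₁ hu, h₁.rowSum_eq hc₁ hv] at this
          exact this hEq
      refine ⟨_, .top v htop hno, ?_⟩
      obtain ⟨hL₃, hc₃⟩ := hL₂.split h₂.std hc₂ h0
      have h₃ : HoldsData n k D W O (Cmd.split.eval s₂) :=
        h₂.eval rfl (by decide) (by decide) (by decide)
      have h20 := (Cmd.agree_eval .split s₂).reg 20 (by decide)
      rw [Cmd.eval_seq, Cmd.eval_seq, ← List.append_assoc]
      rw [← hvdef] at hL₃ h20
      generalize Cmd.split.eval s₂ = s₃ at *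
      have hcand := eval_findCandidates h₃.std (h20 ▸ hv)
      have ha₄ := Cmd.agree_eval .findCandidates s₃
      have hL₄ : HasStack n (Cmd.findCandidates.eval s₃) (L ++ splitOn col v) :=
        hL₃.congr (ha₄.reg 5 (by decide)) (ha₄.mem 2 (by decide))
      have hm3₄ := ha₄.mem 3 (by decide)
      refine hL₄.pairs (h₃.std.eval rfl) (by rwa [hm3₄]) fun u hu => ?_
      rw [hcand u hu, h20, h₃.arc v hv u hu, hc₃ u hu]
  · rw [if_neg h19]
    rw [hc _ hv] at h0
    exact ⟨_, .pending _ hv h0 ((hm _ hv).1 hmark), (hL₁.split h₁.std hc₁ h0).1⟩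

theorem eval_rowCover (hs : Std n s) :
    (Cmd.rowCover.eval s).reg 12 = s.reg 12 + n ∧
    (Cmd.rowCover.eval s).rreg 2 = s.rreg 2 + ∑ v ∈ Finset.range n,
      if s.mem 3 (s.reg 10) = 1 ∨ s.mem 3 v = 1 then s.rmem 0 (s.reg 12 + v) else 0 := by
  set s₁ := (Cmd.load 13 3 10).eval s with hs₁
  have hstd : Std n s₁ := hs.eval rfl
  refine Cmd.eval_loop_induct (n := n) (i := 11) (s := s₁) rfl hstd
    (fun j s' => s'.reg 12 = s.reg 12 + j ∧ s'.rreg 2 = s.rreg 2 + ∑ v ∈ Finset.range j,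
      if s.mem 3 (s.reg 10) = 1 ∨ s.mem 3 v = 1 then s.rmem 0 (s.reg 12 + v) else 0)
    (by simp [hs₁]) ?_
  intro j s' hj hs' hi ha ⟨h1, h2⟩
  have h3 : s'.mem 3 = s.mem 3 := by simpa [hs₁] using ha.mem 3 (by decide)
  have h4 : s'.rmem = s.rmem := by simpa [hs₁] using ha.rmem (by decide)
  have h13 : s'.reg 13 = s.mem 3 (s.reg 10) := by simpa [hs₁] using ha.reg 13 (by decide)
  have e2 := hs'.reg_two
  have e3 := hs'.reg_three
  rw [Finset.sum_range_succ, ← add_assoc (s.rreg 2), ← h2]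
  by_cases hc : s.mem 3 (s.reg 10) = 1
  · simp [e2, e3, h1, h3, h4, hi, h13, hc]; omega
  · by_cases hc' : s.mem 3 j = 1
    · simp [e2, e3, h1, h3, h4, hi, h13, hc, hc']; omega
    · simp [e2, e3, h1, h3, hi, h13, hc, hc']; omega

theorem eval_saveBest (hs : Std n s) :
    (Cmd.saveBest.eval s).rreg 1 = s.rreg 2 ∧
    ∀ v < n, (Cmd.saveBest.eval s).mem 1 v ≠ 0 ↔ s.mem 3 v = 1 := by
  set s₁ := (Cmd.radd 1 2 0).eval s with hs₁
  have hstd : Std n s₁ := hs.eval rfl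
  refine Cmd.eval_loop_induct (n := n) (i := 10) (s := s₁) rfl hstd
    (fun j s' => s'.rreg 1 = s.rreg 2 ∧ ∀ v < j, s'.mem 1 v ≠ 0 ↔ s.mem 3 v = 1)
    (by simp [hs₁, hs.rreg_zero]) ?_
  intro j s' hj hs' hi ha ⟨h1, h2⟩
  have h3 : s'.mem 3 = s.mem 3 := by simpa [hs₁] using ha.mem 3 (by decide)
  have e2 := hs'.reg_two
  have e3 := hs'.reg_three
  by_cases hc : s.mem 3 j = 1
  · refine ⟨by simp [e2, e3, h1, h3, hi, hc], fun v hv => ?_⟩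
    by_cases hvj : v = j
    · subst hvj; simp [e2, e3, h3, hi, hc]
    · simpa [e2, e3, h3, hi, hc, hvj] using h2 v (by omega)
  · refine ⟨by simp [e2, e3, h1, h3, hi, hc], fun v hv => ?_⟩
    by_cases hvj : v = j
    · subst hvj; simp [e2, e3, h3, hi, hc]
    · simpa [e2, e3, h3, hi, hc, hvj] using h2 v (by omega)

/-- The best set found in `s'` is the best one of the set found in `s` and the set of vertices
chosen in `col`. -/
def UpdatesBest (n : ℕ) (W : ℕ → ℕ → ℝ) (col : ℕ → ℕ) (s s' : State) : Prop :=
  (matrixCover n W (below n fun v => col v = 1) < s.rreg 1 ∧ s'.rreg 1 = s.rreg 1 ∧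
    s'.mem 1 = s.mem 1) ∨
  (s.rreg 1 ≤ matrixCover n W (below n fun v => col v = 1) ∧
    s'.rreg 1 = matrixCover n W (below n fun v => col v = 1) ∧
    ∀ v < n, s'.mem 1 v ≠ 0 ↔ col v = 1)

/-- A tie overwrites the saved set. So a first complete colouring is saved even if its value is `0`,
the initial content of real register `1`. -/
theorem HoldsData.evaluate (h : HoldsData n k D W O s) (hc : ∀ v < n, s.mem 3 v = col v) :
    UpdatesBest n W col s (Cmd.evaluate.eval s) := by
  set s₁ := (Cmd.seq (.radd 2 0 0) (.const 12 0)).eval s with hs₁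
  have hstd : Std n s₁ := h.std.eval rfl
  have hsum := Cmd.eval_loop_induct (n := n) (i := 10) (p := .rowCover) (s := s₁) rfl hstd
    (fun j s' => s'.reg 12 = j * n ∧ s'.rreg 2 = ∑ u ∈ Finset.range j, ∑ v ∈ Finset.range n,
      if s.mem 3 u = 1 ∨ s.mem 3 v = 1 then s.rmem 0 (u * n + v) else 0)
    (by simp [hs₁, h.std.rreg_zero])
    (by
      intro j s' hj hs' hi ha ⟨h1, h2⟩
      have h3 : s'.mem 3 = s.mem 3 := by simpa [hs₁] using ha.mem 3 (by decide)
      have h4 : s'.rmem = s.rmem := by simpa [hs₁] using ha.rmem (by decide)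
      obtain ⟨h5, h6⟩ := eval_rowCover hs'
      refine ⟨by simp [h5, h1]; ring, ?_⟩
      rw [Finset.sum_range_succ, ← h2]
      simp [h6, h3, h4, hi, h1])
  have ha₂ := Cmd.agree_eval (.loop 10 .rowCover) s₁
  have hstd₂ : Std n ((Cmd.loop 10 .rowCover).eval s₁) := hstd.eval rfl
  have heq : Cmd.evaluate.eval s =
    (Cmd.ite (.rlt 2 1) .skip .saveBest).eval ((Cmd.loop 10 .rowCover).eval s₁) := rfl
  have hr1 : ((Cmd.loop 10 .rowCover).eval s₁).rreg 1 = s.rreg 1 := by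
    simpa [hs₁] using ha₂.rreg 1 (by decide)
  have hm1 : ((Cmd.loop 10 .rowCover).eval s₁).mem 1 = s.mem 1 := by
    simpa [hs₁] using ha₂.mem 1 (by decide)
  have hm3 : ((Cmd.loop 10 .rowCover).eval s₁).mem 3 = s.mem 3 := by
    simpa [hs₁] using ha₂.mem 3 (by decide)
  rw [heq]
  generalize (Cmd.loop 10 .rowCover).eval s₁ = s₂ at *
  have hval : s₂.rreg 2 = matrixCover n W (below n fun v => col v = 1) := by
    rw [hsum.2, matrixCover]
    refine Finset.sum_congr rfl fun u hu => Finset.sum_congr rfl fun v hv => ?_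
    rw [Finset.mem_range] at hu hv
    rw [hc u hu, hc v hv, h.weight u hu v hv]
    simp [hu, hv]
  rw [Cmd.eval_ite_rlt]
  by_cases hlt : s₂.rreg 2 < s₂.rreg 1
  · rw [if_pos hlt]
    left
    rw [hval, hr1] at hlt
    exact ⟨hlt, by simp [hr1], by simp [hm1]⟩
  · rw [if_neg hlt]
    right
    obtain ⟨h1, h2⟩ := eval_saveBest hstd₂
    rw [hval, hr1] at hlt
    refine ⟨not_lt.1 hlt, h1.trans hval, fun v hv => ?_⟩
    rw [h2 v hv, hm3, hc v hv]

/-- The effect of the body of the main loop. -/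
inductive BodyEffect (n k D : ℕ) (W : ℕ → ℕ → ℝ) (O : ℕ → ℕ → Prop) (L : List (ℕ → ℕ))
    (col : ℕ → ℕ) (s s' : State) : Prop where
  | active (ha : IsActive n k D O col) (L' : List (ℕ → ℕ)) (hL' : IsExpansion n W O col L')
      (hL : HasStack n s' (L ++ L')) (h1 : s'.mem 1 = s.mem 1) (hr : s'.rreg 1 = s.rreg 1)
  | complete (hk : numChosen n col = k) (hL : HasStack n s' L) (hu : UpdatesBest n W col s s')
  | discard (ha : ¬ IsActive n k D O col) (hk : numChosen n col ≠ k) (hL : HasStack n s' L)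
      (h1 : s'.mem 1 = s.mem 1) (hr : s'.rreg 1 = s.rreg 1)

theorem HoldsData.body (h : HoldsData n k D W O s) (hD : D ≤ n) (hk : k ≤ n)
    (hL : HasStack n s (L ++ [col])) :
    HoldsData n k D W O (Cmd.body.eval s) ∧ BodyEffect n k D W O L col s (Cmd.body.eval s) := by
  refine ⟨h.eval rfl (by decide) (by decide) (by decide), ?_⟩
  obtain ⟨hL₁, hc₁⟩ := hL.pop h.std
  have ha₁ := Cmd.agree_eval .pop s
  have h₁ : HoldsData n k D W O (Cmd.pop.eval s) :=
    h.eval rfl (by decide) (by decide) (by decide)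
  have m1 := ha₁.mem 1 (by decide)
  have r1 := ha₁.rreg 1 (by decide)
  rw [Cmd.body, Cmd.eval_seq]
  generalize Cmd.pop.eval s = s₁ at *
  have hmark := eval_mark h₁.std
  have ha₂ := Cmd.agree_eval .mark s₁
  have h₂ : HoldsData n k D W O (Cmd.mark.eval s₁) :=
    h₁.eval rfl (by decide) (by decide) (by decide)
  have m2 := (ha₂.mem 1 (by decide)).trans m1
  have r2 := (ha₂.rreg 1 (by decide)).trans r1
  have hL₂ : HasStack n (Cmd.mark.eval s₁) L :=
    hL₁.congr (ha₂.reg 5 (by decide)) (ha₂.mem 2 (by decide))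
  have hc₂ : ∀ v < n, (Cmd.mark.eval s₁).mem 3 v = col v := by rwa [ha₂.mem 3 (by decide)]
  have hm₂ : ∀ v < n, (Cmd.mark.eval s₁).mem 4 v ≠ 0 ↔ IsMarked n O col v := by
    intro v hv
    rw [hmark v hv]
    refine exists_congr fun u => and_congr_right fun hu => ?_
    rw [hc₁ u hu, ← h₁.arc u hu v hv]
  clear hmark ha₂
  rw [Cmd.eval_seq]
  generalize Cmd.mark.eval s₁ = s₂ at *
  obtain ⟨h15, h16⟩ := eval_count h₂.std
  have ha₃ := Cmd.agree_eval .count s₂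
  have h₃ : HoldsData n k D W O (Cmd.count.eval s₂) :=
    h₂.eval rfl (by decide) (by decide) (by decide)
  have m3 := (ha₃.mem 1 (by decide)).trans m2
  have r3 := (ha₃.rreg 1 (by decide)).trans r2
  have hL₃ : HasStack n (Cmd.count.eval s₂) L :=
    hL₂.congr (ha₃.reg 5 (by decide)) (ha₃.mem 2 (by decide))
  have hc₃ : ∀ v < n, (Cmd.count.eval s₂).mem 3 v = col v := by rwa [ha₃.mem 3 (by decide)]
  have hm₃ : ∀ v < n, (Cmd.count.eval s₂).mem 4 v ≠ 0 ↔ IsMarked n O col v := by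
    rwa [ha₃.mem 4 (by decide)]
  have h15' : (Cmd.count.eval s₂).reg 15 = numChosen n col := by
    rw [h15, numChosen, numChosen, below_congr fun v hv => by rw [hc₂ v hv]]
  have h16' : (Cmd.count.eval s₂).reg 16 = numCharged n O col := by
    rw [h16, numCharged]
    congr 1
    refine below_congr fun v hv => ?_
    rw [hc₂ v hv, ← hm₂ v hv, not_not]
  clear h15 h16 ha₃
  rw [Cmd.eval_seq]
  generalize Cmd.count.eval s₂ = s₃ at *
  rw [Cmd.eval_ite_lt, h15', h₃.reg_one]
  by_cases hlt : numChosen n col < k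
  · rw [if_pos hlt, Cmd.eval_seq]
    have h17 := eval_limit h₃.std (h₃.reg_six ▸ hD) (h₃.reg_one ▸ hk)
    rw [h₃.reg_six, h₃.reg_one, h15'] at h17
    have ha₄ := Cmd.agree_eval .limit s₃
    have h₄ : HoldsData n k D W O (Cmd.limit.eval s₃) :=
      h₃.eval rfl (by decide) (by decide) (by decide)
    have m4 := (ha₄.mem 1 (by decide)).trans m3
    have r4 := (ha₄.rreg 1 (by decide)).trans r3
    have hL₄ : HasStack n (Cmd.limit.eval s₃) L :=
      hL₃.congr (ha₄.reg 5 (by decide)) (ha₄.mem 2 (by decide))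
    have hc₄ : ∀ v < n, (Cmd.limit.eval s₃).mem 3 v = col v := by rwa [ha₄.mem 3 (by decide)]
    have hm₄ : ∀ v < n, (Cmd.limit.eval s₃).mem 4 v ≠ 0 ↔ IsMarked n O col v := by
      rwa [ha₄.mem 4 (by decide)]
    have h16 := (ha₄.reg 16 (by decide)).trans h16'
    clear ha₄
    generalize Cmd.limit.eval s₃ = s₄ at *
    rw [Cmd.eval_ite_lt, h17, h16]
    by_cases hcut : D * (k - numChosen n col) < numCharged n O col
    · rw [if_pos hcut]
      exact .discard (fun h => by have := h.2; omega) hlt.ne (hL₄.congr (by simp) (by simp))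
        (by simpa using m4) (by simpa using r4)
    · rw [if_neg hcut]
      obtain ⟨L', hL', hst⟩ := h₄.expand hL₄ hc₄ hm₄
      have ha₅ := Cmd.agree_eval .expand s₄
      exact .active ⟨hlt, not_lt.1 hcut⟩ L' hL' hst ((ha₅.mem 1 (by decide)).trans m4)
        ((ha₅.rreg 1 (by decide)).trans r4)
  · rw [if_neg hlt, Cmd.eval_ite_lt, h15', h₃.reg_one]
    -- Choosing a pair may lead from `k - 1` to `k + 1` chosen vertices.
    by_cases hgt : k < numChosen n col
    · rw [if_pos hgt]
      exact .discard (fun h => hlt h.1) hgt.ne' (hL₃.congr (by simp) (by simp))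
        (by simpa using m3) (by simpa using r3)
    · rw [if_neg hgt]
      have ha₄ := Cmd.agree_eval .evaluate s₃
      refine .complete (by omega) (hL₃.congr (ha₄.reg 5 (by decide)) (ha₄.mem 2 (by decide))) ?_
      have := h₃.evaluate hc₃
      unfold UpdatesBest at this ⊢
      rwa [m3, r3] at this

end RealRAM

/-! ### Correctness and length of the search -/

namespace RealRAM

/-- The data of an instance that the search relies on: a matrix of weights, an orientation of its
nonzero entries with out-degrees at most `D`, and an optimal set. -/
structure SearchInstance (n k D : ℕ) (W : ℕ → ℕ → ℝ) (O : ℕ → ℕ → Prop) (S : Finset ℕ) : Prop where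
  symm : ∀ u v, W u v = W v u
  diag : ∀ v, W v v = 0
  nonneg : ∀ u v, 0 ≤ W u v
  arc : ∀ u v, W u v ≠ 0 → O u v ∨ O v u
  outdegree : ∀ u < n, (below n (O u)).card ≤ D
  optimal : IsFirstOptimal n k W S

/-- The set saved in the array `1` has `k` elements, and the real register `1` holds its value. -/
def SavedSet (n k : ℕ) (W : ℕ → ℕ → ℝ) (s : State) : Prop :=
  (below n fun v => s.mem 1 v ≠ 0).card = k ∧
    matrixCover n W (below n fun v => s.mem 1 v ≠ 0) = s.rreg 1

/-- An optimal set has been found. -/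
def Found (n k : ℕ) (W : ℕ → ℕ → ℝ) (S : Finset ℕ) (s : State) : Prop :=
  SavedSet n k W s ∧ matrixCover n W S ≤ s.rreg 1

/-- The invariant of the search: an optimal set has been found, or a colouring on the stack can be
completed to the set `S`. -/
structure SearchInv (n k : ℕ) (W : ℕ → ℕ → ℝ) (O : ℕ → ℕ → Prop) (S : Finset ℕ)
    (L : List (ℕ → ℕ)) (s : State) : Prop where
  saved : s.rreg 1 = 0 ∨ SavedSet n k W s
  found : Found n k W S s ∨ ∃ c ∈ L, IsGood n O S c

variable {n k D : ℕ} {W : ℕ → ℕ → ℝ} {O : ℕ → ℕ → Prop} {S : Finset ℕ} {s s' : State}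
  {L : List (ℕ → ℕ)} {col : ℕ → ℕ}

theorem SavedSet.congr (h : SavedSet n k W s) (h1 : s'.mem 1 = s.mem 1)
    (hr : s'.rreg 1 = s.rreg 1) : SavedSet n k W s' := by
  unfold SavedSet at h ⊢
  rwa [h1, hr]

theorem Found.congr (h : Found n k W S s) (h1 : s'.mem 1 = s.mem 1)
    (hr : s'.rreg 1 = s.rreg 1) : Found n k W S s' :=
  ⟨h.1.congr h1 hr, hr ▸ h.2⟩

theorem SearchInstance.matrixCover_nonneg (hI : SearchInstance n k D W O S) (T : Finset ℕ) :
    0 ≤ matrixCover n W T := by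
  refine Finset.sum_nonneg fun u _ => Finset.sum_nonneg fun v _ => ?_
  split_ifs
  · exact hI.nonneg u v
  · exact le_rfl

theorem SearchInv.body (hI : SearchInstance n k D W O S) (h : SearchInv n k W O S (L ++ [col]) s)
    (he : BodyEffect n k D W O L col s s') :
    ∃ L', HasStack n s' (L ++ L') ∧ SearchInv n k W O S (L ++ L') s' ∧
      (L' = [] ∨ IsActive n k D O col ∧ IsExpansion n W O col L') := by
  have hgood : Found n k W S s ∨ IsGood n O S col ∨ ∃ c ∈ L, IsGood n O S c := by
    rcases h.found with hf | ⟨c, hc, hg⟩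
    · exact .inl hf
    · rcases List.mem_append.1 hc with hc | hc
      · exact .inr (.inr ⟨c, hc, hg⟩)
      · exact .inr (.inl (List.mem_singleton.1 hc ▸ hg))
  cases he with
  | active ha L' hL' hL h1 hr =>
    refine ⟨L', hL, ⟨?_, ?_⟩, .inr ⟨ha, hL'⟩⟩
    · rw [hr]; exact h.saved.imp_right fun h => h.congr h1 hr
    · rcases hgood with hf | hg | ⟨c, hc, hg⟩
      · exact .inl (hf.congr h1 hr)
      · obtain ⟨c, hc, hg⟩ :=
          hL'.exists_good hI.symm hI.diag hI.nonneg hI.arc hI.optimal hg ha.1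
        exact .inr ⟨c, List.mem_append_right _ hc, hg⟩
      · exact .inr ⟨c, List.mem_append_left _ hc, hg⟩
  | discard ha hk hL h1 hr =>
    refine ⟨[], by simpa using hL, ⟨?_, ?_⟩, .inl rfl⟩
    · rw [hr]; exact h.saved.imp_right fun h => h.congr h1 hr
    · rcases hgood with hf | hg | ⟨c, hc, hg⟩
      · exact .inl (hf.congr h1 hr)
      -- A good colouring is never discarded: it has at most `k` chosen vertices and respects the
      -- limit on charged ones.
      · have h2 := hg.numChosen_le
        have h3 := hg.numCharged_le hI.optimal.subset hI.outdegree
        rw [hI.optimal.card_eq] at h2 h3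
        exact absurd ⟨lt_of_le_of_ne h2 hk, h3⟩ ha
      · exact .inr ⟨c, List.mem_append_left _ hc, hg⟩
  | complete hk hL hu =>
    have hS : IsGood n O S col → (below n fun v => col v = 1) = S := fun hg =>
      hg.eq_of_numChosen (hk.trans hI.optimal.card_eq.symm)
    have h0 := hI.matrixCover_nonneg (below n fun v => col v = 1)
    refine ⟨[], by simpa using hL, ?_, .inl rfl⟩
    rw [List.append_nil]
    rcases hu with ⟨hlt, hr, h1⟩ | ⟨hle, hr, h1⟩
    · refine ⟨?_, ?_⟩
      · rw [hr]; exact h.saved.imp_right fun h => h.congr h1 hr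
      · rcases hgood with hf | hg | ⟨c, hc, hg⟩
        · exact .inl (hf.congr h1 hr)
        -- The recorded value exceeds the nonnegative cover of `S`. So it is not the initial `0`,
        -- and it belongs to a saved set.
        · rw [hS hg] at hlt h0
          refine .inl ⟨?_, hr ▸ hlt.le⟩
          rcases h.saved with h2 | h2
          · linarith
          · exact h2.congr h1 hr
        · exact .inr ⟨c, hc, hg⟩
    · have hsaved : SavedSet n k W s' := by
        unfold SavedSet
        rw [below_congr h1, hr]
        exact ⟨hk, rfl⟩
      refine ⟨.inr hsaved, ?_⟩
      rcases hgood with hf | hg | ⟨c, hc, hg⟩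
      · exact .inl ⟨hsaved, by rw [hr]; exact hf.2.trans hle⟩
      · refine .inl ⟨hsaved, ?_⟩
        rw [hr, hS hg]
      · exact .inr ⟨c, hc, hg⟩

/-- The main loop finds an optimal set, and the number of its passages is at most the sum of the
weights of the colourings on the stack. -/
theorem exec_search {A σ γ : ℝ} (hI : SearchInstance n k D W O S) (hr : Rates D A σ γ) (hn : 0 < n)
    (hD : D ≤ n) (hk : k ≤ n) {M : ℕ} (N : ℕ) : ∀ (s : State) (V : ℕ) (L : List (ℕ → ℕ)),
    HoldsData n k D W O s → HasStack n s L → SearchInv n k W O S L s → s.BoundedBy V →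
    (L.map (weight n k D O A σ γ)).sum ≤ N → V + N * Cmd.body.bound n * (n + 3) ≤ M →
    ∃ s' t, Exec (.while (.lt 3 5) Cmd.body.toProg) s s' t ∧
      t ≤ (1 + N * (Cmd.body.bound n + 1)) * (1 + 3 * M.size) ∧ Found n k W S s' := by
  induction N with
  | zero =>
    intro s V L hd hL hi hV hw hM
    -- Every colouring weighs at least `1`, so a total weight of at most `0` means an empty stack.
    have hLnil : L = [] := by
      cases L with
      | nil => rfl
      | cons c L =>
        have h1 := hr.one_le_weight (n := n) (k := k) (O := O) (col := c)
        have h2 : 0 ≤ (L.map (weight n k D O A σ γ)).sum := by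
          refine List.sum_nonneg fun x hx => ?_
          obtain ⟨c', -, rfl⟩ := List.mem_map.1 hx
          exact zero_le_one.trans hr.one_le_weight
        simp at hw
        linarith
    subst hLnil
    refine ⟨s, _, .while_false ?_, ?_, ?_⟩
    · simp [Test.Holds, hd.std.reg_three, hL.ptr]
    · simpa using Test.cost_le (b := .lt 3 5) hV (by simpa using hM)
    · simpa using hi.found
  | succ N ih =>
    intro s V L hd hL hi hV hw hM
    have hVM : V ≤ M := le_trans (Nat.le_add_right _ _) hM
    have hcost := Test.cost_le (b := .lt 3 5) hV hVM
    rcases List.eq_nil_or_concat L with rfl | ⟨L₀, col, rfl⟩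
    · refine ⟨s, _, .while_false ?_, ?_, ?_⟩
      · simp [Test.Holds, hd.std.reg_three, hL.ptr]
      · exact hcost.trans (Nat.le_mul_of_pos_left _ (by positivity))
      · simpa using hi.found
    · rw [List.concat_eq_append] at hL hi hw
      obtain ⟨hd', he⟩ := hd.body hD hk hL
      obtain ⟨L', hL', hi', hch⟩ := hi.body hI he
      obtain ⟨t, ht, hex, hV'⟩ := Cmd.body.exec s V (M := M) rfl hd.std hV (by nlinarith)
      -- The popped colouring outweighs its children together by at least `1`, so each passage
      -- lowers the budget by one.
      have hw' : ((L₀ ++ L').map (weight n k D O A σ γ)).sum ≤ N := by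
        rw [List.map_append, List.sum_append] at hw ⊢
        simp only [List.map_cons, List.map_nil, List.sum_cons, List.sum_nil, add_zero] at hw
        push_cast at hw
        have h1 := hr.one_le_weight (n := n) (k := k) (O := O) (col := col)
        rcases hch with rfl | ⟨ha, hexp⟩
        · simp; linarith
        · have := hexp.sum_weight_lt hr hI.outdegree ha
          linarith
      obtain ⟨s', t', hex', ht', hf⟩ := ih _ _ _ hd' hL' hi' hV' hw' (by nlinarith)
      refine ⟨s', _, .while_true ?_ hex hex', ?_, hf⟩
      · simp only [Test.Holds, hd.std.reg_three, hL.ptr]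
        simp [hn]
      · nlinarith

/-- The weight of the colouring without decided vertices. -/
theorem weight_zero_le {A σ γ : ℝ} (hA : 1 ≤ A) :
    weight n k D O A σ γ (fun _ => 0) ≤ (n * n + 3 : ℝ) * (n + 1) * A ^ k := by
  have h1 : numChosen n (fun _ => 0) = 0 := by simp [numChosen, below]
  have h2 : numCharged n O (fun _ => 0) = 0 := by simp [numCharged, below]
  have h3 : numPending n O (fun _ => 0) = 0 := by simp [numPending, below, IsMarked]
  have h4 : numBlank n (fun _ => 0) = n := by simp [numBlank, below]
  have h5 : (1 : ℝ) ≤ A ^ k := one_le_pow₀ hA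
  unfold weight
  split_ifs
  · rw [potential, h1, h2, h3, h4]; simp
  · have : (0 : ℝ) ≤ n := n.cast_nonneg
    have h6 : (1 : ℝ) ≤ (n * n + 3 : ℝ) * (n + 1) := by nlinarith [mul_nonneg this this]
    nlinarith

theorem isGood_zero : IsGood n O S (fun _ => 0) :=
  ⟨fun v _ h => by simp at h, fun v _ h => by simp at h, fun v _ h => by simp at h⟩

end RealRAM

namespace RealRAM

/-! ### Orienting the graph -/

namespace Cmd

/-- Count the neighbours of the vertex in the register `10` that are not removed. -/
def degreeRow : Cmd :=
  seq (const 22 0) (loop 11 (seq (load 13 0 12) (seq (incr 12) (seq (load 14 7 11)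
    (ifPos 13 (ifPos 14 skip (incr 22)) skip)))))

/-- Record the vertex in the register `10` as the one of minimum degree. -/
def recordMin : Cmd := seq (const 19 1) (seq (copy 20 10) (copy 21 22))

/-- Look for a vertex of minimum degree among the vertices that are not removed. -/
def findMin : Cmd :=
  seq (const 19 0) (seq (const 12 0) (loop 10 (seq degreeRow (seq (load 13 7 10)
    (ifPos 13 skip (ifPos 19 (ite (.lt 22 21) recordMin skip) recordMin))))))

/-- Direct the edges from the vertex in the register `20` to vertices that are not removed. -/
def directRow : Cmd :=
  seq rowPointer (loop 10 (seq (load 13 0 7) (seq (load 14 7 10)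
    (seq (ifPos 13 (ifPos 14 skip (store 5 7 2)) skip) (incr 7)))))

/-- Direct the edges at the vertex in the register `20`, and remove it. -/
def removeMin : Cmd :=
  seq (ite (.lt 6 21) (copy 6 21) skip) (seq directRow (store 7 20 2))

/-- Orient the graph by removing vertices of minimum degree. -/
def orient : Cmd := loop 23 (seq findMin (ifPos 19 removeMin skip))

end Cmd

/-- The number of neighbours of `u` that are not removed. -/
noncomputable def remainingDegree (n : ℕ) (s : State) (u : ℕ) : ℕ :=
  (below n fun v => s.mem 0 (u * n + v) ≠ 0 ∧ s.mem 7 v = 0).card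

variable {n : ℕ} {s : State}

theorem eval_degreeRow (hs : Std n s) :
    (Cmd.degreeRow.eval s).reg 12 = s.reg 12 + n ∧ (Cmd.degreeRow.eval s).reg 22 =
      (below n fun v => s.mem 0 (s.reg 12 + v) ≠ 0 ∧ s.mem 7 v = 0).card := by
  have hstd : Std n ((Cmd.const 22 0).eval s) := hs.eval rfl
  refine Cmd.eval_loop_induct (n := n) (i := 11) (s := (Cmd.const 22 0).eval s) rfl hstd
    (fun j s' => s'.reg 12 = s.reg 12 + j ∧ s'.reg 22 =
      (below j fun v => s.mem 0 (s.reg 12 + v) ≠ 0 ∧ s.mem 7 v = 0).card)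
    (by simp) ?_
  intro j s' hj hs' hi ha ⟨h1, h2⟩
  have h0 : s'.mem 0 = s.mem 0 := by simpa using ha.mem 0 (by decide)
  have h7 : s'.mem 7 = s.mem 7 := by simpa using ha.mem 7 (by decide)
  rw [card_below_succ, ← h2]
  have e2 := hs'.reg_two
  have e3 := hs'.reg_three
  by_cases hc : s.mem 0 (s.reg 12 + j) = 0
  · simp [e2, e3, h1, h0, h7, hi, hc]; omega
  · by_cases hc' : s.mem 7 j = 0
    · simp [e2, e3, h1, h0, h7, hi, hc, hc']; omega
    · simp [e2, e3, h1, h0, h7, hi, hc, hc']; omega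

theorem eval_findMin (hs : Std n s) :
    ((Cmd.findMin.eval s).reg 19 = 0 ∧ ∀ v < n, s.mem 7 v ≠ 0) ∨
    ((Cmd.findMin.eval s).reg 19 ≠ 0 ∧ (Cmd.findMin.eval s).reg 20 < n ∧
      s.mem 7 ((Cmd.findMin.eval s).reg 20) = 0 ∧
      (Cmd.findMin.eval s).reg 21 = remainingDegree n s ((Cmd.findMin.eval s).reg 20) ∧
      ∀ u < n, s.mem 7 u = 0 →
        remainingDegree n s ((Cmd.findMin.eval s).reg 20) ≤ remainingDegree n s u) := by
  set s₁ := (Cmd.seq (.const 19 0) (.const 12 0)).eval s with hs₁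
  have hstd : Std n s₁ := hs.eval rfl
  refine (Cmd.eval_loop_induct (n := n) (i := 10) (s := s₁) rfl hstd
    (fun j s' => s'.reg 12 = j * n ∧ ((s'.reg 19 = 0 ∧ ∀ v < j, s.mem 7 v ≠ 0) ∨
      (s'.reg 19 ≠ 0 ∧ s'.reg 20 < j ∧ s.mem 7 (s'.reg 20) = 0 ∧
        s'.reg 21 = remainingDegree n s (s'.reg 20) ∧
        ∀ u < j, s.mem 7 u = 0 → remainingDegree n s (s'.reg 20) ≤ remainingDegree n s u)))
    (by simp [hs₁]) ?_).2
  intro j s' hj hs' hi ha ⟨h1, h2⟩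
  have h0 : s'.mem 0 = s.mem 0 := by simpa [hs₁] using ha.mem 0 (by decide)
  have h7 : s'.mem 7 = s.mem 7 := by simpa [hs₁] using ha.mem 7 (by decide)
  obtain ⟨h5, h6⟩ := eval_degreeRow hs'
  have hs'' : Std n (Cmd.degreeRow.eval s') := hs'.eval rfl
  have hag := Cmd.agree_eval .degreeRow s'
  have e19 := hag.reg 19 (by decide)
  have e20 := hag.reg 20 (by decide)
  have e21 := hag.reg 21 (by decide)
  have e10 := hag.reg 10 (by decide)
  have em7 := hag.mem 7 (by decide)
  rw [h7, h0, h1] at h6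
  change _ = remainingDegree n s j at h6
  rw [h1] at h5
  rw [hi] at e10
  rw [h7] at em7
  rw [Cmd.eval_seq]
  generalize Cmd.degreeRow.eval s' = s₂ at *
  have e2 := hs''.reg_two
  have e3 := hs''.reg_three
  have hjn : (j + 1) * n = j * n + n := by ring
  by_cases hc : s.mem 7 j = 0
  · rcases h2 with ⟨h2, h7⟩ | ⟨h2, h7, h8, h9, h10⟩
    · rw [h2] at e19
      refine ⟨by simp [e3, e10, em7, hc, e19, Cmd.recordMin, h5, hjn], .inr ?_⟩
      simp [e3, e10, em7, hc, e19, Cmd.recordMin, h6]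
      intro u hu hu0
      rcases Nat.lt_succ_iff_lt_or_eq.1 (Nat.lt_succ_iff.2 hu) with hu | rfl
      · exact absurd hu0 (h7 u hu)
      · simp
    · have e19' : s₂.reg 19 ≠ 0 := by rwa [e19]
      by_cases hlt : remainingDegree n s j < remainingDegree n s (s'.reg 20)
      · refine ⟨by simp [e3, e10, em7, hc, e19', Cmd.recordMin, h5, hjn, e21, h9, h6, hlt],
          .inr ?_⟩
        simp [e3, e10, em7, hc, e19', Cmd.recordMin, h6, e21, h9, hlt]
        intro u hu hu0
        rcases Nat.lt_succ_iff_lt_or_eq.1 (Nat.lt_succ_iff.2 hu) with hu | rfl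
        · have := h10 u hu hu0
          omega
        · simp
      · refine ⟨by simp [e3, e10, em7, hc, e19', h5, hjn, e21, h9, h6, hlt], .inr ?_⟩
        simp [e3, e10, em7, hc, h6, e21, h9, hlt, e19, e20, h2, h8]
        refine ⟨by omega, ?_⟩
        intro u hu hu0
        rcases Nat.lt_succ_iff_lt_or_eq.1 (Nat.lt_succ_iff.2 hu) with hu | rfl
        · exact h10 u hu hu0
        · exact not_lt.1 hlt
  · refine ⟨by simp [e3, e10, em7, hc, h5, hjn], ?_⟩
    simp [e3, e10, em7, hc, e19, e20, e21]
    rcases h2 with ⟨h2, h7⟩ | ⟨h2, h7, h8, h9, h10⟩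
    · left
      refine ⟨h2, fun v hv => ?_⟩
      rcases Nat.lt_succ_iff_lt_or_eq.1 (Nat.lt_succ_iff.2 hv) with hv | rfl
      · exact h7 v hv
      · exact hc
    · right
      refine ⟨h2, by omega, h8, h9, fun u hu hu0 => ?_⟩
      rcases Nat.lt_succ_iff_lt_or_eq.1 (Nat.lt_succ_iff.2 hu) with hu | rfl
      · exact h10 u hu hu0
      · exact absurd hu0 hc

theorem eval_directRow (hs : Std n s) (hv : s.reg 20 < n) (x : ℕ) :
    (Cmd.directRow.eval s).mem 5 x ≠ 0 ↔ s.mem 5 x ≠ 0 ∨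
      ∃ u < n, x = s.reg 20 * n + u ∧ s.mem 0 x ≠ 0 ∧ s.mem 7 u = 0 := by
  have hp := eval_rowPointer hs hv.le
  have hstd : Std n (Cmd.rowPointer.eval s) := hs.eval rfl
  have ha₁ := Cmd.agree_eval .rowPointer s
  have m5 := ha₁.mem 5 (by decide)
  have m0 := ha₁.mem 0 (by decide)
  have m7 := ha₁.mem 7 (by decide)
  refine (Cmd.eval_loop_induct (n := n) (i := 10) (s := Cmd.rowPointer.eval s) rfl hstd
    (fun j s' => s'.reg 7 = s.reg 20 * n + j ∧ ∀ x, s'.mem 5 x ≠ 0 ↔ s.mem 5 x ≠ 0 ∨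
      ∃ u < j, x = s.reg 20 * n + u ∧ s.mem 0 x ≠ 0 ∧ s.mem 7 u = 0)
    (by simp [hp, m5]) ?_).2 x
  intro j s' hj hs' hi ha ⟨h1, h2⟩
  have h0 : s'.mem 0 = s.mem 0 := by simpa [m0] using ha.mem 0 (by decide)
  have h7 : s'.mem 7 = s.mem 7 := by simpa [m7] using ha.mem 7 (by decide)
  have e2 := hs'.reg_two
  have e3 := hs'.reg_three
  have hstep : ∀ x, (∃ u < j + 1, x = s.reg 20 * n + u ∧ s.mem 0 x ≠ 0 ∧ s.mem 7 u = 0) ↔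
      (∃ u < j, x = s.reg 20 * n + u ∧ s.mem 0 x ≠ 0 ∧ s.mem 7 u = 0) ∨
      (x = s.reg 20 * n + j ∧ s.mem 0 x ≠ 0 ∧ s.mem 7 j = 0) := fun x =>
    Nat.exists_lt_succ_right
  by_cases hc : s.mem 0 (s.reg 20 * n + j) ≠ 0 ∧ s.mem 7 j = 0
  · refine ⟨by simp [e2, e3, h1, h0, h7, hi, hc.1, hc.2]; omega, fun x => ?_⟩
    rw [hstep, ← or_assoc, ← h2]
    by_cases hx : x = s.reg 20 * n + j
    · subst hx; simp [e2, e3, h1, h0, h7, hi, hc.1, hc.2]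
    · simp [e2, e3, h1, h0, h7, hi, hc.1, hc.2, hx]
  · have hc' : ∀ x, ¬ (x = s.reg 20 * n + j ∧ s.mem 0 x ≠ 0 ∧ s.mem 7 j = 0) := by
      rintro x ⟨rfl, h⟩; exact hc h
    by_cases hc0 : s.mem 0 (s.reg 20 * n + j) = 0
    · refine ⟨by simp [e2, e3, h1, h0, h7, hi, hc0]; omega, fun x => ?_⟩
      rw [hstep, ← or_assoc, ← h2, or_iff_left (hc' x)]
      simp [e3, h1, h0, h7, hi, hc0]
    · have hc7 : s.mem 7 j ≠ 0 := fun h => hc ⟨hc0, h⟩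
      refine ⟨by simp [e2, e3, h1, h0, h7, hi, hc0, hc7]; omega, fun x => ?_⟩
      rw [hstep, ← or_assoc, ← h2, or_iff_left (hc' x)]
      simp [e3, h1, h0, h7, hi, hc0, hc7]

theorem mul_add_inj {n a b x y : ℕ} (hx : x < n) (hy : y < n) (h : a * n + x = b * n + y) :
    a = b ∧ x = y := by
  have hn : 0 < n := by omega
  have h1 : (a * n + x) / n = a := by
    rw [mul_comm, Nat.mul_add_div hn, Nat.div_eq_of_lt hx, add_zero]
  have h2 : (b * n + y) / n = b := by
    rw [mul_comm, Nat.mul_add_div hn, Nat.div_eq_of_lt hy, add_zero]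
  have : a = b := by rw [← h1, h, h2]
  subst this
  exact ⟨rfl, by omega⟩

/-- The state of the orientation after the removal of some vertices: `a` is the adjacency
relation. -/
structure OrientInv (n d : ℕ) (a : ℕ → ℕ → Prop) (j : ℕ) (s : State) : Prop where
  removed : j ≤ (below n fun v => s.mem 7 v ≠ 0).card
  arc : ∀ u < n, ∀ v < n, a u v → s.mem 7 u ≠ 0 ∨ s.mem 7 v ≠ 0 →
    s.mem 5 (u * n + v) ≠ 0 ∨ s.mem 5 (v * n + u) ≠ 0
  outdegree : ∀ u < n, (below n fun v => s.mem 5 (u * n + v) ≠ 0).card ≤ s.reg 6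
  empty : ∀ u < n, s.mem 7 u = 0 → ∀ v < n, s.mem 5 (u * n + v) = 0
  le : s.reg 6 ≤ d
  le_width : s.reg 6 ≤ n

/-- The row of `v` was empty so far and receives arcs to exactly the unremoved neighbours, so the
out-degree of `v` is its remaining degree. Edges to vertices removed earlier already have a
direction. -/
theorem OrientInv.removeMin {d j : ℕ} {a : ℕ → ℕ → Prop} (h : OrientInv n d a j s)
    (hs : Std n s) (hsymm : ∀ u v, a u v → a v u)
    (ha : ∀ u < n, ∀ v < n, s.mem 0 (u * n + v) ≠ 0 ↔ a u v) (hv : s.reg 20 < n)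
    (h7 : s.mem 7 (s.reg 20) = 0) (h21 : s.reg 21 = remainingDegree n s (s.reg 20))
    (hd : s.reg 21 ≤ d) :
    OrientInv n d a (j + 1) (Cmd.removeMin.eval s) := by
  set v := s.reg 20 with hvdef
  obtain ⟨s₁, hs₁, h6, hag⟩ : ∃ s₁, (Cmd.ite (.lt 6 21) (.copy 6 21) .skip).eval s = s₁ ∧
      s₁.reg 6 = max (s.reg 6) (s.reg 21) ∧ Agree (Cmd.ite (.lt 6 21) (.copy 6 21) .skip) s s₁ := by
    refine ⟨_, rfl, ?_, Cmd.agree_eval _ s⟩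
    rw [Cmd.eval_ite_lt]
    split_ifs with hlt
    · simp [hs.reg_three]; omega
    · simp; omega
  have hs' : Std n s₁ := hag.std rfl hs
  have e20 : s₁.reg 20 = v := hag.reg 20 (by decide)
  have m0 := hag.mem 0 (by decide)
  have m5 := hag.mem 5 (by decide)
  have m7 := hag.mem 7 (by decide)
  have hrow := eval_directRow hs' (e20 ▸ hv)
  have hag₂ := Cmd.agree_eval .directRow s₁
  have hs₂ : Std n (Cmd.directRow.eval s₁) := hs'.eval rfl
  have h6₂ := (hag₂.reg 6 (by decide)).trans h6
  have e20₂ := (hag₂.reg 20 (by decide)).trans e20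
  have m7₂ := (hag₂.mem 7 (by decide)).trans m7
  have heq : Cmd.removeMin.eval s = (Cmd.store 7 20 2).eval (Cmd.directRow.eval s₁) := by
    rw [← hs₁]; rfl
  rw [e20, m5, m0, m7] at hrow
  rw [heq]
  clear hag₂ heq
  generalize Cmd.directRow.eval s₁ = s₂ at *
  set s₃ := (Cmd.store 7 20 2).eval s₂ with hs₃
  have m7₃ : ∀ u, s₃.mem 7 u ≠ 0 ↔ s.mem 7 u ≠ 0 ∨ u = v := by
    intro u
    by_cases huv : u = v
    · simp [hs₃, e20₂, huv, hs₂.reg_two]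
    · simp [hs₃, e20₂, huv, m7₂]
  have m5₃ : s₃.mem 5 = s₂.mem 5 := by simp [hs₃]
  have r6₃ : s₃.reg 6 = max (s.reg 6) (s.reg 21) := by simpa [hs₃] using h6₂
  have hO : ∀ u < n, ∀ w < n, s₃.mem 5 (u * n + w) ≠ 0 ↔
      s.mem 5 (u * n + w) ≠ 0 ∨ (u = v ∧ a u w ∧ s.mem 7 w = 0) := by
    intro u hu w hw
    rw [m5₃, hrow]
    refine or_congr_right ⟨?_, ?_⟩
    · rintro ⟨x, hx, hEq, h1, h2⟩
      obtain ⟨rfl, rfl⟩ := mul_add_inj hw hx hEq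
      exact ⟨rfl, (ha _ hu _ hw).1 h1, h2⟩
    · rintro ⟨rfl, h1, h2⟩
      exact ⟨w, hw, rfl, (ha _ hu _ hw).2 h1, h2⟩
  constructor
  · have : (below n fun u => s₃.mem 7 u ≠ 0) = insert v (below n fun u => s.mem 7 u ≠ 0) := by
      ext u
      simp only [mem_below, Finset.mem_insert, m7₃]
      constructor
      · tauto
      · rintro (rfl | h)
        · exact ⟨hv, .inr rfl⟩
        · exact ⟨h.1, .inl h.2⟩
    rw [this, Finset.card_insert_of_notMem (by simp [h7])]
    exact Nat.succ_le_succ h.removed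
  · intro u hu w hw huw hor
    rw [hO u hu w hw, hO w hw u hu]
    rw [m7₃, m7₃] at hor
    by_cases hold : s.mem 7 u ≠ 0 ∨ s.mem 7 w ≠ 0
    · have := h.arc u hu w hw huw hold
      tauto
    · push Not at hold
      have huw' := hsymm u w huw
      have := hold.1
      have := hold.2
      tauto
  · intro u hu
    rw [r6₃]
    by_cases huv : u = v
    · have : (below n fun w => s₃.mem 5 (u * n + w) ≠ 0) =
          below n fun w => s.mem 0 (v * n + w) ≠ 0 ∧ s.mem 7 w = 0 := by
        refine below_congr fun w hw => ?_
        subst huv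
        rw [hO _ hu w hw, ha _ hu w hw, h.empty _ hu h7 w hw]
        simp
      rw [this, h21]
      exact le_max_right _ _
    · have : (below n fun w => s₃.mem 5 (u * n + w) ≠ 0) =
          below n fun w => s.mem 5 (u * n + w) ≠ 0 := by
        refine below_congr fun w hw => ?_
        rw [hO u hu w hw]
        simp [huv]
      rw [this]
      exact (h.outdegree u hu).trans (le_max_left _ _)
  · intro u hu hu7 w hw
    have h1 : ¬ (s.mem 7 u ≠ 0 ∨ u = v) := by rw [← m7₃]; simpa using hu7
    push Not at h1
    have h2 := hO u hu w hw
    rw [h.empty u hu h1.1 w hw] at h2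
    by_contra hne
    have := h2.1 hne
    tauto
  · rw [r6₃]; exact max_le h.le hd
  · rw [r6₃]
    refine max_le h.le_width ?_
    rw [h21]
    refine (Finset.card_le_card (below_subset_range n _)).trans (by simp)

/-- Degeneracy, applied to the set of unremoved vertices, bounds the minimum remaining degree by
`d`. The program does not know `d`: register `6` collects the largest minimum degree that occurs,
and this is the later `D`. -/
theorem eval_orient {d : ℕ} {a : ℕ → ℕ → Prop} (hs : Std n s) (h6 : s.reg 6 = 0)
    (h5 : ∀ x, s.mem 5 x = 0) (h7 : ∀ x, s.mem 7 x = 0) (hsymm : ∀ u v, a u v → a v u)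
    (ha : ∀ u < n, ∀ v < n, s.mem 0 (u * n + v) ≠ 0 ↔ a u v)
    (hd : ∀ U ⊆ Finset.range n, U.Nonempty → ∃ u ∈ U, (below n fun v => a u v ∧ v ∈ U).card ≤ d) :
    OrientInv n d a n (Cmd.orient.eval s) := by
  refine Cmd.eval_loop_induct (n := n) (i := 23) (s := s) rfl hs (OrientInv n d a) ?_ ?_
  · constructor <;> simp [h5, h6, h7, below]
  intro j s' hj hs' hi hag h
  have h0 : s'.mem 0 = s.mem 0 := hag.mem 0 (by decide)
  have hspec := eval_findMin hs'
  have hs'' : Std n (Cmd.findMin.eval s') := hs'.eval rfl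
  have hag₂ := Cmd.agree_eval .findMin s'
  have m0 := hag₂.mem 0 (by decide)
  have m5 := hag₂.mem 5 (by decide)
  have m7 := hag₂.mem 7 (by decide)
  have r6 := hag₂.reg 6 (by decide)
  rw [Cmd.eval_seq]
  clear hag₂
  have hdeg : ∀ u, remainingDegree n (Cmd.findMin.eval s') u = remainingDegree n s' u := by
    intro u; rw [remainingDegree, remainingDegree, m0, m7]
  generalize Cmd.findMin.eval s' = s₂ at *
  rw [Cmd.eval_ifPos hs''.reg_three]
  have h₂ : OrientInv n d a j s₂ := by
    obtain ⟨i1, i2, i3, i4, i5, i6⟩ := h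
    constructor <;> simpa only [m5, m7, r6]
  suffices hsuff : ∀ t : State, OrientInv n d a (j + 1) t →
      OrientInv n d a (j + 1) ((Instr.op .add 23 23 2).apply t) by
    apply hsuff
    rcases hspec with ⟨h19, hall⟩ | ⟨h19, hv, h7v, h21, hmin⟩
    -- The invariant bounds the number of removed vertices only from below, so running out of
    -- vertices must be allowed for; then all `n ≥ j + 1` are removed.
    · rw [if_pos h19]
      obtain ⟨i1, i2, i3, i4, i5, i6⟩ := h₂
      refine ⟨?_, by simpa using i2, by simpa using i3, by simpa using i4, by simpa using i5,
        by simpa using i6⟩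
      have : (below n fun v => s₂.mem 7 v ≠ 0) = Finset.range n := by
        ext v
        simp only [mem_below, Finset.mem_range, m7]
        exact ⟨fun h => h.1, fun h => ⟨h, hall v h⟩⟩
      simp only [Cmd.eval_instr, Instr.apply, this, Finset.card_range]
      omega
    · rw [if_neg h19]
      refine h₂.removeMin hs'' hsymm (by rwa [m0, h0]) hv (by rwa [m7]) (by rw [h21, hdeg]) ?_
      obtain ⟨u, hu, hud⟩ := hd (below n fun v => s'.mem 7 v = 0) (below_subset_range n _)
        ⟨s₂.reg 20, by simp [hv, h7v]⟩
      rw [mem_below] at hu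
      rw [h21]
      refine (hmin u hu.1 hu.2).trans (le_trans (le_of_eq ?_) hud)
      rw [remainingDegree]
      congr 1
      refine below_congr fun v hv => ?_
      rw [h0, ha u hu.1 v hv, mem_below]
      tauto
  intro t ⟨i1, i2, i3, i4, i5, i6⟩
  exact ⟨i1, i2, by simpa using i3, i4, by simpa using i5, by simpa using i6⟩

end RealRAM

namespace RealRAM

/-! ### Graphs as matrices -/

theorem matrixArray_apply {α : Type} [Zero α] {n : ℕ} (A : Fin n → Fin n → α) (u v : Fin n) :
    matrixArray A (u * n + v) = A u v := by
  have hlt : (u * n + v : ℕ) < n * n := by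
    have h1 : (u + 1) * n ≤ n * n := Nat.mul_le_mul_right n u.2
    have h2 : ((u : ℕ) + 1) * n = u * n + n := by ring
    have := v.2
    omega
  have h : finProdFinEquiv.symm ⟨u * n + v, hlt⟩ = (u, v) := by
    rw [Equiv.symm_apply_eq]
    ext
    simp [finProdFinEquiv]
    ring
  rw [matrixArray, dif_pos hlt, h]

open Classical in
/-- The matrix of the edge weights. -/
noncomputable def weightMatrix {n : ℕ} (G : SimpleGraph (Fin n)) (w : Sym2 (Fin n) → ℝ)
    (u v : ℕ) : ℝ :=
  if h : u < n ∧ v < n then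
    if G.Adj ⟨u, h.1⟩ ⟨v, h.2⟩ then w s(⟨u, h.1⟩, ⟨v, h.2⟩) else 0 else 0

/-- The adjacency relation on natural numbers. -/
def AdjBelow {n : ℕ} (G : SimpleGraph (Fin n)) (u v : ℕ) : Prop :=
  ∃ (hu : u < n) (hv : v < n), G.Adj ⟨u, hu⟩ ⟨v, hv⟩

/-- Each unordered pair of distinct vertices comes from two ordered ones, of which the order on `Fin
n` selects one. -/
theorem sum_sym2_eq {n : ℕ} (f : Sym2 (Fin n) → ℝ) (hf : ∀ e, e.IsDiag → f e = 0) :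
    2 * ∑ e, f e = ∑ u, ∑ v, f s(u, v) := by
  classical
  have h1 : ∑ e, f e = ∑ i ∈ (Finset.univ : Finset (Fin n)).offDiag with i.1 < i.2,
      f s(i.1, i.2) := by
    rw [← Finset.sum_sym2_filter_not_isDiag, Finset.sym2_univ, Finset.sum_filter]
    refine Finset.sum_congr rfl fun e _ => ?_
    split_ifs with h
    · exact hf e h
    · rfl
  have h2 : ∑ u, ∑ v, f s(u, v) = ∑ p : Fin n × Fin n, f s(p.1, p.2) :=
    (Fintype.sum_prod_type' fun u v => f s(u, v)).symm
  have h3 : ∑ p : Fin n × Fin n, f s(p.1, p.2) =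
      ∑ p : Fin n × Fin n, ((if p.1 < p.2 then f s(p.1, p.2) else 0) +
        if p.2 < p.1 then f s(p.1, p.2) else 0) := by
    refine Finset.sum_congr rfl fun p _ => ?_
    rcases lt_trichotomy p.1 p.2 with h | h | h
    · simp [h, h.not_gt]
    · simp [h, hf]
    · simp [h, h.not_gt]
  have h4 : ∑ p : Fin n × Fin n, (if p.2 < p.1 then f s(p.1, p.2) else 0) =
      ∑ p : Fin n × Fin n, if p.1 < p.2 then f s(p.1, p.2) else 0 := by
    refine Fintype.sum_equiv (Equiv.prodComm _ _) _ _ fun p => ?_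
    simp [Sym2.eq_swap]
  have h5 : ∑ p : Fin n × Fin n, (if p.1 < p.2 then f s(p.1, p.2) else 0) = ∑ e, f e := by
    rw [h1, ← Finset.sum_filter]
    refine Finset.sum_congr ?_ fun _ _ => rfl
    ext p
    simp only [Finset.mem_filter, Finset.mem_univ, true_and, Finset.mem_offDiag]
    exact ⟨fun h => ⟨h.ne, h⟩, fun h => h.2⟩
  rw [h2, h3, Finset.sum_add_distrib, h4, h5, two_mul]

/-- The factor `2` does not affect comparisons, and it lets the program add up the full symmetric
matrix. -/
theorem two_mul_coveredWeight {n : ℕ} (G : SimpleGraph (Fin n)) (w : Sym2 (Fin n) → ℝ)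
    (S : Finset (Fin n)) :
    2 * G.coveredWeight w S = matrixCover n (weightMatrix G w) (S.map Fin.valEmbedding) := by
  classical
  rw [SimpleGraph.coveredWeight, Finset.sum_filter, sum_sym2_eq, matrixCover, Finset.sum_range]
  · refine Finset.sum_congr rfl fun u _ => ?_
    rw [Finset.sum_range]
    refine Finset.sum_congr rfl fun v _ => ?_
    have hu : (u : ℕ) ∈ S.map Fin.valEmbedding ↔ u ∈ S := by
      simp [Fin.val_inj]
    have hv : (v : ℕ) ∈ S.map Fin.valEmbedding ↔ v ∈ S := by
      simp [Fin.val_inj]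
    have hex : (∃ x ∈ S, x ∈ s(u, v)) ↔ u ∈ S ∨ v ∈ S := by
      simp only [Sym2.mem_iff]
      grind
    simp only [hu, hv, hex, weightMatrix, SimpleGraph.mem_edgeSet, Fin.is_lt, and_self, dif_pos,
      Fin.eta]
    by_cases h1 : G.Adj u v <;> by_cases h2 : u ∈ S ∨ v ∈ S <;> simp [h1, h2]
  · intro e he
    rw [if_neg]
    rintro ⟨h, -⟩
    exact G.not_isDiag_of_mem_edgeSet h he

variable {n d k : ℕ} {G : SimpleGraph (Fin n)} {w : Sym2 (Fin n) → ℝ}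

theorem weightMatrix_symm (u v : ℕ) : weightMatrix G w u v = weightMatrix G w v u := by
  unfold weightMatrix
  by_cases h : u < n ∧ v < n
  · rw [dif_pos h, dif_pos h.symm, Sym2.eq_swap, G.adj_comm]
  · rw [dif_neg h, dif_neg fun h' => h h'.symm]

theorem weightMatrix_self (v : ℕ) : weightMatrix G w v v = 0 := by
  simp [weightMatrix]

theorem weightMatrix_nonneg (hw : ∀ e ∈ G.edgeSet, 0 < w e) (u v : ℕ) :
    0 ≤ weightMatrix G w u v := by
  unfold weightMatrix
  split_ifs with h h'
  · exact (hw _ h').le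
  · exact le_rfl
  · exact le_rfl

theorem adjBelow_of_weightMatrix_ne_zero {u v : ℕ} (h : weightMatrix G w u v ≠ 0) :
    AdjBelow G u v := by
  unfold weightMatrix at h
  split_ifs at h with h1 h2
  · exact ⟨h1.1, h1.2, h2⟩
  · exact absurd rfl h
  · exact absurd rfl h

theorem AdjBelow.symm {u v : ℕ} (h : AdjBelow G u v) : AdjBelow G v u := by
  obtain ⟨hu, hv, h⟩ := h
  exact ⟨hv, hu, h.symm⟩

theorem exists_card_below_le (hG : G.IsDegenerate d) (U : Finset ℕ) (hU : U ⊆ Finset.range n)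
    (hne : U.Nonempty) : ∃ u ∈ U, (below n fun v => AdjBelow G u v ∧ v ∈ U).card ≤ d := by
  classical
  set U' : Finset (Fin n) := Finset.univ.filter fun v => (v : ℕ) ∈ U with hU'
  obtain ⟨x, hx⟩ := hne
  have hxn := Finset.mem_range.1 (hU hx)
  obtain ⟨v, hv, hd⟩ := hG U' ⟨⟨x, hxn⟩, by simp [hU', hx]⟩
  refine ⟨v, by simpa [hU'] using hv, le_trans (le_of_eq ?_) hd⟩
  have h1 : ((U' : Set (Fin n)) ∩ G.neighborSet v) =
      ((U'.filter fun y => G.Adj v y : Finset (Fin n)) : Set (Fin n)) := by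
    ext y
    simp
  rw [h1, Set.ncard_coe_finset, ← Finset.card_map Fin.valEmbedding]
  congr 1
  ext y
  simp only [mem_below, AdjBelow, Finset.mem_map, Finset.mem_filter, hU', Finset.mem_univ,
    true_and, Fin.valEmbedding_apply]
  constructor
  · rintro ⟨hy, ⟨_, _, hadj⟩, hyU⟩
    exact ⟨⟨y, hy⟩, ⟨hyU, hadj⟩, rfl⟩
  · rintro ⟨z, ⟨hz, hadj⟩, rfl⟩
    exact ⟨z.2, ⟨v.2, z.2, hadj⟩, hz⟩

theorem map_output (s : State) :
    (output n s).map Fin.valEmbedding = below n fun v => s.mem 1 v ≠ 0 := by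
  ext y
  simp only [output, Finset.mem_map, Finset.mem_filter, Finset.mem_univ, true_and,
    Fin.valEmbedding_apply, mem_below]
  constructor
  · rintro ⟨z, hz, rfl⟩
    exact ⟨z.2, hz⟩
  · rintro ⟨hy, h⟩
    exact ⟨⟨y, hy⟩, h, rfl⟩

theorem Found.output_optimal {S : Finset ℕ} {s : State}
    (hS : IsFirstOptimal n k (weightMatrix G w) S) (h : Found n k (weightMatrix G w) S s) :
    (output n s).card = k ∧ ∀ T : Finset (Fin n), T.card = k →
      G.coveredWeight w T ≤ G.coveredWeight w (output n s) := by
  obtain ⟨⟨h1, h2⟩, h3⟩ := h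
  refine ⟨by rw [← Finset.card_map Fin.valEmbedding, map_output, h1], fun T hT => ?_⟩
  have h4 := hS.le (T.map Fin.valEmbedding) (fun x hx => by
    obtain ⟨z, -, rfl⟩ := Finset.mem_map.1 hx
    exact Finset.mem_range.2 z.2) (by rw [Finset.card_map, hT])
  rw [← two_mul_coveredWeight] at h4
  rw [← map_output, ← two_mul_coveredWeight] at h2
  linarith

/-! ### The algorithm -/

/-- Orient the graph and initialize the stack. -/
def Cmd.prepare : Cmd := .seq .orient (.copy 5 0)

/-- The algorithm for the maximum weight of edges covered by `k` vertices. -/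
def algorithm : Prog :=
  .seq (.instr (.const 2 1)) (.seq Cmd.prepare.toProg (.while (.lt 3 5) Cmd.body.toProg))

/-- The algorithm finds an optimal set, in a number of steps that is bounded in terms of some
`D ≤ d`. -/
theorem exec_algorithm (hG : G.IsDegenerate d) (hw : ∀ e ∈ G.edgeSet, 0 < w e) (hk0 : 0 < k)
    (hk : k ≤ n) : ∃ (D : ℕ) (s : State) (t : ℕ), D ≤ d ∧ D ≤ n ∧
      Exec algorithm (input G w k) s t ∧
      (∀ N M : ℕ, N = (n * n + 3) * (n + 1) * 2 ^ ((D + 1) * k) →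
        M = n + (Cmd.prepare.bound n + N * Cmd.body.bound n) * (n + 3) →
        t ≤ 2 + (Cmd.prepare.bound n + 1 + N * (Cmd.body.bound n + 1)) * (1 + 3 * M.size)) ∧
      (output n s).card = k ∧ ∀ T : Finset (Fin n), T.card = k →
        G.coveredWeight w T ≤ G.coveredWeight w (output n s) := by
  classical
  have hn : 0 < n := by omega
  -- The input has `0` in register `2`; the first instruction supplies the `1` required by `Std`.
  set s₀ := (Instr.const 2 1).apply (input G w k) with hs₀
  have hstd : Std n s₀ := ⟨by simp [hs₀, input], by simp [hs₀], by simp [hs₀, input],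
    by simp [hs₀, input]⟩
  have hmem0 : ∀ u < n, ∀ v < n, s₀.mem 0 (u * n + v) ≠ 0 ↔ AdjBelow G u v := by
    intro u hu v hv
    have := matrixArray_apply (fun u v => if G.Adj u v then 1 else 0) ⟨u, hu⟩ ⟨v, hv⟩
    simp only at this
    simp [hs₀, input, this, AdjBelow, hu, hv]
  have hrmem : ∀ u < n, ∀ v < n, s₀.rmem 0 (u * n + v) = weightMatrix G w u v := by
    intro u hu v hv
    have := matrixArray_apply (fun u v => if G.Adj u v then w s(u, v) else 0) ⟨u, hu⟩ ⟨v, hv⟩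
    simp only at this
    simp [hs₀, input, this, weightMatrix, hu, hv]
  have hV : s₀.BoundedBy n := by
    refine ⟨fun x => ?_, fun a i => ?_⟩
    · simp only [hs₀, Instr.apply, input, Function.update_apply]
      split_ifs <;> omega
    · simp only [hs₀, Instr.apply, input, matrixArray]
      split_ifs <;> omega
  have horient := eval_orient (d := d) (a := AdjBelow G) hstd (by simp [hs₀, input])
    (by simp [hs₀, input]) (by simp [hs₀, input]) (fun _ _ => AdjBelow.symm) hmem0
    (exists_card_below_le hG)
  have hag := Cmd.agree_eval .orient s₀
  set s₁ := Cmd.orient.eval s₀ with hs₁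
  have hstd₁ : Std n s₁ := hstd.eval rfl
  set s₂ := (Cmd.copy 5 0).eval s₁ with hs₂
  have heq : Cmd.prepare.eval s₀ = s₂ := rfl
  have hstd₂ : Std n s₂ := hstd₁.eval rfl
  set D := s₁.reg 6 with hD
  -- The orientation loop removes `n` numbers below `n`, hence all of them, so every edge has been
  -- directed.
  have hremoved : ∀ u < n, s₁.mem 7 u ≠ 0 := by
    have h1 : (below n fun v => s₁.mem 7 v ≠ 0) = Finset.range n :=
      Finset.eq_of_subset_of_card_le (below_subset_range n _) (by simpa using horient.removed)
    intro u hu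
    have h2 : u ∈ below n fun v => s₁.mem 7 v ≠ 0 := by rw [h1]; exact Finset.mem_range.2 hu
    exact (mem_below.1 h2).2
  have hdata : HoldsData n k D (weightMatrix G w) (fun u v => s₁.mem 5 (u * n + v) ≠ 0) s₂ := by
    refine ⟨hstd₂, ?_, by simp [hs₂, hD], fun u hu v hv => ?_, fun u hu v hv => ?_⟩
    · have h1 := hag.reg 1 (by decide)
      simp [hs₂, h1, hs₀, input]
    · have h1 := hag.rmem (by decide)
      simp only [hs₂, Cmd.eval_instr, Instr.apply, h1]
      exact hrmem u hu v hv
    · simp [hs₂]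
  obtain ⟨S, hS⟩ := exists_isFirstOptimal (weightMatrix G w) hk
  have hI : SearchInstance n k D (weightMatrix G w) (fun u v => s₁.mem 5 (u * n + v) ≠ 0) S := by
    refine ⟨weightMatrix_symm, weightMatrix_self, weightMatrix_nonneg hw, fun u v huv => ?_,
      horient.outdegree, hS⟩
    have ha := adjBelow_of_weightMatrix_ne_zero huv
    exact horient.arc u ha.1 v ha.2.1 ha (.inl (hremoved u ha.1))
  have hstack : HasStack n s₂ [fun _ => 0] := by
    have h1 := hag.mem 2 (by decide)
    refine ⟨by simp [hs₂, hstd₁.reg_zero, hstd₁.reg_three], fun i hi v hv => ?_⟩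
    have : i = 0 := by simpa using hi
    subst this
    simp [hs₂, h1, hs₀, input]
  have hinv : SearchInv n k (weightMatrix G w) (fun u v => s₁.mem 5 (u * n + v) ≠ 0) S
      [fun _ => 0] s₂ := by
    have h1 := hag.rreg 1 (by decide)
    exact ⟨.inl (by simp [hs₂, h1, hs₀, input]), .inr ⟨_, by simp, isGood_zero⟩⟩
  obtain ⟨σ, γ, hr⟩ := exists_rates D
  -- `N` bounds the weight of the blank colouring for `A = 2 ^ (D + 1)`, and thereby the number of
  -- passages through the main loop.
  obtain ⟨N, hN⟩ : ∃ N : ℕ, N = (n * n + 3) * (n + 1) * 2 ^ ((D + 1) * k) := ⟨_, rfl⟩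
  obtain ⟨M, hM⟩ : ∃ M : ℕ, M = n + (Cmd.prepare.bound n + N * Cmd.body.bound n) * (n + 3) :=
    ⟨_, rfl⟩
  have hweight : (([fun _ => 0] : List (ℕ → ℕ)).map (weight n k D
      (fun u v => s₁.mem 5 (u * n + v) ≠ 0) (2 ^ (D + 1)) σ γ)).sum ≤ N := by
    have h1 := weight_zero_le (n := n) (k := k) (D := D)
      (O := fun u v => s₁.mem 5 (u * n + v) ≠ 0) (A := 2 ^ (D + 1)) (σ := σ) (γ := γ)
      (one_le_pow₀ (by norm_num))
    rw [← pow_mul] at h1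
    rw [hN]
    push_cast
    simpa using h1
  have hM₁ : n + Cmd.prepare.bound n * (n + 3) ≤ M := by
    rw [hM, add_mul, ← add_assoc]
    exact Nat.le_add_right _ _
  have hM₂ : n + Cmd.prepare.bound n * (n + 3) + N * Cmd.body.bound n * (n + 3) ≤ M := by
    rw [hM, add_mul, ← add_assoc]
  obtain ⟨t₁, ht₁, he₁, hV₁⟩ := Cmd.exec (M := M) Cmd.prepare s₀ n rfl hstd hV hM₁
  rw [heq] at he₁ hV₁
  obtain ⟨s, t₂, he₂, ht₂, hf⟩ := exec_search hI hr hn horient.le_width hk N s₂ _ _ hdata hstack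
    hinv hV₁ hweight hM₂
  obtain ⟨hcard, hopt⟩ := hf.output_optimal hS
  have hex : Exec algorithm (input G w k) s (_ + (t₁ + t₂)) := .seq (.instr _ _) (.seq he₁ he₂)
  refine ⟨D, s, _, horient.le, horient.le_width, hex, ?_, hcard, hopt⟩
  rintro N' M' rfl rfl
  rw [← hN, ← hM]
  have hc : (Instr.const 2 1).cost (input G w k) = 2 := by simp [Instr.cost]
  rw [hc]
  generalize Cmd.prepare.bound n = b₁ at ht₁
  generalize 1 + 3 * M.size = κ at ht₁ ht₂
  refine Nat.add_le_add_left ((add_le_add ht₁ ht₂).trans (le_of_eq ?_)) 2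
  ring

/-- The time bound of the algorithm is single exponential in `(D + 1) * k` up to a polynomial. -/
theorem exists_time_bound : ∃ C : ℕ, ∀ n k D N M : ℕ, 0 < n → k ≤ n → D ≤ n →
    N = (n * n + 3) * (n + 1) * 2 ^ ((D + 1) * k) →
    M = n + (Cmd.prepare.bound n + N * Cmd.body.bound n) * (n + 3) →
    2 + (Cmd.prepare.bound n + 1 + N * (Cmd.body.bound n + 1)) * (1 + 3 * M.size) ≤
      C * 2 ^ ((D + 1) * k) * n ^ C := by
  obtain ⟨a, ha⟩ := (Cmd.seq .prepare .body).exists_bound_le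
  -- The `9` comes from `1 + N ≤ 9 * n ^ 3 * E`, the factor `a + 1` from the step bounds, `111 * a +
  -- 22 = 1 + 3 * (37 * a + 7)` from the length of `M`, and the `2` from the first instruction.
  refine ⟨2 + 9 * (a + 1) * (111 * a + 22), fun n k D N M hn hk hD hN hM => ?_⟩
  set E := 2 ^ ((D + 1) * k) with hE
  have hE1 : 1 ≤ E := Nat.one_le_two_pow
  have hab := ha n hn
  simp only [Cmd.bound] at hab
  set b₁ := Cmd.prepare.bound n
  set b₂ := Cmd.body.bound n
  have hpow : ∀ m, 1 ≤ n ^ m := fun m => Nat.one_le_pow _ _ hn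
  have hNle : N ≤ 8 * n ^ 3 * E := by
    rw [hN]
    have h1 : n * n + 3 ≤ 4 * n ^ 2 := by nlinarith
    have h2 : n + 1 ≤ 2 * n := by omega
    calc (n * n + 3) * (n + 1) * E ≤ (4 * n ^ 2) * (2 * n) * E := by gcongr
      _ = _ := by ring
  have hEn : 1 ≤ n ^ 3 * E := Nat.mul_pos (hpow 3) hE1
  have hN1 : 1 + N ≤ 9 * n ^ 3 * E := by nlinarith
  have hMle : M ≤ (1 + 36 * a) * n ^ (a + 4) * E := by
    have h1 : b₁ + N * b₂ ≤ a * n ^ a * (9 * n ^ 3 * E) := by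
      calc b₁ + N * b₂ ≤ (b₁ + b₂) * (1 + N) := by nlinarith
        _ ≤ _ := by gcongr
    have h2 : n + 3 ≤ 4 * n := by omega
    have h3 : n ≤ n ^ (a + 4) * E :=
      (Nat.le_self_pow (by omega) n).trans (Nat.le_mul_of_pos_right _ hE1)
    rw [hM]
    calc n + (b₁ + N * b₂) * (n + 3) ≤
          n ^ (a + 4) * E + (a * n ^ a * (9 * n ^ 3 * E)) * (4 * n) := by gcongr
      _ = (1 + 36 * a) * n ^ (a + 4) * E := by ring
  -- Because `D ≤ n` and `k ≤ n`, the exponent of `E` is at most `(n + 1) * n`, so all numbers have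
  -- length polynomial in `n` alone.
  have hsize : M.size ≤ n ^ 2 * (37 * a + 7) := by
    have h1 : M < 2 ^ ((36 * a + 1) + n * (a + 4) + (n + 1) * n) := by
      refine hMle.trans_lt ?_
      have h2 : 1 + 36 * a < 2 ^ (36 * a + 1) := by
        rw [add_comm]; exact Nat.lt_two_pow_self
      have h3 : n ^ (a + 4) ≤ 2 ^ (n * (a + 4)) := by
        rw [pow_mul]; exact Nat.pow_le_pow_left Nat.lt_two_pow_self.le _
      have h4 : E ≤ 2 ^ ((n + 1) * n) := Nat.pow_le_pow_right (by norm_num) (by gcongr)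
      rw [pow_add 2 _ ((n + 1) * n), pow_add 2 (36 * a + 1)]
      calc (1 + 36 * a) * n ^ (a + 4) * E < 2 ^ (36 * a + 1) * n ^ (a + 4) * E := by
            have := hpow (a + 4); gcongr
        _ ≤ _ := by gcongr
    refine (Nat.size_le.2 h1).trans ?_
    have h2 : n ≤ n ^ 2 := Nat.le_self_pow (by norm_num) n
    have h3 := hpow 2
    nlinarith
  have hκ : 1 + 3 * M.size ≤ n ^ 2 * (111 * a + 22) := by
    have := hpow 2
    nlinarith
  have hsteps : b₁ + 1 + N * (b₂ + 1) ≤ (a + 1) * n ^ a * (9 * n ^ 3 * E) := by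
    have h1 := hpow a
    calc b₁ + 1 + N * (b₂ + 1) ≤ (b₁ + b₂ + 1) * (1 + N) := by nlinarith
      _ ≤ ((a + 1) * n ^ a) * (9 * n ^ 3 * E) := by gcongr; nlinarith
  set K := 9 * (a + 1) * (111 * a + 22) with hK
  have hle : a + 5 ≤ 2 + K := by rw [hK]; nlinarith
  calc 2 + (b₁ + 1 + N * (b₂ + 1)) * (1 + 3 * M.size) ≤
        2 + ((a + 1) * n ^ a * (9 * n ^ 3 * E)) * (n ^ 2 * (111 * a + 22)) := by gcongr
    _ = 2 + K * E * n ^ (a + 5) := by rw [hK]; ring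
    _ ≤ 2 * E * n ^ (a + 5) + K * E * n ^ (a + 5) := by
      have : 1 ≤ E * n ^ (a + 5) := Nat.mul_pos hE1 (hpow _)
      nlinarith
    _ = (2 + K) * E * n ^ (a + 5) := by ring
    _ ≤ (2 + K) * E * n ^ (2 + K) := by gcongr

/-- At `m = 0` the conventions `Real.log 0 = 0` and `0 ^ 0 = 1` make the value `1`, as the reading
of the middle factor for `d = 0` demands. -/
theorem one_le_natCast_rpow_mul_log (m C : ℕ) :
    (1 : ℝ) ≤ (m : ℝ) ^ ((C : ℝ) * Real.log (m : ℝ)) := by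
  rcases Nat.eq_zero_or_pos m with rfl | hm
  · simp
  · have h1 : (1 : ℝ) ≤ m := by exact_mod_cast hm
    exact Real.one_le_rpow h1 (mul_nonneg C.cast_nonneg (Real.log_nonneg h1))

end RealRAM

theorem theorem1 :
    ∃ (P : RealRAM.Prog) (C : ℕ),
      ∀ (n k d : ℕ) (G : SimpleGraph (Fin n)) (w : Sym2 (Fin n) → ℝ),
        G.IsDegenerate d → (∀ e ∈ G.edgeSet, 0 < w e) → 0 < k → k ≤ n →
        ∃ (s : RealRAM.State) (t : ℕ),
          RealRAM.Exec P (RealRAM.input G w k) s t ∧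
          (t : ℝ) ≤ (C : ℝ) * (2 : ℝ) ^ (k * d + k) *
            ((k * d : ℕ) : ℝ) ^ ((C : ℝ) * Real.log ((k * d : ℕ) : ℝ)) * (n : ℝ) ^ C ∧
          (RealRAM.output n s).card = k ∧
          ∀ S : Finset (Fin n), S.card = k →
            G.coveredWeight w S ≤ G.coveredWeight w (RealRAM.output n s) := by
  obtain ⟨C, hC⟩ := RealRAM.exists_time_bound
  refine ⟨RealRAM.algorithm, C, fun n k d G w hG hw hk0 hk => ?_⟩
  obtain ⟨D, s, t, hDd, hDn, he, ht, hcard, hopt⟩ := RealRAM.exec_algorithm hG hw hk0 hk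
  refine ⟨s, t, he, ?_, hcard, hopt⟩
  have h1 : t ≤ C * 2 ^ (k * d + k) * n ^ C := by
    refine (ht _ _ rfl rfl).trans ((hC n k D _ _ (by omega) hk hDn rfl rfl).trans ?_)
    -- The running time depends on the bound `D` that the program found; `D ≤ d` turns it into a
    -- bound in terms of `d`.
    have : (D + 1) * k ≤ k * d + k := by
      calc (D + 1) * k ≤ (d + 1) * k := by gcongr
        _ = k * d + k := by ring
    gcongr
    norm_num
  have h2 : (t : ℝ) ≤ C * 2 ^ (k * d + k) * n ^ C := by exact_mod_cast h1
  have h3 := RealRAM.one_le_natCast_rpow_mul_log (k * d) C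
  calc (t : ℝ) ≤ C * 2 ^ (k * d + k) * 1 * n ^ C := by rwa [mul_one]
    _ ≤ _ := by gcongr
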